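/- **Setting.** A closed-loop structured system $(\bar A,\bar B,\bar C,\bar K)$ consists of matrices $\bar A\in\{\star,0\}^{n\times n}$, $\bar B\in\{\star,0\}^{n\times m}$, $\bar C\in\{\star,0\}^{p\times n}$, $\bar K\in\{\star,0\}^{m\times p}$. A real matrix realizes such a pattern if it vanishes wherever the pattern is $0$; $[K]$ is the set of realizations of $\bar K$. The system has *no structurally fixed modes* (no SFMs) if for some realization $(A,B,C)$ of $(\bar A,\bar B,\bar C)$ one has $\bigcap_{K\in[K]}\sigma(A+BKC)=\emptyset$, where $\sigma$ is the set of complex eigenvalues. For $\mathcal I\subseteq\{1,\dots,m\}\times\{1,\dots,p\}$ let $\bar K^{\mathcal I}$ be $\bar K$ with the entries in $\mathcal I$ replaced by $0$. The system is *resilient to any $\gamma$ feedback-link failures* if $(\bar A,\bar B,\bar C,\bar K^{\mathcal I})$ has no SFMs for every $\mathcal I$ with $|\mathcal I|\le\gamma$. The state digraph $\mathcal D(\bar A)$ on $x_1,\dots,x_n$ has an edge $(x_j,x_i)$ iff $\bar A_{ij}=\star$; it is irreducible if there is a directed path between any two of its vertices. The system bipartite graph $\mathcal B(\bar A,\bar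 B,\bar C,\bar K)$ has left vertices $x'_i,u'_i,y'_i$ and right vertices $x_i,u_i,y_i$ (states, inputs, outputs) and the edges $(x'_i,x_j)$ if $\bar A_{ij}=\star$, $(x'_i,u_j)$ if $\bar B_{ij}=\star$, $(y'_i,x_j)$ if $\bar C_{ij}=\star$, $(u'_i,y_j)$ if $\bar K_{ij}=\star$, and all $(u'_i,u_i)$ and $(y'_i,y_i)$. The edges $(u'_i,y_j)$ are the feedback edges; $\mathcal E_K$ is their set. **Procedure** for $\gamma\ge1$, a bipartite graph $\mathcal B_\gamma$ and a set $S_\gamma$ of its edges. Find a perfect matching $M_\gamma$ of $\mathcal B_\gamma$ of minimum cost, where edges in $S_\gamma$ cost $1$ and all others $0$; if there is no perfect matching, return False. Let $F_\gamma=M_\gamma\cap S_\gamma$. For $q=0,1,\dots,\gamma-1$ and every set $R$ of $\gamma-q$ edges of $F_\gamma$, remove $R$ from $\mathcal B_\gamma$; if $q=0$, check that the remaining graph has a perfect matching; if $q\ge1$, apply the procedure for $q$ to the remaining graph and the edge set $S_\gamma\setminus F_\gamma$. Return False as soon as one of these checks fails, and True otherwise. (Removals from $S_\gamma\setminus F_\gamma$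 alone need no check, as $M_\gamma$ survives them.) **Theorem 8.** Let $(\bar A,\bar B,\bar C,\bar K)$ be a closed-loop structured system such that $\mathcal D(\bar A)$ is irreducible and every perfect matching of $\mathcal B(\bar A,\bar B,\bar C,\bar K)$ contains a feedback edge, and let $\gamma\ge1$. Then the procedure, applied to $\mathcal B(\bar A,\bar B,\bar C,\bar K)$ and $\mathcal E_K$, returns True if and only if the system is resilient to any $\gamma$ feedback-link failures, whichever minimum cost perfect matchings are chosen. Moreover, when $m=O(n)$ and $p=O(n)$, it can be carried out on a unit-cost random access machine (with the Hungarian method for the minimum cost perfect matchings, and augmenting paths for the existence checks) in time $O(2^{\gamma-1}n^{\gamma+2.5})$, where the implied constant depends only on the constants in $m=O(n)$, $p=O(n)$, and not on $\gamma$. -/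

import Mathlib

/-! ## Structured systems, fixed modes and resilience -/

/-- A closed-loop structured system with `n` states, `m` inputs and `p` outputs: the patterns of the
state, input, output and feedback matrices. An entry `true` is a free parameter (a star), an entry
`false` is a fixed zero. `K i j = true` means that output `j` is fed back to input `i`. -/
structure ClosedLoop (n m p : ℕ) where
  A : Matrix (Fin n) (Fin n) Bool
  B : Matrix (Fin n) (Fin m) Bool
  C : Matrix (Fin p) (Fin n) Bool
  K : Matrix (Fin m) (Fin p) Bool

/-- The numerical matrix `X` has the structure `P`: it vanishes wherever `P` has a fixed zero. -/
def HasPattern {k l : ℕ} (P : Matrix (Fin k) (Fin l) Bool) (X : Matrix (Fin k) (Fin l) ℝ) : Prop :=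
  ∀ i j, P i j = false → X i j = 0

namespace ClosedLoop

variable {n m p : ℕ}

/-- No structurally fixed modes: for some numerical realization `(A, B, C)`, the matrices
`A + B K C`, with `K` ranging over the real matrices of the feedback pattern, have no common
(complex) eigenvalue. -/
def NoSFM (sys : ClosedLoop n m p) : Prop :=
  ∃ (A : Matrix (Fin n) (Fin n) ℝ) (B : Matrix (Fin n) (Fin m) ℝ) (C : Matrix (Fin p) (Fin n) ℝ),
    HasPattern sys.A A ∧ HasPattern sys.B B ∧ HasPattern sys.C C ∧
      (⋂ K ∈ {K : Matrix (Fin m) (Fin p) ℝ | HasPattern sys.K K},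
        spectrum ℂ ((A + B * K * C).map (algebraMap ℝ ℂ))) = ∅

/-- The system after failure of the feedback links with indices in `I`. -/
def failLinks (sys : ClosedLoop n m p) (I : Finset (Fin m × Fin p)) : ClosedLoop n m p :=
  { sys with K := fun i j => if (i, j) ∈ I then false else sys.K i j }

/-- The system keeps having no structurally fixed modes whenever at most `γ` feedback links fail. -/
def Resilient (sys : ClosedLoop n m p) (γ : ℕ) : Prop :=
  ∀ I : Finset (Fin m × Fin p), I.card ≤ γ → (sys.failLinks I).NoSFM

/-- The edges of the state digraph: there is an edge from `x_j` to `x_i` if `A i j` is a star. -/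
def StateEdge (sys : ClosedLoop n m p) (j i : Fin n) : Prop := sys.A i j = true

/-- The state digraph is irreducible (strongly connected): there is a directed path between any two
vertices. -/
def Irreducible (sys : ClosedLoop n m p) : Prop :=
  ∀ i j : Fin n, Relation.ReflTransGen sys.StateEdge i j

end ClosedLoop

/-! ## Bipartite graphs and matchings

A bipartite graph whose two sides are copies `V'` and `V` of the same finite set is given by its
adjacency matrix: `G a b = true` if the left vertex `a'` is joined to the right vertex `b`. The
same type is used for sets of edges. -/

abbrev BGraph (V : Type) := V → V → Bool

section Matchings

variable {V : Type}

/-- `M` is a matching of `G`: a set of edges no two of which have a common endpoint. -/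
def IsMatching (G : BGraph V) (M : Finset (V × V)) : Prop :=
  (∀ e ∈ M, G e.1 e.2 = true) ∧ ∀ e ∈ M, ∀ f ∈ M, e ≠ f → e.1 ≠ f.1 ∧ e.2 ≠ f.2

/-- A perfect matching: a matching whose cardinality is that of the left side. -/
def IsPerfectMatching [Fintype V] (G : BGraph V) (M : Finset (V × V)) : Prop :=
  IsMatching G M ∧ M.card = Fintype.card V

/-- The cost of a set of edges when the edges in `S` cost `1` and all others cost `0`. -/
def edgeCost (S : BGraph V) (M : Finset (V × V)) : ℕ := ∑ e ∈ M, if S e.1 e.2 then 1 else 0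

/-- A minimum cost perfect matching for the cost function `edgeCost S`. -/
def IsMinCostPM [Fintype V] (G S : BGraph V) (M : Finset (V × V)) : Prop :=
  IsPerfectMatching G M ∧ ∀ M', IsPerfectMatching G M' → edgeCost S M ≤ edgeCost S M'

/-- A matching as it is stored by the algorithms: `toR a` is the right vertex matched to the left
vertex `a'`, and `toL b` is the left vertex matched to the right vertex `b`. -/
structure Mates (V : Type) where
  toR : V → Option V
  toL : V → Option V

/-- The two arrays describe the same matching. -/
def Mates.Consistent (M : Mates V) : Prop := ∀ a b, M.toR a = some b ↔ M.toL b = some a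

variable [DecidableEq V]

/-- The set of matched pairs. -/
def Mates.edges [Fintype V] (M : Mates V) : Finset (V × V) :=
  Finset.univ.filter fun e => M.toR e.1 = some e.2

/-- Match the left vertex `a` with the right vertex `b`. -/
def Mates.join (M : Mates V) (a b : V) : Mates V :=
  ⟨Function.update M.toR a (some b), Function.update M.toL b (some a)⟩

/-- Unmatch the left vertex `a` and the right vertex `b`. -/
def Mates.cut (M : Mates V) (a b : V) : Mates V :=
  ⟨Function.update M.toR a none, Function.update M.toL b none⟩

end Matchings

namespace ClosedLoop

variable {n m p : ℕ}

/-- The vertices on either side of the system bipartite graph: states, inputs, outputs. -/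
abbrev Vertex (n m p : ℕ) := Fin n ⊕ Fin m ⊕ Fin p

/-- The list of all vertices. -/
def vertices (n m p : ℕ) : List (Vertex n m p) :=
  (List.finRange n).map Sum.inl ++
    ((List.finRange m).map (fun i => Sum.inr (Sum.inl i)) ++
      (List.finRange p).map (fun i => Sum.inr (Sum.inr i)))

/-- The system bipartite graph. The first argument is the left (primed) vertex. -/
def bipartite (sys : ClosedLoop n m p) : BGraph (Vertex n m p)
  | .inl i, .inl j => sys.A i j
  | .inl i, .inr (.inl j) => sys.B i j
  | .inl _, .inr (.inr _) => false
  | .inr (.inl _), .inl _ => false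
  | .inr (.inl i), .inr (.inl j) => decide (i = j)
  | .inr (.inl i), .inr (.inr j) => sys.K i j
  | .inr (.inr i), .inl j => sys.C i j
  | .inr (.inr _), .inr (.inl _) => false
  | .inr (.inr i), .inr (.inr j) => decide (i = j)

/-- The set of feedback edges of the system bipartite graph. -/
def feedbackEdges (sys : ClosedLoop n m p) : BGraph (Vertex n m p)
  | .inr (.inl i), .inr (.inr j) => sys.K i j
  | _, _ => false

end ClosedLoop

/-! ## Step counting

Unit-cost random access machine: a computation is a value together with the number of steps taken.
Functions on the vertices (or on pairs of vertices) are arrays; a `Function.update` is an assignment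
to one cell, and the old content of an array is never used after an assignment. -/

structure Timed (α : Type) where
  val : α
  time : ℕ

namespace Timed

instance : Monad Timed where
  pure x := ⟨x, 0⟩
  bind x f := ⟨(f x.val).val, x.time + (f x.val).time⟩

/-- `x` is computed from the data at hand in `k` steps. -/
def charge {α : Type} (k : ℕ) (x : α) : Timed α := ⟨x, k⟩

/-- A single step: `x` is computed by a bounded number of array reads and writes, arithmetical
operations and comparisons, and list operations at the head. -/
def step {α : Type} (x : α) : Timed α := charge 1 x

/-- A loop over a list with a running state; every round costs one step besides its body. -/
def foldT {α σ : Type} (body : σ → α → Timed σ) : σ → List α → Timed σ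
  | s, [] => step s
  | s, a :: l => do
    let s₁ ← step s
    let s₂ ← body s₁ a
    foldT body s₂ l

/-- A loop over a list that stops with `false` at the first element whose test fails. -/
def allT {α : Type} (test : α → Timed Bool) : List α → Timed Bool
  | [] => step true
  | a :: l => do
    let ok ← test a
    let ok₁ ← step ok
    if ok₁ then allT test l else step false

end Timed

open Timed

/-! ## Subroutine: checking for a perfect matching

Given a graph and a matching in it, every free left vertex in turn is matched along an augmenting
path, found by a search through alternating paths. -/

/-- State of the search: `par b` is the left vertex from which the right vertex `b` was reached
(`none` if `b` has not been reached), `todo` are the left vertices to be explored, `goal` is a free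
right vertex, once one has been reached. -/
structure AltSearch (V : Type) where
  par : V → Option V
  todo : List V
  goal : Option V

section PerfectMatchingCheck

variable {V : Type} [DecidableEq V]

/-- Look at the pair `(a, b)` while `a` is explored. -/
def AltSearch.visit (G : BGraph V) (M : Mates V) (a : V) (s : AltSearch V) (b : V) :
    Timed (AltSearch V) :=
  step <|
    if s.goal.isNone && G a b && (s.par b).isNone then
      match M.toL b with
      | none => { par := Function.update s.par b (some a), todo := s.todo, goal := some b }
      | some a₁ => { par := Function.update s.par b (some a), todo := a₁ :: s.todo, goal := none }
    else s

/-- Explore left vertices until a free right vertex is reached or nothing is left to be explored.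
At most `k` vertices are explored. -/
def AltSearch.run (vs : List V) (G : BGraph V) (M : Mates V) : ℕ → AltSearch V → Timed (AltSearch V)
  | 0, s => step s
  | k + 1, s =>
    match s.goal, s.todo with
    | none, a :: l => do
      let s₁ ← foldT (AltSearch.visit G M a) { s with todo := l } vs
      AltSearch.run vs G M k s₁
    | _, _ => step s

/-- Exchange matched and unmatched edges along the path that ends in the right vertex `b`. -/
def augment (par : V → Option V) : ℕ → V → Mates V → Timed (Mates V)
  | 0, _, M => step M
  | k + 1, b, M =>
    match par b with
    | none => step M
    | some a => do
      let M₁ ← step (M.join a b)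
      match M.toR a with
      | none => step M₁
      | some b₁ => augment par k b₁ M₁

/-- If the left vertex `a` is free, try to match it; `none` records an earlier or present failure. -/
def matchVertex (vs : List V) (G : BGraph V) (s : Option (Mates V)) (a : V) :
    Timed (Option (Mates V)) :=
  match s with
  | none => step none
  | some M =>
    match M.toR a with
    | some _ => step (some M)
    | none => do
      let noPar ← charge vs.length fun _ => none
      let r ← AltSearch.run vs G M vs.length { par := noPar, todo := [a], goal := none }
      match r.goal with
      | none => step none
      | some b => do
        let M₁ ← augment r.par vs.length b M
        step (some M₁)

/-- Check whether `G` has a perfect matching, starting from the matching `M`. -/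
def checkPM (vs : List V) (G : BGraph V) (M : Mates V) : Timed Bool := do
  let r ← foldT (matchVertex vs G) (some M) vs
  step r.isSome

end PerfectMatchingCheck

/-! ## Subroutine: minimum cost perfect matching

The Hungarian method. Pairs that are not edges are admitted at a prohibitive cost. -/

/-- State of the stage in which one more left vertex is matched. `u`, `v` are the potentials of the
left and right vertices; `slack b` is the least reduced cost by which the right vertex `b` can be
reached from the alternating tree, and `way b` the right vertex of the tree preceding it then
(`none` for the root of the tree); `used b` tells whether `b` belongs to the tree; `last` is the
free right vertex in which the stage ends. -/
structure HungarianStage (V : Type) where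
  u : V → ℤ
  v : V → ℤ
  slack : V → ℤ
  way : V → Option V
  used : V → Bool
  last : Option V

/-- State between two stages: potentials and the matching, as partners of the right vertices. -/
structure HungarianState (V : Type) where
  u : V → ℤ
  v : V → ℤ
  toL : V → Option V

section MinCost

variable {V : Type} [DecidableEq V]

/-- The cost of a pair; `big` for a pair that is not an edge. -/
def pairCost (G S : BGraph V) (big : ℤ) (a b : V) : ℤ :=
  if G a b then (if S a b then 1 else 0) else big

/-- Remember the unused vertex of least slack. -/
def pickMin (s : HungarianStage V) (best : Option V) (b : V) : Timed (Option V) :=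
  step <|
    if s.used b then best
    else
      match best with
      | none => some b
      | some b₀ => if s.slack b < s.slack b₀ then some b else some b₀

/-- Change the potentials in the tree by `δ`, and the slack outside of it. -/
def shift (toL : V → Option V) (δ : ℤ) (s : HungarianStage V) (b : V) : Timed (HungarianStage V) :=
  step <|
    if s.used b then
      match toL b with
      | none => { s with v := Function.update s.v b (s.v b - δ) }
      | some a =>
        { s with
          u := Function.update s.u a (s.u a + δ)
          v := Function.update s.v b (s.v b - δ) }
    else { s with slack := Function.update s.slack b (s.slack b - δ) }

/-- Update the slack of `b` after the left vertex `a`, matched to `b₁`, has joined the tree. -/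
def relax (c : V → V → ℤ) (a b₁ : V) (s : HungarianStage V) (b : V) : Timed (HungarianStage V) :=
  step <|
    if s.used b then s
    else if c a b - s.u a - s.v b < s.slack b then
      { s with
        slack := Function.update s.slack b (c a b - s.u a - s.v b)
        way := Function.update s.way b (some b₁) }
    else s

/-- Grow the tree rooted at the left vertex `root` until it contains a free right vertex. -/
def growTree (vs : List V) (c : V → V → ℤ) (toL : V → Option V) (root : V) :
    ℕ → HungarianStage V → Timed (HungarianStage V)
  | 0, s => step s
  | k + 1, s => do
    let best ← foldT (pickMin s) none vs
    match best with
    | none => step s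
    | some b₁ => do
      let δ ← step (s.slack b₁)
      let s₁ ← foldT (shift toL δ) s vs
      let s₂ ← step
        { s₁ with
          u := Function.update s₁.u root (s₁.u root + δ)
          used := Function.update s₁.used b₁ true }
      match toL b₁ with
      | none => step { s₂ with last := some b₁ }
      | some a => do
        let s₃ ← foldT (relax c a b₁) s₂ vs
        growTree vs c toL root k s₃

/-- Exchange matched and unmatched edges along the tree path from `root` to the right vertex `b`. -/
def augmentTree (way : V → Option V) (root : V) : ℕ → V → (V → Option V) → Timed (V → Option V)
  | 0, _, toL => step toL
  | k + 1, b, toL =>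
    match way b with
    | none => step (Function.update toL b (some root))
    | some b₁ => do
      let toL₁ ← step (Function.update toL b (toL b₁))
      augmentTree way root k b₁ toL₁

/-- One stage: match the left vertex `root`. -/
def hungarianStage (vs : List V) (c : V → V → ℤ) (h : HungarianState V) (root : V) :
    Timed (HungarianState V) := do
  let s₀ ← charge (3 * vs.length)
    { u := h.u
      v := h.v
      slack := fun b => c root b - h.u root - h.v b
      way := fun _ => none
      used := fun _ => false
      last := none : HungarianStage V }
  let s ← growTree vs c h.toL root vs.length s₀
  match s.last with
  | none => step { h with u := s.u, v := s.v }
  | some b => do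
    let toL ← augmentTree s.way root vs.length b h.toL
    step { u := s.u, v := s.v, toL := toL }

/-- Enter the pair matched at the right vertex `b` into the result, unless it is not an edge. -/
def recordPair (G : BGraph V) (toL : V → Option V) (r : Option (Mates V)) (b : V) :
    Timed (Option (Mates V)) :=
  step <|
    match r, toL b with
    | some M, some a => if G a b then some (M.join a b) else none
    | _, _ => none

/-- A minimum cost perfect matching of `G`, where the edges in `S` cost `1` and all others `0`;
`none` if there is no perfect matching. -/
def minCostPM (vs : List V) (G S : BGraph V) : Timed (Option (Mates V)) := do
  let big ← charge vs.length ((vs.length : ℤ) + 1)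
  let c ← charge (vs.length ^ 2) (pairCost G S big)
  let h₀ ← charge (3 * vs.length)
    { u := fun _ => 0, v := fun _ => 0, toL := fun _ => none : HungarianState V }
  let h ← foldT (hungarianStage vs c) h₀ vs
  let M₀ ← charge (2 * vs.length) ⟨fun _ => none, fun _ => none⟩
  foldT (recordPair G h.toL) (some M₀) vs

end MinCost

/-! ## The recursive procedure -/

section Procedure

variable {V : Type} [DecidableEq V]

/-- A correct subroutine for minimum cost perfect matchings. -/
def FindsMinCostPM [Fintype V] (mc : BGraph V → BGraph V → Timed (Option (Mates V))) : Prop :=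
  ∀ G S : BGraph V,
    ((mc G S).val = none → ¬ ∃ M, IsPerfectMatching G M) ∧
      ∀ M, (mc G S).val = some M → M.Consistent ∧ IsMinCostPM G S M.edges

/-- A correct subroutine for the existence of perfect matchings; it may use a matching of the
graph that is known already. -/
def ChecksPM [Fintype V] (chk : BGraph V → Mates V → Timed Bool) : Prop :=
  ∀ (G : BGraph V) (M : Mates V), M.Consistent → IsMatching G M.edges →
    ((chk G M).val = true ↔ ∃ M', IsPerfectMatching G M')

/-- The list `F` of the edges of the matching `M` that belong to `S`. -/
def edgesIn (S : BGraph V) (M : Mates V) (F : List (V × V)) (a : V) : Timed (List (V × V)) :=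
  step <|
    match M.toR a with
    | some b => if S a b then (a, b) :: F else F
    | none => F

/-- Run `test` after the removal of `R` from the graph (and from the matching) for every
`k`-element sublist `R` of the list `F` of edges, until a test fails. For every choice of an edge
the graph and the matching are copied. -/
def forRemovals (vs : List V) (test : BGraph V → Mates V → Timed Bool) :
    ℕ → List (V × V) → BGraph V → Mates V → Timed Bool
  | 0, _, G, M => test G M
  | _ + 1, [], _, _ => step true
  | k + 1, e :: F, G, M => do
    let G₁ ← charge (vs.length ^ 2) fun a b => G a b && !decide ((a, b) = e)
    let M₁ ← charge (2 * vs.length) (M.cut e.1 e.2)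
    let ok ← forRemovals vs test k F G₁ M₁
    let ok₁ ← step ok
    if ok₁ then forRemovals vs test (k + 1) F G M else step false

/-- The procedure for the removal of `γ` edges of `S` from `G`, with subroutines `mc` for minimum
cost perfect matchings and `chk` for the existence of perfect matchings. With `M` a perfect matching
of least cost and `F` the set of its edges in `S`, case `q`, for `q = 0, …, γ - 1`, goes through
all removals of `γ - q` edges of `F`; each time, the graph left is checked for a perfect matching if
`q = 0`, and is passed to the procedure for `q` and `S \ F` if `q > 0`. The case `q = γ`, in which `M`
survives, needs no work. -/
def verifyRemovals (vs : List V) (mc : BGraph V → BGraph V → Timed (Option (Mates V)))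
    (chk : BGraph V → Mates V → Timed Bool) (γ : ℕ) (G S : BGraph V) : Timed Bool := do
  match ← mc G S with
  | none => step false
  | some M => do
    let F ← foldT (edgesIn S M) [] vs
    let S₁ ← charge (vs.length ^ 2) fun a b => S a b && !decide (M.toR a = some b)
    allT (fun q : Fin γ =>
      forRemovals vs
        (if q.val = 0 then chk else fun G₁ _ => verifyRemovals vs mc chk q.val G₁ S₁)
        (γ - q.val) F G M) (List.finRange γ)
termination_by γ
decreasing_by exact q.isLt

end Procedure

/-- The complete verification algorithm: set up the system bipartite graph and the set of its
feedback edges, and run the procedure with the two subroutines above. -/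
def ClosedLoop.verify {n m p : ℕ} (sys : ClosedLoop n m p) (γ : ℕ) : Timed Bool := do
  let G ← charge ((vertices n m p).length ^ 2) sys.bipartite
  let S ← charge ((vertices n m p).length ^ 2) sys.feedbackEdges
  verifyRemovals (vertices n m p) (minCostPM (vertices n m p)) (checkPM (vertices n m p)) γ G S

/-! Matchings decide fixed modes. If no mode is fixed, then 0 is not, so A + BKC is invertible for
some K. Then the descriptor matrix in the variables (x, u, y) is nonsingular, and a nonzero term of
its determinant is a perfect matching (`NoSFM.exists_isPerfectMatching`).

Conversely, let a perfect matching use a feedback edge (`noSFM_of_isPerfectMatching`). Choose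
positive, algebraically independent starred entries for A, and zero-one matrices B, C as the
matching dictates. Zero is not fixed: with K also read off the matching, det(A + BKC) is a
polynomial in the entries of A that does not vanish when A is specialised to its part of the
matching. A nonzero z is not fixed either: closing only the loop through the feedback edge adds 1 to
a single entry of A, so if z is an eigenvalue both for this K and for K = 0, a cofactor of z - A
vanishes. For irreducible generic A this cannot happen at a nonzero eigenvalue
(`GenericEntries.adjugate_ne_zero`): a vanishing cofactor puts z in the algebraic closure of the
entries other than any given one of a row or column, which kills further cofactors. Irreducibility
spreads this over the whole graph, until z - A would have to be singular for all choices of the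
entries, including A = 0.

A perfect matching after link failures is also one of the original graph, so it does contain a
feedback edge. Hence resilience means that the removal of any γ or fewer feedback edges leaves a
perfect matching.

The procedure tests exactly this (`verifyRemovals_val_iff`): a removed set R splits into its part
inside the matching M, which is enumerated, and the rest, which is left to the recursive call. The
subroutines are justified by a Hall violator (`matchVertex_spec`) and by linear programming duality
(`findsMinCostPM_minCostPM`).

For the running time (`verifyRemovals_time_le`), a matching has at most n feedback edges, so case q
makes at most C(n, γ-q) calls, and C(n, k) ≤ 2 (n/2)^k turns the recurrence into a geometric sum. In
case q = 0 the check starts from M with γ edges cut, hence needs only γ augmentations. This gives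
the exponent γ + 2, better than the required γ + 5/2. -/

/-! ## Generic nonnegative matrices -/

section GenericMatrices

open Matrix Polynomial

variable {ι : Type} [Fintype ι]

/-- Minimum principle for `s - A` with `A` nonnegative and `s` above the row sums. -/
theorem nonneg_of_resolvent_nonneg {A : Matrix ι ι ℝ} {s : ℝ} (hA : ∀ i j, 0 ≤ A i j)
    (hs : ∀ i, ∑ j, A i j < s) {y : ι → ℝ} (hy : ∀ i, 0 ≤ s * y i - ∑ j, A i j * y j) (i : ι) :
    0 ≤ y i := by
  obtain ⟨k, -, hk⟩ := Finset.exists_min_image Finset.univ y ⟨i, Finset.mem_univ i⟩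
  have h1 : (∑ j, A k j) * y k ≤ ∑ j, A k j * y j := by
    rw [Finset.sum_mul]
    exact Finset.sum_le_sum fun j _ => mul_le_mul_of_nonneg_left (hk j (Finset.mem_univ j)) (hA k j)
  have h2 : 0 ≤ (s - ∑ j, A k j) * y k := by
    have := hy k
    nlinarith
  have h3 : 0 ≤ y k := nonneg_of_mul_nonneg_right h2 (by linarith [hs k])
  exact h3.trans (hk i (Finset.mem_univ i))

variable [DecidableEq ι]

theorem Matrix.det_add_single {R : Type*} [CommRing R] (M : Matrix ι ι R) (i j : ι) (t : R) :
    (M + Matrix.single i j t).det = M.det + t * M.adjugate j i := by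
  have h : M + Matrix.single i j t = M.updateRow i (M i + t • Pi.single j 1) := by
    ext a b
    by_cases ha : a = i
    · subst ha
      by_cases hb : b = j
      · subst hb; simp
      · simp [hb, Ne.symm hb]
    · simp [ha, Ne.symm ha]
  rw [h, det_updateRow_add, det_updateRow_smul, updateRow_eq_self, adjugate_apply]

theorem Matrix.adjugate_add_single_row {R : Type*} [CommRing R] (M : Matrix ι ι R) (i j k : ι)
    (t : R) : (M + Matrix.single i j t).adjugate k i = M.adjugate k i := by
  rw [adjugate_apply, adjugate_apply]
  congr 1
  ext a b
  by_cases ha : a = i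
  · subst ha; simp
  · simp [ha, Ne.symm ha]

theorem Matrix.adjugate_add_single_col {R : Type*} [CommRing R] (M : Matrix ι ι R) (i j k : ι)
    (t : R) : (M + Matrix.single i j t).adjugate j k = M.adjugate j k := by
  have h := adjugate_add_single_row Mᵀ j i k t
  rw [← Matrix.transpose_single, ← transpose_add, ← adjugate_transpose, ← adjugate_transpose] at h
  exact h

theorem scalar_sub_mulVec (A : Matrix ι ι ℝ) (s : ℝ) (v : ι → ℝ) (i : ι) :
    ((Matrix.scalar ι s - A) *ᵥ v) i = s * v i - ∑ j, A i j * v j := by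
  rw [Matrix.sub_mulVec, Pi.sub_apply]
  congr 1
  simp [Matrix.mulVec_diagonal]

/-- For s above all row sums, the minimum principle, applied to a kernel vector and its negative,
makes s - A invertible, and it makes the inverse nonnegative. In column k of the inverse a zero at i
excludes i = k and forces zeros at all predecessors of i. Since every vertex is reachable from k,
there are no zeros. -/
theorem exists_adjugate_ne_zero {A : Matrix ι ι ℝ} (hA : ∀ i j, 0 ≤ A i j)
    (hconn : ∀ i j, Relation.ReflTransGen (fun j i => A i j ≠ 0) i j) :
    ∃ s : ℝ, ∀ j k, (Matrix.scalar ι s - A).adjugate j k ≠ 0 := by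
  obtain ⟨s, hs⟩ : ∃ s : ℝ, ∀ i, ∑ j, A i j < s :=
    ⟨∑ i, ∑ j, A i j + 1, fun i => lt_of_le_of_lt
      (Finset.single_le_sum (f := fun i => ∑ j, A i j)
        (fun i _ => Finset.sum_nonneg fun j _ => hA i j) (Finset.mem_univ i)) (by linarith)⟩
  refine ⟨s, fun j k hjk => ?_⟩
  set N := Matrix.scalar ι s - A with hN
  have hdet : N.det ≠ 0 := by
    intro h0
    obtain ⟨v, hv0, hv⟩ := Matrix.exists_mulVec_eq_zero_iff.mpr h0
    apply hv0
    have h1 : ∀ i, s * v i - ∑ j, A i j * v j = 0 := fun i => by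
      rw [← scalar_sub_mulVec, ← hN, hv, Pi.zero_apply]
    funext i
    refine le_antisymm ?_ (nonneg_of_resolvent_nonneg hA hs (fun i => (h1 i).ge) i)
    have := nonneg_of_resolvent_nonneg hA hs (y := -v) (fun i => by
      simp only [Pi.neg_apply, mul_neg, Finset.sum_neg_distrib]
      linarith [h1 i]) i
    simpa using this
  set y : ι → ℝ := fun i => N.adjugate i k / N.det with hy
  have hsol : ∀ i, s * y i - ∑ j, A i j * y j = if i = k then 1 else 0 := by
    intro i
    have h1 := congrFun (congrFun (Matrix.mul_adjugate N) i) k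
    rw [← scalar_sub_mulVec, ← hN]
    have : (N *ᵥ y) i = (N * N.adjugate) i k / N.det := by
      simp only [Matrix.mulVec, dotProduct, Matrix.mul_apply, hy, Finset.sum_div, mul_div_assoc]
    rw [this, h1, Matrix.smul_apply, Matrix.one_apply, smul_eq_mul, mul_div_assoc,
      mul_div_cancel₀ _ hdet]
  have hnn : ∀ i, 0 ≤ y i := nonneg_of_resolvent_nonneg hA hs fun i => by
    rw [hsol]; split_ifs <;> norm_num
  have hzero : ∀ i, y i = 0 → i ≠ k ∧ ∀ l, A i l ≠ 0 → y l = 0 := by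
    intro i hi
    have h1 := hsol i
    have h2 : 0 ≤ ∑ j, A i j * y j := Finset.sum_nonneg fun l _ => mul_nonneg (hA i l) (hnn l)
    rw [hi, mul_zero, zero_sub] at h1
    have hik : i ≠ k := by
      intro h
      rw [if_pos h] at h1
      linarith
    rw [if_neg hik, neg_eq_zero, Finset.sum_eq_zero_iff_of_nonneg
      (fun l _ => mul_nonneg (hA i l) (hnn l))] at h1
    exact ⟨hik, fun l hl => (mul_eq_zero.mp (h1 l (Finset.mem_univ l))).resolve_left hl⟩
  have hprop : ∀ i, Relation.ReflTransGen (fun j i => A i j ≠ 0) k i → y i ≠ 0 := by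
    intro i hi
    induction hi with
    | refl => exact fun h => (hzero k h).1 rfl
    | tail _ hstep ih => exact fun h => ih ((hzero _ h).2 _ hstep)
  exact hprop j (hconn k j) (by simp [hy, hjk])

/-- Numbers `x i j` together with algebraically closed (in `ℂ`) subalgebras `L i j` that contain all
of them but `x i j`. -/
structure GenericEntries (x : ι × ι → ℝ) where
  L : ι × ι → Subalgebra ℚ ℂ
  mem_of_ne : ∀ e f, f ≠ e → (x f : ℂ) ∈ L e
  notMem : ∀ e, (x e : ℂ) ∉ L e
  mem_of_isAlgebraic : ∀ e (z : ℂ), IsAlgebraic (L e) z → z ∈ L e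

/-- The entries are distinct members of a transcendence basis of ℝ over ℚ consisting of positive
numbers. The subalgebras are flats of the algebraic independence matroid of ℂ, that is, algebraic
closures of all entries but one. -/
theorem exists_genericEntries (ι : Type) [Fintype ι] :
    ∃ x : ι × ι → ℝ, (∀ e, 0 < x e) ∧ Nonempty (GenericEntries x) := by
  classical
  -- Every real number is a difference of two positive ones, so the positive reals contain a
  -- transcendence basis.
  have hspan : Algebra.adjoin ℚ {r : ℝ | 0 < r} = ⊤ := by
    refine eq_top_iff.mpr fun r _ => ?_
    have h1 : |r| + 1 ∈ Algebra.adjoin ℚ {r : ℝ | 0 < r} :=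
      Algebra.subset_adjoin (show 0 < |r| + 1 by positivity)
    have h2 : |r| + 1 - r ∈ Algebra.adjoin ℚ {r : ℝ | 0 < r} :=
      Algebra.subset_adjoin (show 0 < |r| + 1 - r by linarith [le_abs_self r])
    simpa using sub_mem h1 h2
  have halg : Algebra.IsAlgebraic (Algebra.adjoin ℚ {r : ℝ | 0 < r}) ℝ := by
    constructor
    intro r
    have hr : r ∈ Algebra.adjoin ℚ {r : ℝ | 0 < r} := by rw [hspan]; trivial
    exact isAlgebraic_algebraMap (⟨r, hr⟩ : Algebra.adjoin ℚ {r : ℝ | 0 < r})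
  obtain ⟨t, htpos, ht⟩ := exists_isTranscendenceBasis_subset (R := ℚ) (A := ℝ) {r : ℝ | 0 < r}
  -- With a finite transcendence basis, ℝ would be countable.
  have hinf : Infinite t := by
    by_contra hfin
    rw [not_infinite_iff_finite] at hfin
    have hcount : Cardinal.mk ℝ ≤ Cardinal.aleph0 := by
      rcases isEmpty_or_nonempty t with he | hne
      · have : Algebra.IsAlgebraic ℚ ℝ := ht.isEmpty_iff_isAlgebraic.mp he
        have h1 := Algebra.IsAlgebraic.cardinalMk_le_max ℚ ℝ
        simpa using h1
      · have h1 := ht.lift_cardinalMk_eq_max_lift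
        have h2 : Cardinal.mk t < Cardinal.aleph0 := Cardinal.lt_aleph0_of_finite t
        simp only [Cardinal.lift_id, Cardinal.mk_denumerable] at h1
        rw [h1]
        simp
    exact absurd hcount (not_le.mpr (by rw [Cardinal.mk_real]; exact Cardinal.aleph0_lt_continuum))
  obtain ⟨g⟩ : Nonempty (ι × ι ↪ t) := by
    have := Infinite.natEmbedding t
    exact ⟨((Fintype.equivFin (ι × ι)).toEmbedding.trans Fin.valEmbedding).trans this⟩
  refine ⟨fun e => (g e : ℝ), fun e => htpos (g e).2, ?_⟩
  have hind : AlgebraicIndependent ℚ (fun e => ((g e : ℝ) : ℂ)) := by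
    have h1 := (ht.1.comp g g.injective).map' (f := IsScalarTower.toAlgHom ℚ ℝ ℂ)
      (algebraMap ℝ ℂ).injective
    exact h1
  set x : ι × ι → ℂ := fun e => ((g e : ℝ) : ℂ) with hx
  have hflat : ∀ e, ∃ S : Subalgebra ℚ ℂ,
      (S : Set ℂ) = (AlgebraicIndependent.matroid ℚ ℂ).closure (x '' {e}ᶜ) ∧
      ∀ a : ℂ, IsAlgebraic S a → a ∈ (AlgebraicIndependent.matroid ℚ ℂ).closure (x '' {e}ᶜ) :=
    fun e => AlgebraicIndependent.matroid_isFlat_iff.mp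
      ((AlgebraicIndependent.matroid ℚ ℂ).isFlat_closure _)
  choose L hL hLalg using hflat
  refine ⟨⟨L, fun e f hf => ?_, fun e he => ?_, fun e z hz => ?_⟩⟩
  · rw [← SetLike.mem_coe, hL]
    exact (AlgebraicIndependent.matroid ℚ ℂ).subset_closure _ (Set.subset_univ _) ⟨f, hf, rfl⟩
  · rw [← SetLike.mem_coe, hL, AlgebraicIndependent.matroid_closure_eq] at he
    exact hind.transcendental_adjoin (s := {e}ᶜ) (i := e) (by simp) he
  · rw [← SetLike.mem_coe, hL]
    exact hLalg e z hz

end GenericMatrices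

/-! ## Matrices with generic entries -/

section GenericEntries

open Matrix Polynomial

/-- Otherwise `x e` would be a root of a nonzero linear polynomial over `g.L e`, hence an element of
it. This is the only way in which transcendence enters the determinant arguments. -/
theorem GenericEntries.left_eq_zero {ι : Type} {x : ι × ι → ℝ} (g : GenericEntries x)
    (e : ι × ι) {c d : ℂ} (hc : c ∈ g.L e) (hd : d ∈ g.L e)
    (h : d + x e * c = 0) : c = 0 := by
  by_contra hc0
  refine g.notMem e (g.mem_of_isAlgebraic e _ ?_)
  refine ⟨C (⟨c, hc⟩ : g.L e) * X + C ⟨d, hd⟩, fun h0 => hc0 ?_, ?_⟩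
  · have := congrArg (fun p => p.coeff 1) h0
    simpa [coeff_C] using congrArg Subtype.val this
  · have h1 : algebraMap (g.L e) ℂ ⟨c, hc⟩ = c := rfl
    have h2 : algebraMap (g.L e) ℂ ⟨d, hd⟩ = d := rfl
    rw [map_add, map_mul, aeval_X, aeval_C, aeval_C, h1, h2]
    linear_combination h

variable {ι : Type} [DecidableEq ι]

theorem Subalgebra.single_mem {R S : Type*} [CommRing R] [CommRing S] [Algebra R S]
    (L : Subalgebra R S) (e : ι × ι) {t : S} (ht : t ∈ L) (i j : ι) :
    Matrix.single e.1 e.2 t i j ∈ L := by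
  rw [Matrix.single_apply]
  split_ifs
  exacts [ht, zero_mem _]

variable [Fintype ι]

theorem Subalgebra.det_mem {R S : Type*} [CommRing R] [CommRing S] [Algebra R S]
    (L : Subalgebra R S) {M : Matrix ι ι S} (h : ∀ i j, M i j ∈ L) : M.det ∈ L := by
  rw [det_apply]
  exact sum_mem fun σ _ => by
    rw [Units.smul_def]
    exact zsmul_mem (prod_mem fun i _ => h _ _) _

theorem Subalgebra.adjugate_mem {R S : Type*} [CommRing R] [CommRing S] [Algebra R S]
    (L : Subalgebra R S) {M : Matrix ι ι S} (h : ∀ i j, M i j ∈ L) (j k : ι) :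
    M.adjugate j k ∈ L := by
  rw [adjugate_apply]
  refine L.det_mem fun a b => ?_
  by_cases ha : a = k
  · subst ha
    rw [updateRow_self, Pi.single_apply]
    split_ifs
    exacts [one_mem _, zero_mem _]
  · rw [updateRow_ne ha]
    exact h a b

namespace GenericEntries

variable {x : ι × ι → ℝ} (g : GenericEntries x)

/-- A determinant that vanishes at the generic entries vanishes identically. -/
theorem det_eq_zero_of_det_eq_zero (S : Finset (ι × ι)) (w : ι × ι → ℂ)
    (hw : ∀ e f, w f ∈ g.L e) :
    ∀ Z : Matrix ι ι ℂ, (∀ e i j, Z i j ∈ g.L e) →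
      (Z + ∑ e ∈ S, Matrix.single e.1 e.2 (x e : ℂ)).det = 0 →
        (Z + ∑ e ∈ S, Matrix.single e.1 e.2 (w e)).det = 0 := by
  induction S using Finset.induction_on with
  | empty => exact fun Z _ h => by simpa using h
  | insert e S he ih =>
    intro Z hZ h
    rw [Finset.sum_insert he, add_comm (Matrix.single _ _ _), ← add_assoc, det_add_single] at h
    set Y := Z + ∑ e ∈ S, Matrix.single e.1 e.2 (x e : ℂ) with hY
    have hYmem : ∀ i j, Y i j ∈ g.L e := fun i j => by
      rw [hY, Matrix.add_apply, Matrix.sum_apply]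
      refine add_mem (hZ e i j) (sum_mem fun f hf => ?_)
      exact (g.L e).single_mem f (g.mem_of_ne e f fun hfe => he (hfe ▸ hf)) i j
    -- The determinant is affine in the entry at `e`, with both coefficients in `g.L e`. Both
    -- vanish, so this entry may be given any value; the value `w e` joins the constant part `Z` for
    -- the remaining entries.
    have hc := g.left_eq_zero e ((g.L e).adjugate_mem hYmem e.2 e.1) ((g.L e).det_mem hYmem) h
    rw [hc, mul_zero, add_zero] at h
    rw [Finset.sum_insert he, ← add_assoc]
    refine ih _ (fun f i j => add_mem (hZ f i j) ((g.L f).single_mem e (hw f e) i j)) ?_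
    rw [add_right_comm, ← hY, det_add_single, h, hc, mul_zero, add_zero]

/-- The matrix with the generic entries at the places in `E` and zeros elsewhere. -/
def matrix (x : ι × ι → ℝ) (E : ι → ι → Bool) : Matrix ι ι ℝ :=
  Matrix.of fun i j => if E i j then x (i, j) else 0

theorem matrix_map_eq_sum (E : ι → ι → Bool) :
    (matrix x E).map (algebraMap ℝ ℂ) =
      ∑ e ∈ Finset.univ.filter (fun e : ι × ι => E e.1 e.2 = true),
        Matrix.single e.1 e.2 (x e : ℂ) := by
  ext i j
  rw [Matrix.sum_apply, Finset.sum_filter, Finset.sum_eq_single (i, j)]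
  · by_cases h : E i j = true <;> simp [matrix, h]
  · intro e _ he
    split_ifs
    · rw [Matrix.single_apply, if_neg]
      exact fun h => he (Prod.ext h.1 h.2)
    · rfl
  · simp

/-- The cofactor with index (j, k) does not involve row k or column j. As a function of z it is
therefore a polynomial over `g.L e` for every place e in that row or column. It is not the zero
polynomial, so its roots lie in `g.L e`. -/
theorem mem_of_adjugate_eq_zero {E : ι → ι → Bool} (hpos : ∀ e, 0 < x e)
    (hconn : ∀ i j, Relation.ReflTransGen (fun j i => E i j = true) i j) {z : ℂ} {j k : ι}
    (h : (Matrix.scalar ι z - (matrix x E).map (algebraMap ℝ ℂ)).adjugate j k = 0)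
    (e : ι × ι) (he : e.1 = k ∨ e.2 = j) : z ∈ g.L e := by
  set A := (matrix x E).map (algebraMap ℝ ℂ) with hA
  have hx : ∀ i j, E i j = true ↔ matrix x E i j ≠ 0 := fun i j => by
    by_cases hE : E i j = true <;> simp [matrix, hE, (hpos _).ne']
  obtain ⟨s, hs⟩ := exists_adjugate_ne_zero (A := matrix x E)
    (fun i j => by
      simp only [matrix, Matrix.of_apply]
      split_ifs
      exacts [(hpos _).le, le_rfl])
    (by simpa only [hx] using hconn)
  -- the matrix without the entry at `e`
  have hmem : ∀ i j, (A - Matrix.single e.1 e.2 (A e.1 e.2)) i j ∈ g.L e := fun i j => by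
    rw [Matrix.sub_apply, Matrix.single_apply]
    split_ifs with hij
    · rw [hij.1, hij.2, sub_self]; exact zero_mem _
    · rw [sub_zero, hA, Matrix.map_apply]
      simp only [matrix, Matrix.of_apply]
      split_ifs
      · exact g.mem_of_ne e (i, j) fun h0 => hij (by rw [← h0]; exact ⟨rfl, rfl⟩)
      · rw [map_zero]; exact zero_mem _
  set A' : Matrix ι ι (g.L e) := Matrix.of fun i j => ⟨_, hmem i j⟩ with hA'
  have heval : ∀ t : ℂ, aeval t ((charmatrix A').adjugate j k) =
      (Matrix.scalar ι t - A).adjugate j k := by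
    intro t
    have h1 : (aeval t : (g.L e)[X] →ₐ[g.L e] ℂ) ((charmatrix A').adjugate j k) =
        (((aeval t : (g.L e)[X] →ₐ[g.L e] ℂ).toRingHom.mapMatrix
          (charmatrix A').adjugate) : Matrix ι ι ℂ) j k := rfl
    rw [h1, RingHom.map_adjugate]
    have h2 : (aeval t : (g.L e)[X] →ₐ[g.L e] ℂ).toRingHom.mapMatrix (charmatrix A') =
        (Matrix.scalar ι t - A) + Matrix.single e.1 e.2 (A e.1 e.2) := by
      ext i l
      have h3 : algebraMap (g.L e) ℂ (A' i l) = (A - Matrix.single e.1 e.2 (A e.1 e.2)) i l := rfl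
      rw [RingHom.mapMatrix_apply, Matrix.map_apply, charmatrix_apply]
      simp only [AlgHom.toRingHom_eq_coe, RingHom.coe_coe, map_sub, aeval_C, h3,
        Matrix.sub_apply, Matrix.add_apply, Matrix.scalar_apply]
      rw [Matrix.diagonal_apply, Matrix.diagonal_apply]
      split_ifs
      · rw [aeval_X]; ring
      · rw [map_zero]; ring
    rw [h2]
    rcases he with he | he
    · subst he; exact adjugate_add_single_row _ _ _ _ _
    · subst he; exact adjugate_add_single_col _ _ _ _ _
  refine g.mem_of_isAlgebraic e z ⟨(charmatrix A').adjugate j k, fun h0 => ?_, by rw [heval, h]⟩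
  -- The polynomial is nonzero because it is nonzero at the real number `s`, which lies above the
  -- row sums.
  have h1 := heval (s : ℂ)
  rw [h0, map_zero] at h1
  apply hs j k
  have h2 : Matrix.scalar ι (s : ℂ) - A =
      (algebraMap ℝ ℂ).mapMatrix (Matrix.scalar ι s - matrix x E) := by
    ext i l
    rw [hA, RingHom.mapMatrix_apply, Matrix.map_apply, Matrix.sub_apply, Matrix.sub_apply,
      Matrix.map_apply, map_sub, Matrix.scalar_apply, Matrix.scalar_apply, Matrix.diagonal_apply,
      Matrix.diagonal_apply]
    split_ifs <;> simp
  rw [h2, ← RingHom.map_adjugate, RingHom.mapMatrix_apply, Matrix.map_apply] at h1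
  exact (map_eq_zero_iff _ (algebraMap ℝ ℂ).injective).mp h1.symm

/-- The vanishing determinant is affine in the entry at (i, j), and its slope is, up to sign, this
cofactor. If z does not depend on that entry, both coefficients lie in `g.L (i, j)`, and the slope
must vanish. -/
theorem adjugate_eq_zero_of_mem {E : ι → ι → Bool} {z : ℂ}
    (hdet : (Matrix.scalar ι z - (matrix x E).map (algebraMap ℝ ℂ)).det = 0)
    {i j : ι} (hE : E i j = true) (hz : z ∈ g.L (i, j)) :
    (Matrix.scalar ι z - (matrix x E).map (algebraMap ℝ ℂ)).adjugate j i = 0 := by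
  set N := Matrix.scalar ι z - (matrix x E).map (algebraMap ℝ ℂ) with hN
  have hmem : ∀ a b, (N + Matrix.single i j (x (i, j) : ℂ)) a b ∈ g.L (i, j) := fun a b => by
    have hz' : ∀ a b, Matrix.scalar ι z a b ∈ g.L (i, j) := fun a b => by
      rw [Matrix.scalar_apply, Matrix.diagonal_apply]
      split_ifs
      exacts [hz, zero_mem _]
    rw [hN, Matrix.add_apply, Matrix.sub_apply, Matrix.single_apply, Matrix.map_apply]
    simp only [matrix, Matrix.of_apply]
    by_cases hij : i = a ∧ j = b
    · rw [if_pos hij, ← hij.1, ← hij.2, if_pos hE]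
      simpa using hz' i j
    · rw [if_neg hij, add_zero]
      refine sub_mem (hz' a b) ?_
      split_ifs
      · exact g.mem_of_ne _ (a, b) fun h0 => hij (by
          rw [Prod.ext_iff] at h0
          exact ⟨h0.1.symm, h0.2.symm⟩)
      · rw [map_zero]; exact zero_mem _
  have h1 : N = (N + Matrix.single i j (x (i, j) : ℂ)) + Matrix.single i j (-(x (i, j) : ℂ)) := by
    rw [add_assoc, ← Matrix.single_add, add_neg_cancel, Matrix.single_zero, add_zero]
  have h2 := hdet
  rw [h1, det_add_single] at h2
  have h3 := g.left_eq_zero (i, j) (neg_mem ((g.L _).adjugate_mem hmem j i))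
    ((g.L _).det_mem hmem) (by linear_combination h2)
  rw [h1, adjugate_add_single_row]
  exact neg_eq_zero.mp h3

/-- For an irreducible generic matrix `A`, all cofactors of `z - A` are nonzero at the nonzero
eigenvalues `z`. -/
theorem adjugate_ne_zero (g : GenericEntries x) {E : ι → ι → Bool} (hpos : ∀ e, 0 < x e)
    (hconn : ∀ i j, Relation.ReflTransGen (fun j i => E i j = true) i j) {z : ℂ} (hz : z ≠ 0)
    (hdet : (Matrix.scalar ι z - (matrix x E).map (algebraMap ℝ ℂ)).det = 0) (b a : ι) :
    (Matrix.scalar ι z - (matrix x E).map (algebraMap ℝ ℂ)).adjugate b a ≠ 0 := by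
  intro hba
  set N := Matrix.scalar ι z - (matrix x E).map (algebraMap ℝ ℂ) with hN
  have hNij : ∀ i j, N i j = (if i = j then z else 0) - if E i j = true then (x (i, j) : ℂ) else 0 := by
    intro i j
    rw [hN, Matrix.sub_apply, Matrix.map_apply, Matrix.scalar_apply, Matrix.diagonal_apply]
    simp only [matrix, Matrix.of_apply]
    congr 1
    split_ifs <;> simp
  -- Since `N * N.adjugate = 0`, its (k, k) entry expresses z times the diagonal cofactor as the sum
  -- of A k j times `N.adjugate j k`. The next statement is the same for columns.
  have hrow : ∀ k, (∀ j, E k j = true → N.adjugate j k = 0) → N.adjugate k k = 0 := by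
    intro k hk
    have h1 := congrFun (congrFun (Matrix.mul_adjugate N) k) k
    rw [hdet, zero_smul, Matrix.zero_apply, Matrix.mul_apply] at h1
    have h2 : ∀ j, N k j * N.adjugate j k = if k = j then z * N.adjugate k k else 0 := by
      intro j
      rw [hNij]
      by_cases hE : E k j = true
      · rw [hk j hE]
        split_ifs with h
        · subst h; rw [hk k hE]; ring
        · ring
      · rw [if_neg hE]
        split_ifs with h
        · subst h; ring
        · ring
    simp only [h2, Finset.sum_ite_eq, Finset.mem_univ, if_true] at h1
    exact (mul_eq_zero.mp h1).resolve_left hz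
  have hcol : ∀ k, (∀ i, E i k = true → N.adjugate k i = 0) → N.adjugate k k = 0 := by
    intro k hk
    have h1 := congrFun (congrFun (Matrix.adjugate_mul N) k) k
    rw [hdet, zero_smul, Matrix.zero_apply, Matrix.mul_apply] at h1
    have h2 : ∀ j, N.adjugate k j * N j k = if k = j then z * N.adjugate k k else 0 := by
      intro j
      rw [hNij]
      by_cases hE : E j k = true
      · rw [hk j hE, zero_mul]
        split_ifs with h
        · subst h; rw [hk k hE, mul_zero]
        · rfl
      · rw [if_neg hE]
        by_cases h : k = j
        · subst h; rw [if_pos rfl, if_pos rfl]; ring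
        · rw [if_neg (Ne.symm h), if_neg h]; ring
    simp only [h2, Finset.sum_ite_eq, Finset.mem_univ, if_true] at h1
    exact (mul_eq_zero.mp h1).resolve_left hz
  have hstart : N.adjugate a a = 0 := hrow a fun j hE =>
    g.adjugate_eq_zero_of_mem hdet hE (g.mem_of_adjugate_eq_zero hpos hconn hba _ (Or.inl rfl))
  -- A vanishing diagonal cofactor passes to the predecessors in the digraph: first row k frees z
  -- from the entry at (k, j), which kills the cofactor (j, k); then column j is free, which kills
  -- all cofactors in the expansion of z times the cofactor (j, j).
  have hstep : ∀ j k, E k j = true → N.adjugate k k = 0 → N.adjugate j j = 0 := by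
    intro j k hE hk
    have h1 : N.adjugate j k = 0 := g.adjugate_eq_zero_of_mem hdet hE
      (g.mem_of_adjugate_eq_zero hpos hconn hk _ (Or.inl rfl))
    exact hcol j fun i hi => g.adjugate_eq_zero_of_mem hdet hi
      (g.mem_of_adjugate_eq_zero hpos hconn h1 _ (Or.inr rfl))
  have hall : ∀ k, N.adjugate k k = 0 := by
    intro k
    have := hconn k a
    induction this using Relation.ReflTransGen.head_induction_on with
    | refl => exact hstart
    | head h _ ih => exact hstep _ _ h ih
  have hzmem : ∀ e, z ∈ g.L e := fun e =>
    g.mem_of_adjugate_eq_zero hpos hconn (hall e.1) e (Or.inl rfl)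
  -- Now z lies in every `g.L e` and counts as a constant, so the generic entries may all be
  -- replaced by 0. Then det(z - A) becomes a power of z, which is nonzero.
  have h1 := g.det_eq_zero_of_det_eq_zero
    (Finset.univ.filter (fun e : ι × ι => E e.1 e.2 = true)) (fun _ => 0)
    (fun e _ => zero_mem _) (-Matrix.scalar ι z) (fun e i j => by
      rw [Matrix.neg_apply, Matrix.scalar_apply, Matrix.diagonal_apply]
      refine neg_mem ?_
      split_ifs
      exacts [hzmem e, zero_mem _]) (by
      rw [← matrix_map_eq_sum, show -Matrix.scalar ι z + (matrix x E).map (algebraMap ℝ ℂ) = -N by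
        rw [hN]; abel, det_neg, hdet, mul_zero])
  simp only [Matrix.single_zero, Finset.sum_const_zero, add_zero, det_neg, Matrix.scalar_apply,
    Matrix.det_diagonal, Finset.prod_const] at h1
  exact (mul_ne_zero (pow_ne_zero _ (neg_ne_zero.mpr one_ne_zero)) (pow_ne_zero _ hz)) h1

end GenericEntries

end GenericEntries

/-! ## Perfect matchings and permutations -/

section PerfectMatchings

variable {V : Type} [Fintype V]

/-- Both coordinates are injective on `M`, so the cardinality forces every left vertex to be
covered, and an injection of a finite set into itself is bijective. -/
theorem IsPerfectMatching.exists_equiv {G : BGraph V} {M : Finset (V × V)}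
    (hM : IsPerfectMatching G M) :
    ∃ σ : V ≃ V, (∀ a, (a, σ a) ∈ M) ∧ ∀ e ∈ M, e.2 = σ e.1 := by
  classical
  have hinj1 : Set.InjOn Prod.fst (M : Set (V × V)) := fun e he f hf h => by
    by_contra hne
    exact (hM.1.2 e he f hf hne).1 h
  have hinj2 : Set.InjOn Prod.snd (M : Set (V × V)) := fun e he f hf h => by
    by_contra hne
    exact (hM.1.2 e he f hf hne).2 h
  have himg : M.image Prod.fst = Finset.univ := by
    rw [← Finset.card_eq_iff_eq_univ, Finset.card_image_of_injOn hinj1, hM.2]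
  have hex : ∀ a, ∃ b, (a, b) ∈ M := fun a => by
    have : a ∈ M.image Prod.fst := by rw [himg]; exact Finset.mem_univ a
    obtain ⟨⟨a', b⟩, he, rfl⟩ := Finset.mem_image.mp this
    exact ⟨b, he⟩
  choose s hs using hex
  have hsinj : Function.Injective s := fun a a' h =>
    congrArg Prod.fst (hinj2 (hs a) (hs a') h)
  refine ⟨Equiv.ofBijective s (Finite.injective_iff_bijective.mp hsinj), hs, fun e he => ?_⟩
  exact congrArg Prod.snd (hinj1 he (hs e.1) rfl)

theorem IsPerfectMatching.of_equiv {G : BGraph V} (σ : V ≃ V) (h : ∀ a, G a (σ a) = true) :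
    IsPerfectMatching G
      (Finset.univ.map ⟨fun a => (a, σ a), fun _ _ h => congrArg Prod.fst h⟩) := by
  refine ⟨⟨fun e he => ?_, fun e he f hf hef => ?_⟩, by simp⟩
  · obtain ⟨a, -, rfl⟩ := Finset.mem_map.mp he
    exact h a
  · obtain ⟨a, -, rfl⟩ := Finset.mem_map.mp he
    obtain ⟨b, -, rfl⟩ := Finset.mem_map.mp hf
    have hab : a ≠ b := fun h0 => hef (by rw [h0])
    exact ⟨hab, fun h0 => hab (σ.injective h0)⟩

theorem exists_isPerfectMatching_iff {G : BGraph V} :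
    (∃ M, IsPerfectMatching G M) ↔ ∃ σ : V ≃ V, ∀ a, G a (σ a) = true :=
  ⟨fun ⟨_, hM⟩ =>
    have ⟨σ, hσ, _⟩ := hM.exists_equiv
    ⟨σ, fun a => hM.1.1 _ (hσ a)⟩, fun ⟨σ, hσ⟩ => ⟨_, .of_equiv σ hσ⟩⟩

theorem IsPerfectMatching.mono {G G' : BGraph V} {M : Finset (V × V)} (hM : IsPerfectMatching G M)
    (h : ∀ e ∈ M, G' e.1 e.2 = true) : IsPerfectMatching G' M :=
  ⟨⟨h, hM.1.2⟩, hM.2⟩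

theorem IsPerfectMatching.edgeCost_eq {G S : BGraph V} {M : Finset (V × V)}
    (hM : IsPerfectMatching G M) {σ : V ≃ V} (hσ : ∀ a, (a, σ a) ∈ M) :
    edgeCost S M = ∑ a, if S a (σ a) then 1 else 0 := by
  classical
  have h : Finset.univ.map ⟨fun a => (a, σ a), fun _ _ h => congrArg Prod.fst h⟩ = M := by
    refine Finset.eq_of_subset_of_card_le (fun e he => ?_) ?_
    · obtain ⟨a, -, rfl⟩ := Finset.mem_map.mp he
      exact hσ a
    · rw [Finset.card_map, Finset.card_univ, hM.2]
  rw [edgeCost, ← h, Finset.sum_map]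
  rfl

end PerfectMatchings

/-! ## Fixed modes and perfect matchings -/

namespace ClosedLoop

open Matrix

variable {n m p : ℕ}

/-- The matrix of the system in descriptor form, in the variables `(x, u, y)`. -/
def descriptorMatrix (A : Matrix (Fin n) (Fin n) ℝ) (B : Matrix (Fin n) (Fin m) ℝ)
    (C : Matrix (Fin p) (Fin n) ℝ) (K : Matrix (Fin m) (Fin p) ℝ) :
    Matrix (Vertex n m p) (Vertex n m p) ℝ :=
  Matrix.of fun a b =>
    match a, b with
    | .inl i, .inl j => A i j
    | .inl i, .inr (.inl j) => B i j
    | .inl _, .inr (.inr _) => 0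
    | .inr (.inl _), .inl _ => 0
    | .inr (.inl i), .inr (.inl j) => if i = j then -1 else 0
    | .inr (.inl i), .inr (.inr j) => K i j
    | .inr (.inr i), .inl j => C i j
    | .inr (.inr _), .inr (.inl _) => 0
    | .inr (.inr i), .inr (.inr j) => if i = j then -1 else 0

/-- A kernel vector (x, u, y) satisfies y = Cx, u = Ky and Ax + Bu = 0, so x lies in the kernel of A
+ BKC; once x = 0, also y and u vanish. -/
theorem det_descriptorMatrix_ne_zero {A : Matrix (Fin n) (Fin n) ℝ} {B : Matrix (Fin n) (Fin m) ℝ}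
    {C : Matrix (Fin p) (Fin n) ℝ} {K : Matrix (Fin m) (Fin p) ℝ}
    (h : (A + B * K * C).det ≠ 0) : (descriptorMatrix A B C K).det ≠ 0 := by
  intro h0
  obtain ⟨w, hw0, hw⟩ := Matrix.exists_mulVec_eq_zero_iff.mpr h0
  have hx : ∀ i, ∑ j, A i j * w (.inl j) + ∑ j, B i j * w (.inr (.inl j)) = 0 := fun i => by
    have := congrFun hw (.inl i)
    simpa [Matrix.mulVec, dotProduct, descriptorMatrix, Fintype.sum_sum_type] using this
  have hu : ∀ i, ∑ j, K i j * w (.inr (.inr j)) = w (.inr (.inl i)) := fun i => by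
    have := congrFun hw (.inr (.inl i))
    simp [Matrix.mulVec, dotProduct, descriptorMatrix, Fintype.sum_sum_type] at this
    linarith
  have hy : ∀ i, ∑ j, C i j * w (.inl j) = w (.inr (.inr i)) := fun i => by
    have := congrFun hw (.inr (.inr i))
    simp [Matrix.mulVec, dotProduct, descriptorMatrix, Fintype.sum_sum_type] at this
    linarith
  have hv : (fun i => w (.inl i)) = 0 := by
    by_contra hne
    refine h (Matrix.exists_mulVec_eq_zero_iff.mp ⟨_, hne, ?_⟩)
    have h1 : C *ᵥ (fun i => w (.inl i)) = fun i => w (.inr (.inr i)) := funext hy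
    have h2 : K *ᵥ (fun i => w (.inr (.inr i))) = fun i => w (.inr (.inl i)) := funext hu
    rw [Matrix.add_mulVec, ← Matrix.mulVec_mulVec, ← Matrix.mulVec_mulVec, h1, h2]
    exact funext hx
  have hv' : ∀ i, w (.inl i) = 0 := congrFun hv
  have hy' : ∀ i, w (.inr (.inr i)) = 0 := fun i => by rw [← hy]; simp [hv']
  have hu' : ∀ i, w (.inr (.inl i)) = 0 := fun i => by rw [← hu]; simp [hy']
  refine hw0 (funext fun a => ?_)
  rcases a with i | i | i
  exacts [hv' i, hu' i, hy' i]

theorem bipartite_of_descriptorMatrix_ne_zero {sys : ClosedLoop n m p}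
    {A : Matrix (Fin n) (Fin n) ℝ} {B : Matrix (Fin n) (Fin m) ℝ}
    {C : Matrix (Fin p) (Fin n) ℝ} {K : Matrix (Fin m) (Fin p) ℝ} (hA : HasPattern sys.A A)
    (hB : HasPattern sys.B B) (hC : HasPattern sys.C C) (hK : HasPattern sys.K K)
    {a b : Vertex n m p} (h : descriptorMatrix A B C K a b ≠ 0) : sys.bipartite a b = true := by
  by_contra hf
  rw [Bool.not_eq_true] at hf
  apply h
  rcases a with i | i | i <;> rcases b with j | j | j <;>
    simp only [bipartite, decide_eq_false_iff_not] at hf <;>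
    simp only [descriptorMatrix, Matrix.of_apply]
  exacts [hA i j hf, hB i j hf, if_neg hf, hK i j hf, hC i j hf, if_neg hf]

theorem mem_spectrum_map_iff {X : Matrix (Fin n) (Fin n) ℝ} {z : ℂ} :
    z ∈ spectrum ℂ (X.map (algebraMap ℝ ℂ)) ↔
      (Matrix.scalar (Fin n) z - X.map (algebraMap ℝ ℂ)).det = 0 := by
  rw [spectrum.mem_iff, Matrix.isUnit_iff_isUnit_det, isUnit_iff_ne_zero, not_not]
  rfl

/-- Only the eigenvalue 0 is needed: some feedback matrix makes the closed loop nonsingular, and a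
nonzero term in the expansion of the descriptor determinant runs through edges of the graph. -/
theorem NoSFM.exists_isPerfectMatching {sys : ClosedLoop n m p} (h : sys.NoSFM) :
    ∃ M, IsPerfectMatching sys.bipartite M := by
  obtain ⟨A, B, C, hA, hB, hC, hempty⟩ := h
  have h0 : (0 : ℂ) ∉ ⋂ K ∈ {K : Matrix (Fin m) (Fin p) ℝ | HasPattern sys.K K},
      spectrum ℂ ((A + B * K * C).map (algebraMap ℝ ℂ)) := by
    rw [hempty]; exact Set.notMem_empty _
  simp only [Set.mem_iInter, not_forall] at h0
  obtain ⟨K, hK, h1⟩ := h0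
  rw [mem_spectrum_map_iff] at h1
  have hdet : (A + B * K * C).det ≠ 0 := by
    intro h2
    apply h1
    rw [map_zero, zero_sub, det_neg]
    have : ((A + B * K * C).map (algebraMap ℝ ℂ)).det = algebraMap ℝ ℂ (A + B * K * C).det :=
      (RingHom.map_det _ _).symm
    rw [this, h2, map_zero, mul_zero]
  have h2 := det_descriptorMatrix_ne_zero hdet
  rw [Matrix.det_apply] at h2
  obtain ⟨σ, -, hσ⟩ := Finset.exists_ne_zero_of_sum_ne_zero h2
  have h3 : ∀ a, descriptorMatrix A B C K (σ a) a ≠ 0 := by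
    intro a ha
    apply hσ
    have h : ∏ i, descriptorMatrix A B C K (σ i) i = 0 :=
      Finset.prod_eq_zero (Finset.mem_univ a) ha
    exact (congrArg _ h).trans (smul_zero _)
  rw [exists_isPerfectMatching_iff]
  refine ⟨σ.symm, fun a => ?_⟩
  have := bipartite_of_descriptorMatrix_ne_zero hA hB hC hK (h3 (σ.symm a))
  rwa [σ.apply_symm_apply] at this

/-- The part of a permutation matrix given by two families of indices. -/
def pick (F : Type) [Field F] {V α β : Type} [DecidableEq V] (σ : V → V) (f : α → V) (g : β → V) :
    Matrix α β F :=
  Matrix.of fun i j => if σ (f i) = g j then 1 else 0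

section Pick

variable {F V α β : Type} [Field F] [DecidableEq V] [Fintype β] {σ : V → V} {f : α → V} {g : β → V}

theorem pick_mulVec_of_eq (hg : Function.Injective g) {i : α} {j : β} (h : σ (f i) = g j)
    (v : β → F) : (pick F σ f g *ᵥ v) i = v j := by
  classical
  simp only [Matrix.mulVec, dotProduct, pick, Matrix.of_apply, h, hg.eq_iff, ite_mul, one_mul,
    zero_mul]
  rw [Finset.sum_ite_eq]
  simp

theorem pick_mulVec_of_ne {i : α} (h : ∀ j, σ (f i) ≠ g j) (v : β → F) :
    (pick F σ f g *ᵥ v) i = 0 := by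
  simp [Matrix.mulVec, dotProduct, pick, h]

end Pick

/-- The state matrix is generic, while input and output matrices are the corresponding blocks of the
permutation matrix of the matching. A common eigenvalue 0 contradicts the matching itself, and a
nonzero one contradicts irreducibility by way of the feedback edge. -/
theorem noSFM_of_isPerfectMatching {sys : ClosedLoop n m p} (hirr : sys.Irreducible)
    {M : Finset (Vertex n m p × Vertex n m p)} (hM : IsPerfectMatching sys.bipartite M)
    {e : Vertex n m p × Vertex n m p} (heM : e ∈ M) (he : sys.feedbackEdges e.1 e.2 = true) :
    sys.NoSFM := by
  obtain ⟨σ, hσM, hσ⟩ := hM.exists_equiv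
  have hG : ∀ a, sys.bipartite a (σ a) = true := fun a => hM.1.1 _ (hσM a)
  have hinl : Function.Injective (Sum.inl : Fin n → Vertex n m p) := Sum.inl_injective
  have hinrl : Function.Injective (fun i => .inr (.inl i) : Fin m → Vertex n m p) :=
    Sum.inr_injective.comp Sum.inl_injective
  have hinrr : Function.Injective (fun i => .inr (.inr i) : Fin p → Vertex n m p) :=
    Sum.inr_injective.comp Sum.inr_injective
  -- the successors of the vertices
  have hx' : ∀ i, (∃ j, σ (.inl i) = .inl j ∧ sys.A i j = true) ∨
      ∃ l, σ (.inl i) = .inr (.inl l) ∧ sys.B i l = true := by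
    intro i
    have := hG (.inl i)
    rcases hs : σ (.inl i) with j | l | l <;> rw [hs] at this
    · exact Or.inl ⟨j, rfl, this⟩
    · exact Or.inr ⟨l, rfl, this⟩
    · exact absurd this (by simp [bipartite])
  have hu' : ∀ i, σ (.inr (.inl i)) = .inr (.inl i) ∨
      ∃ l, σ (.inr (.inl i)) = .inr (.inr l) ∧ sys.K i l = true := by
    intro i
    have := hG (.inr (.inl i))
    rcases hs : σ (.inr (.inl i)) with j | l | l <;> rw [hs] at this
    · exact absurd this (by simp [bipartite])
    · left; rw [of_decide_eq_true this]
    · exact Or.inr ⟨l, rfl, this⟩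
  have hy' : ∀ i, σ (.inr (.inr i)) = .inr (.inr i) ∨
      ∃ j, σ (.inr (.inr i)) = .inl j ∧ sys.C i j = true := by
    intro i
    have := hG (.inr (.inr i))
    rcases hs : σ (.inr (.inr i)) with j | l | l <;> rw [hs] at this
    · exact Or.inr ⟨j, rfl, this⟩
    · exact absurd this (by simp [bipartite])
    · left; rw [of_decide_eq_true this]
  obtain ⟨x, hpos, ⟨g⟩⟩ := exists_genericEntries (Fin n)
  set A := GenericEntries.matrix x sys.A with hA
  let fx : Fin n → Vertex n m p := Sum.inl
  let fu : Fin m → Vertex n m p := fun i => .inr (.inl i)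
  let fy : Fin p → Vertex n m p := fun i => .inr (.inr i)
  have hBpat : HasPattern sys.B (pick ℝ σ fx fu) := fun i l hil => by
    refine if_neg fun h => ?_
    have := hG (.inl i)
    rw [show σ (.inl i) = .inr (.inl l) from h] at this
    simp [bipartite, hil] at this
  have hCpat : HasPattern sys.C (pick ℝ σ fy fx) := fun i l hil => by
    refine if_neg fun h => ?_
    have := hG (.inr (.inr i))
    rw [show σ (.inr (.inr i)) = .inl l from h] at this
    simp [bipartite, hil] at this
  have hKpat : HasPattern sys.K (pick ℝ σ fu fy) := fun i l hil => by
    refine if_neg fun h => ?_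
    have := hG (.inr (.inl i))
    rw [show σ (.inr (.inl i)) = .inr (.inr l) from h] at this
    simp [bipartite, hil] at this
  have hAw : ∀ i j, σ (.inl i) = .inl j → sys.A i j = true := fun i j h => by
    have := hG (.inl i)
    rwa [h] at this
  refine ⟨A, pick ℝ σ fx fu, pick ℝ σ fy fx, fun i j hij => by simp [hA, GenericEntries.matrix, hij],
    hBpat, hCpat, Set.eq_empty_iff_forall_notMem.mpr fun z hz => ?_⟩
  have hz' : ∀ K, HasPattern sys.K K →
      (Matrix.scalar (Fin n) z - (A + pick ℝ σ fx fu * K * pick ℝ σ fy fx).map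
        (algebraMap ℝ ℂ)).det = 0 := fun K hK =>
    mem_spectrum_map_iff.mp (Set.mem_iInter₂.mp hz K hK)
  by_cases hz0 : z = 0
  · subst hz0
    have h1 := hz' _ hKpat
    rw [map_zero, zero_sub, det_neg] at h1
    have h2 := (mul_eq_zero.mp h1).resolve_left
      (pow_ne_zero _ (neg_ne_zero.mpr one_ne_zero))
    have hpick : ∀ {α β : Type} (f : α → Vertex n m p) (g : β → Vertex n m p),
        (pick ℝ σ f g).map (algebraMap ℝ ℂ) = pick ℂ σ f g := fun f g => by
      ext i j
      simp only [pick, Matrix.map_apply, Matrix.of_apply]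
      split_ifs <;> simp
    have hmap : (A + pick ℝ σ fx fu * pick ℝ σ fu fy * pick ℝ σ fy fx).map (algebraMap ℝ ℂ) =
        pick ℂ σ fx fu * pick ℂ σ fu fy * pick ℂ σ fy fx +
          ∑ e ∈ Finset.univ.filter (fun e : Fin n × Fin n => sys.A e.1 e.2 = true),
            Matrix.single e.1 e.2 (x e : ℂ) := by
      refine Eq.trans ?_ (congrArg (_ + ·) (GenericEntries.matrix_map_eq_sum (x := x) sys.A))
      rw [Matrix.map_add _ (map_add _), Matrix.map_mul, Matrix.map_mul, hpick, hpick, hpick,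
        add_comm]
    have hmem : ∀ {α β : Type} (f : α → Vertex n m p) (h : β → Vertex n m p) e i j,
        pick ℂ σ f h i j ∈ g.L e := fun f h e i j => by
      simp only [pick, Matrix.of_apply]
      split_ifs
      exacts [one_mem _, zero_mem _]
    rw [hmap] at h2
    -- The generic entries on edges of the matching are specialised to 1, all others to 0.
    have h3 := g.det_eq_zero_of_det_eq_zero _
      (fun e => if σ (.inl e.1) = .inl e.2 then 1 else 0)
      (fun e f => by split_ifs; exacts [one_mem _, zero_mem _]) _ (fun e i j => by
        rw [Matrix.mul_apply]
        refine sum_mem fun k _ => mul_mem ?_ (hmem _ _ _ _ _)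
        rw [Matrix.mul_apply]
        exact sum_mem fun k _ => mul_mem (hmem _ _ _ _ _) (hmem _ _ _ _ _)) h2
    have h4 : ∑ e ∈ Finset.univ.filter (fun e : Fin n × Fin n => sys.A e.1 e.2 = true),
        Matrix.single e.1 e.2 (if σ (.inl e.1) = .inl e.2 then (1 : ℂ) else 0) =
          pick ℂ σ fx fx := by
      ext i j
      rw [Matrix.sum_apply, Finset.sum_filter, Finset.sum_eq_single (i, j)]
      · by_cases h : sys.A i j = true
        · simp [pick, h, fx]
        · have : ¬ σ (.inl i) = .inl j := fun h0 => h (hAw i j h0)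
          simp [pick, fx, this]
      · intro e _ he
        split_ifs
        any_goals rfl
        all_goals
          rw [Matrix.single_apply, if_neg]
          exact fun h => he (Prod.ext h.1 h.2)
      · simp
    rw [h4] at h3
    obtain ⟨v, hv0, hv⟩ := Matrix.exists_mulVec_eq_zero_iff.mpr h3
    apply hv0
    rw [Matrix.add_mulVec, ← Matrix.mulVec_mulVec, ← Matrix.mulVec_mulVec] at hv
    set y := pick ℂ σ fy fx *ᵥ v with hy
    set u := pick ℂ σ fu fy *ᵥ y with hu
    -- Each row has a single nonzero term. To see that `v j` vanishes, the matching is followed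
    -- backwards from `x_j`: either directly to some `x'_i`, or through an output and an input to
    -- some `x'_l`.
    have hrow : ∀ i, (pick ℂ σ fx fu *ᵥ u) i + (pick ℂ σ fx fx *ᵥ v) i = 0 := congrFun hv
    have hv1 : ∀ i j, σ (.inl i) = .inl j → v j = 0 := fun i j h => by
      have := hrow i
      rwa [pick_mulVec_of_eq hinl (show σ (fx i) = fx j from h),
        pick_mulVec_of_ne (fun l => by simp [fx, fu, h]), zero_add] at this
    have hu1 : ∀ i l, σ (.inl i) = .inr (.inl l) → u l = 0 := fun i l h => by
      have := hrow i
      rwa [pick_mulVec_of_eq hinrl (show σ (fx i) = fu l from h),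
        pick_mulVec_of_ne (fun l => by simp [fx, h]), add_zero] at this
    funext j
    rcases hs : σ.symm (.inl j) with i | i | i
    · exact hv1 i j (by rw [← hs, σ.apply_symm_apply])
    · have h5 : σ (.inr (.inl i)) = .inl j := by rw [← hs, σ.apply_symm_apply]
      rcases hu' i with h6 | ⟨l, h6, -⟩ <;> simp [h6] at h5
    · have h5 : σ (.inr (.inr i)) = .inl j := by rw [← hs, σ.apply_symm_apply]
      have hyv : y i = v j := pick_mulVec_of_eq hinl h5 v
      rcases hs2 : σ.symm (.inr (.inr i)) with k | k | k <;>
        have h6 := (σ.symm_apply_eq.mp hs2).symm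
      · rcases hx' k with ⟨l, h7, -⟩ | ⟨l, h7, -⟩ <;> simp [h7] at h6
      · have huy : u k = y i := pick_mulVec_of_eq hinrr h6 y
        rcases hs3 : σ.symm (.inr (.inl k)) with l | l | l <;>
          have h7 := (σ.symm_apply_eq.mp hs3).symm
        · rw [Pi.zero_apply, ← hyv, ← huy, hu1 l k h7]
        · rcases hu' l with h8 | ⟨q, h8, -⟩
          · rw [h8] at h7
            have : l = k := by simpa using h7
            subst this
            rw [h8] at h6
            simp at h6
          · simp [h8] at h7
        · rcases hy' l with h8 | ⟨q, h8, -⟩ <;> simp [h8] at h7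
      · rcases hy' k with h7 | ⟨l, h7, -⟩
        · rw [h7] at h6
          have : k = i := by simpa using h6
          subst this
          rw [h7] at h5
          simp at h5
        · simp [h7] at h6
  · -- the link of a feedback edge
    obtain ⟨i, j, rfl⟩ : ∃ i j, e = (.inr (.inl i), .inr (.inr j)) := by
      obtain ⟨a, b⟩ := e
      rcases a with a | a | a <;> rcases b with b | b | b <;> simp [feedbackEdges] at he
      exact ⟨a, b, rfl⟩
    have hij : σ (.inr (.inl i)) = .inr (.inr j) := (hσ _ heM).symm
    obtain ⟨a, ha⟩ : ∃ a, σ (.inl a) = .inr (.inl i) := by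
      rcases hs : σ.symm (.inr (.inl i)) with k | k | k <;>
        have h6 := (σ.symm_apply_eq.mp hs).symm
      · exact ⟨k, h6⟩
      · rcases hu' k with h7 | ⟨l, h7, -⟩
        · rw [h7] at h6
          have : k = i := by simpa using h6
          subst this
          rw [h7] at hij
          simp at hij
        · simp [h7] at h6
      · rcases hy' k with h7 | ⟨l, h7, -⟩ <;> simp [h7] at h6
    obtain ⟨b, hb⟩ : ∃ b, σ (.inr (.inr j)) = .inl b := by
      rcases hy' j with h7 | ⟨l, h7, -⟩
      · have := σ.injective (h7.trans hij.symm)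
        simp at this
      · exact ⟨l, h7⟩
    -- The feedback matrices 0 and `Matrix.single i j 1` are compared.
    have h0 := hz' 0 fun _ _ _ => rfl
    rw [Matrix.mul_zero, Matrix.zero_mul, add_zero] at h0
    have h1 := hz' (Matrix.single i j 1) fun k l hkl => by
      rw [Matrix.single_apply, if_neg]
      rintro ⟨rfl, rfl⟩
      rw [show sys.K i j = true from he] at hkl
      simp at hkl
    -- Input i acts only on state a, and output j reads only state b, so the closed loop changes the
    -- single entry (a, b). The two determinants then differ by the cofactor (b, a).
    have h2 : pick ℝ σ fx fu * Matrix.single i j (1 : ℝ) * pick ℝ σ fy fx = Matrix.single a b 1 := by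
      ext k l
      rw [Matrix.mul_apply, Finset.sum_eq_single j]
      · rw [Matrix.mul_single_apply_same, Matrix.single_apply]
        have e1 : σ (fx k) = fu i ↔ a = k := by
          rw [show fu i = σ (fx a) from ha.symm, σ.injective.eq_iff, eq_comm]
          exact hinl.eq_iff
        have e2 : σ (fy j) = fx l ↔ b = l := by
          rw [show σ (fy j) = fx b from hb]
          exact hinl.eq_iff
        simp only [pick, Matrix.of_apply, e1, e2]
        by_cases h3 : a = k <;> by_cases h4 : b = l <;> simp [h3, h4]
      · intro l' _ hl'
        rw [Matrix.mul_single_apply_of_ne _ _ _ _ _ hl', zero_mul]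
      · simp
    have h3 : -Matrix.single a b (1 : ℂ) = Matrix.single a b (-1) :=
      (map_neg (Matrix.singleAddMonoidHom a b) (1 : ℂ)).symm
    rw [h2, Matrix.map_add _ (map_add _), Matrix.map_single, map_one, ← sub_sub, sub_eq_add_neg _
      (Matrix.single a b (1 : ℂ)), h3, Matrix.det_add_single, h0, zero_add,
      neg_one_mul, neg_eq_zero] at h1
    refine g.adjugate_ne_zero hpos (fun i j => ?_) hz0 h0 b a h1
    exact hirr i j

/-- Failures only delete edges. A perfect matching that remains is thus one of the original graph
and contains a feedback edge, which has survived; irreducibility is not affected. -/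
theorem Resilient.iff_forall_exists_isPerfectMatching {sys : ClosedLoop n m p}
    (hirr : sys.Irreducible)
    (hfb : ∀ M, IsPerfectMatching sys.bipartite M → ∃ e ∈ M, sys.feedbackEdges e.1 e.2 = true)
    (γ : ℕ) :
    sys.Resilient γ ↔ ∀ I : Finset (Fin m × Fin p), I.card ≤ γ →
      ∃ M, IsPerfectMatching (sys.failLinks I).bipartite M := by
  refine forall₂_congr fun I _ => ⟨fun h => h.exists_isPerfectMatching, fun ⟨M, hM⟩ => ?_⟩
  have hle : ∀ a b, (sys.failLinks I).bipartite a b = true → sys.bipartite a b = true := by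
    intro a b
    rcases a with a | a | a <;> rcases b with b | b | b <;> simp [bipartite, failLinks]
  obtain ⟨e, heM, he⟩ := hfb M ⟨⟨fun e he => hle _ _ (hM.1.1 e he), hM.1.2⟩, hM.2⟩
  refine noSFM_of_isPerfectMatching (sys := sys.failLinks I) hirr hM heM ?_
  have h1 := hM.1.1 e heM
  obtain ⟨a, b⟩ := e
  rcases a with a | a | a <;> rcases b with b | b | b <;>
    simp only [feedbackEdges, Bool.false_eq_true] at he ⊢
  exact h1

end ClosedLoop

/-! ## Values and running times of the basic loops -/

namespace Timed

variable {α β σ : Type}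

@[simp] theorem bind_val (x : Timed α) (f : α → Timed β) : (x >>= f).val = (f x.val).val := rfl
@[simp] theorem bind_time (x : Timed α) (f : α → Timed β) :
    (x >>= f).time = x.time + (f x.val).time := rfl
@[simp] theorem step_val (x : α) : (step x).val = x := rfl
@[simp] theorem step_time (x : α) : (step x).time = 1 := rfl
@[simp] theorem charge_val (k : ℕ) (x : α) : (charge k x).val = x := rfl
@[simp] theorem charge_time (k : ℕ) (x : α) : (charge k x).time = k := rfl

@[simp] theorem foldT_nil (body : σ → α → Timed σ) (s : σ) : foldT body s [] = step s := rfl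

@[simp] theorem foldT_cons_val (body : σ → α → Timed σ) (s : σ) (a : α) (l : List α) :
    (foldT body s (a :: l)).val = (foldT body (body s a).val l).val := rfl

theorem foldT_cons_time (body : σ → α → Timed σ) (s : σ) (a : α) (l : List α) :
    (foldT body s (a :: l)).time = 1 + ((body s a).time + (foldT body (body s a).val l).time) := rfl

theorem foldT_time_le {body : σ → α → Timed σ} {t : ℕ} (l : List α)
    (h : ∀ s, ∀ a ∈ l, (body s a).time ≤ t) (s : σ) :
    (foldT body s l).time ≤ l.length * (t + 1) + 1 := by
  induction l generalizing s with
  | nil => simp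
  | cons a l ih =>
    rw [foldT_cons_time, List.length_cons]
    have h1 := h s a List.mem_cons_self
    have h2 := ih (fun s b hb => h s b (List.mem_cons_of_mem _ hb)) (body s a).val
    linarith

theorem allT_cons (test : α → Timed Bool) (a : α) (l : List α) :
    allT test (a :: l) =
      ⟨(test a).val && (allT test l).val,
        (test a).time + (1 + if (test a).val then (allT test l).time else 1)⟩ := by
  change Timed.mk (if (test a).val then allT test l else step false).val
    ((test a).time + (1 + (if (test a).val then allT test l else step false).time)) = _
  cases (test a).val <;> rfl

theorem allT_val_iff (test : α → Timed Bool) (l : List α) :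
    (allT test l).val = true ↔ ∀ a ∈ l, (test a).val = true := by
  induction l with
  | nil => simp [allT]
  | cons a l ih => simp [allT_cons, ih]

theorem allT_time_le (test : α → Timed Bool) (l : List α) :
    (allT test l).time ≤ (l.map fun a => (test a).time + 2).sum + 1 := by
  induction l with
  | nil => simp [allT]
  | cons a l ih =>
    rw [allT_cons, List.map_cons, List.sum_cons]
    dsimp only
    split_ifs <;> omega

end Timed

/-! ## Correctness of the recursive procedure -/

theorem nodup_edgesIn {V : Type} (S : BGraph V) (M : Mates V) (F : List (V × V)) (l : List V) (hF : F.Nodup)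
    (hl : l.Nodup) (hFl : ∀ e ∈ F, e.1 ∉ l) : (foldT (edgesIn S M) F l).val.Nodup := by
  induction l generalizing F with
  | nil => simpa using hF
  | cons a l ih =>
    rw [Timed.foldT_cons_val]
    rw [List.nodup_cons] at hl
    have hskip : ∀ e ∈ F, e.1 ∉ l := fun e he h => hFl e he (List.mem_cons_of_mem _ h)
    rw [edgesIn, Timed.step_val]
    rcases M.toR a with _ | b
    · exact ih F hF hl.2 hskip
    · dsimp only
      split_ifs
      · refine ih _ (List.nodup_cons.mpr ⟨fun h => ?_, hF⟩) hl.2 fun e he => ?_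
        · exact hFl _ h List.mem_cons_self
        · rcases List.mem_cons.mp he with rfl | he
          · exact hl.1
          · exact hskip e he
      · exact ih F hF hl.2 hskip

section Removals

variable {V : Type} [DecidableEq V]

/-- The graph without the edges in `R`. -/
def removeEdges (G : BGraph V) (R : Finset (V × V)) : BGraph V :=
  fun a b => G a b && !decide ((a, b) ∈ R)

theorem removeEdges_iff {G : BGraph V} {R : Finset (V × V)} {a b : V} :
    removeEdges G R a b = true ↔ G a b = true ∧ (a, b) ∉ R := by
  simp [removeEdges]

@[simp] theorem removeEdges_empty (G : BGraph V) : removeEdges G ∅ = G := by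
  funext a b
  simp [removeEdges]

theorem removeEdges_removeEdges (G : BGraph V) (R R' : Finset (V × V)) :
    removeEdges (removeEdges G R) R' = removeEdges G (R ∪ R') := by
  funext a b
  rw [Bool.eq_iff_iff]
  simp only [removeEdges_iff, Finset.mem_union, not_or, and_assoc]

/-- The matching left after the edges in `R` are cut one by one. -/
def Mates.cutList (M : Mates V) (R : List (V × V)) : Mates V :=
  R.foldl (fun M e => M.cut e.1 e.2) M

theorem forRemovals_cons (vs : List V) (test : BGraph V → Mates V → Timed Bool) (k : ℕ)
    (e : V × V) (F : List (V × V)) (G : BGraph V) (M : Mates V) :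
    forRemovals vs test (k + 1) (e :: F) G M =
      ⟨(forRemovals vs test k F (removeEdges G {e}) (M.cut e.1 e.2)).val &&
          (forRemovals vs test (k + 1) F G M).val,
        vs.length ^ 2 + (2 * vs.length +
          ((forRemovals vs test k F (removeEdges G {e}) (M.cut e.1 e.2)).time + (1 +
            if (forRemovals vs test k F (removeEdges G {e}) (M.cut e.1 e.2)).val then
              (forRemovals vs test (k + 1) F G M).time else 1)))⟩ := by
  have h : removeEdges G {e} = fun a b => G a b && !decide ((a, b) = e) := by
    funext a b
    simp [removeEdges]
  rw [h]
  set r := forRemovals vs test k F (fun a b => G a b && !decide ((a, b) = e)) (M.cut e.1 e.2)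
    with hr
  change Timed.mk (if r.val then forRemovals vs test (k + 1) F G M else step false).val
    (vs.length ^ 2 + (2 * vs.length + (r.time + (1 +
      (if r.val then forRemovals vs test (k + 1) F G M else step false).time)))) = _
  cases r.val <;> rfl

/-- Sublists of length k + 1 are split, as in Pascal's rule, by whether they contain the head. The
matching is cut along with the graph. -/
theorem forRemovals_val_iff (vs : List V) (test : BGraph V → Mates V → Timed Bool) (k : ℕ)
    (F : List (V × V)) (G : BGraph V) (M : Mates V) :
    (forRemovals vs test k F G M).val = true ↔
      ∀ R : List (V × V), R.Sublist F → R.length = k →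
        (test (removeEdges G R.toFinset) (M.cutList R)).val = true := by
  induction F generalizing k G M with
  | nil =>
    rcases k with _ | k
    · simp [forRemovals, Mates.cutList]
    · simp [forRemovals]
  | cons e F ih =>
    rcases k with _ | k
    · have : ∀ R : List (V × V), (R.Sublist (e :: F) ∧ R.length = 0) ↔ R = [] := fun R => by
        constructor
        · exact fun h => List.length_eq_zero_iff.mp h.2
        · rintro rfl; simp
      simp only [forRemovals, ← and_imp, this, forall_eq]
      simp [Mates.cutList]
    · have h1 := ih k (removeEdges G {e}) (M.cut e.1 e.2)
      have h2 := ih (k + 1) G M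
      have h3 : ∀ R : List (V × V),
          removeEdges (removeEdges G {e}) R.toFinset = removeEdges G (e :: R).toFinset := fun R => by
        rw [removeEdges_removeEdges, List.toFinset_cons, Finset.insert_eq]
      rw [forRemovals_cons, Bool.and_eq_true, h1, h2]
      simp only [h3]
      constructor
      · rintro ⟨ha, hb⟩ R hR hlen
        rcases List.sublist_cons_iff.mp hR with hR | ⟨R', rfl, hR'⟩
        · exact hb R hR hlen
        · exact ha R' hR' (by simpa using hlen)
      · intro h
        exact ⟨fun R hR hlen => h (e :: R) (hR.cons_cons e) (by simp [hlen]),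
          fun R hR hlen => h R (hR.cons e) hlen⟩

theorem Mates.Consistent.cut {M : Mates V} (hM : M.Consistent) {a b : V} (hab : M.toR a = some b) :
    (M.cut a b).Consistent ∧
      ∀ a' b', (M.cut a b).toR a' = some b' ↔ M.toR a' = some b' ∧ (a', b') ≠ (a, b) := by
  have hba := (hM a b).mp hab
  refine ⟨fun a' b' => ?_, fun a' b' => ?_⟩
  · simp only [Mates.cut, Function.update_apply]
    by_cases ha : a' = a <;> by_cases hb : b' = b
    · simp [ha, hb]
    · simp only [ha, hb, if_true, if_false, reduceCtorEq, false_iff]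
      rw [← hM a b', hab]
      exact fun h => hb (Option.some.inj h).symm
    · simp only [ha, hb, if_true, if_false, reduceCtorEq, iff_false]
      rw [hM a' b, hba]
      exact fun h => ha (Option.some.inj h).symm
    · simp only [ha, hb, if_false]
      exact hM a' b'
  · simp only [Mates.cut, Function.update_apply]
    by_cases ha : a' = a
    · subst ha
      simp only [if_true, reduceCtorEq, hab, Option.some.injEq, Prod.mk.injEq, true_and, ne_eq,
        false_iff, not_and, not_not]
      exact fun h => h.symm
    · simp [ha]

theorem Mates.Consistent.cutList {M : Mates V} (hM : M.Consistent) {R : List (V × V)}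
    (hR : R.Nodup) (hRM : ∀ e ∈ R, M.toR e.1 = some e.2) :
    (M.cutList R).Consistent ∧
      ∀ a b, (M.cutList R).toR a = some b ↔ M.toR a = some b ∧ (a, b) ∉ R := by
  induction R generalizing M with
  | nil => simpa [Mates.cutList] using hM
  | cons e R ih =>
    have h1 := hM.cut (hRM e List.mem_cons_self)
    rw [List.nodup_cons] at hR
    have h2 := ih h1.1 hR.2 fun f hf => by
      rw [h1.2]
      exact ⟨hRM f (List.mem_cons_of_mem _ hf), fun h => hR.1 (show e ∈ R from (show f = e from h) ▸ hf)⟩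
    refine ⟨h2.1, fun a b => ?_⟩
    have := h2.2 a b
    rw [Mates.cutList] at this ⊢
    rw [List.foldl_cons, this, h1.2, List.mem_cons, not_or, and_assoc]

theorem mem_edgesIn_iff (S : BGraph V) (M : Mates V) (F : List (V × V)) (l : List V) (e : V × V) :
    e ∈ (foldT (edgesIn S M) F l).val ↔
      e ∈ F ∨ e.1 ∈ l ∧ M.toR e.1 = some e.2 ∧ S e.1 e.2 = true := by
  induction l generalizing F with
  | nil => simp
  | cons a l ih =>
    rw [Timed.foldT_cons_val, ih]
    have h : e ∈ (edgesIn S M F a).val ↔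
        e ∈ F ∨ e.1 = a ∧ M.toR e.1 = some e.2 ∧ S e.1 e.2 = true := by
      rw [edgesIn, Timed.step_val]
      rcases hb : M.toR a with _ | b
      · simp only [iff_self_or]
        rintro ⟨rfl, h, -⟩
        rw [hb] at h
        exact absurd h (by simp)
      · dsimp only
        obtain ⟨e1, e2⟩ := e
        split_ifs with hS
        · simp only [List.mem_cons, Prod.mk.injEq]
          constructor
          · rintro (⟨rfl, rfl⟩ | h)
            · exact Or.inr ⟨rfl, hb, hS⟩
            · exact Or.inl h
          · rintro (h | ⟨rfl, h, -⟩)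
            · exact Or.inr h
            · rw [hb] at h
              exact Or.inl ⟨rfl, (Option.some.inj h).symm⟩
        · simp only [iff_self_or]
          rintro ⟨rfl, h, h'⟩
          rw [hb] at h
          exact absurd (Option.some.inj h ▸ h') hS
    rw [h, List.mem_cons]
    tauto

variable [Fintype V]

theorem Mates.mem_edges {M : Mates V} {e : V × V} : e ∈ M.edges ↔ M.toR e.1 = some e.2 := by
  simp [Mates.edges]

theorem Mates.Consistent.isMatching {M : Mates V} (hM : M.Consistent) {G : BGraph V}
    (hG : ∀ a b, M.toR a = some b → G a b = true) : IsMatching G M.edges := by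
  refine ⟨fun e he => hG _ _ (mem_edges.mp he), fun e he f hf hef => ?_⟩
  rw [mem_edges] at he hf
  constructor
  · intro h
    rw [h, hf] at he
    exact hef (Prod.ext h (Option.some.inj he).symm)
  · intro h
    rw [hM] at he hf
    rw [h, hf] at he
    exact hef (Prod.ext (Option.some.inj he).symm h)

/-- If R misses M, then M survives. Otherwise the part of R inside M is one of the sets enumerated
in case q = γ - |R ∩ M|, and at most q further edges of S outside M are removed, which the inductive
hypothesis covers. Conversely, every removal examined has at most γ edges in all. -/
theorem verifyRemovals_val_iff {vs : List V} (hvs : ∀ a, a ∈ vs) (hnd : vs.Nodup)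
    {mc : BGraph V → BGraph V → Timed (Option (Mates V))} {chk : BGraph V → Mates V → Timed Bool}
    (hmc : FindsMinCostPM mc) (hchk : ChecksPM chk) (γ : ℕ) (hγ : 1 ≤ γ) (G S : BGraph V) :
    (verifyRemovals vs mc chk γ G S).val = true ↔
      ∀ R : Finset (V × V), (∀ e ∈ R, S e.1 e.2 = true) → R.card ≤ γ →
        ∃ M, IsPerfectMatching (removeEdges G R) M := by
  induction γ using Nat.strong_induction_on generalizing G S with
  | _ γ ih =>
  rw [verifyRemovals, Timed.bind_val]
  rcases hval : (mc G S).val with _ | M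
  · simp only [Timed.step_val, Bool.false_eq_true, false_iff, not_forall]
    refine ⟨∅, by simp, by simp, fun ⟨M, hM⟩ => (hmc G S).1 hval ⟨M, hM.mono fun e he => ?_⟩⟩
    exact (removeEdges_iff.mp (hM.1.1 e he)).1
  obtain ⟨hcons, hM, -⟩ := (hmc G S).2 M hval
  simp only [Timed.bind_val, Timed.charge_val, Timed.allT_val_iff, forRemovals_val_iff]
  set F := (foldT (edgesIn S M) [] vs).val with hF
  set S₁ : BGraph V := fun a b => S a b && !decide (M.toR a = some b) with hS₁
  have hFnd : F.Nodup := nodup_edgesIn S M [] vs List.nodup_nil hnd (by simp)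
  have hFmem : ∀ e, e ∈ F ↔ M.toR e.1 = some e.2 ∧ S e.1 e.2 = true := fun e => by
    rw [hF, mem_edgesIn_iff]
    simp [hvs]
  have htest : ∀ (q : Fin γ) (R : List (V × V)), R.Sublist F → R.length = γ - q.val →
      (((if q.val = 0 then chk else fun G₁ _ => verifyRemovals vs mc chk q.val G₁ S₁)
        (removeEdges G R.toFinset) (M.cutList R)).val = true ↔
      ∀ R' : Finset (V × V), (∀ e ∈ R', S₁ e.1 e.2 = true) → R'.card ≤ q.val →
        ∃ M, IsPerfectMatching (removeEdges G (R.toFinset ∪ R')) M) := by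
    intro q R hR _
    have hRM : ∀ e ∈ R, M.toR e.1 = some e.2 := fun e he => ((hFmem e).mp (hR.subset he)).1
    have hcut := hcons.cutList (hR.nodup hFnd) hRM
    split_ifs with hq
    -- For q = 0 no further removal is allowed, so a bare existence check suffices. It is started
    -- from the part of `M` that is left.
    · rw [hchk _ _ hcut.1 (hcut.1.isMatching fun a b hab => ?_)]
      · simp only [hq, nonpos_iff_eq_zero, Finset.card_eq_zero]
        constructor
        · rintro h R' - rfl
          rwa [Finset.union_empty]
        · intro h
          simpa using h ∅ (by simp) rfl
      · have h1 := (hcut.2 a b).mp hab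
        rw [removeEdges_iff, List.mem_toFinset]
        exact ⟨hM.1.1 (a, b) (Mates.mem_edges.mpr h1.1), h1.2⟩
    · rw [ih q.val q.isLt (Nat.one_le_iff_ne_zero.mpr hq)]
      simp only [removeEdges_removeEdges]
  constructor
  · intro h R hRS hRc
    by_cases hempty : R.filter (fun e => M.toR e.1 = some e.2) = ∅
    · refine ⟨M.edges, hM.mono fun e he => removeEdges_iff.mpr ⟨hM.1.1 e he, fun heR => ?_⟩⟩
      rw [Finset.filter_eq_empty_iff] at hempty
      exact hempty heR (Mates.mem_edges.mp he)
    · set R₁ := R.filter (fun e => M.toR e.1 = some e.2) with hR₁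
      have hpos : 0 < R₁.card := Finset.card_pos.mpr (Finset.nonempty_iff_ne_empty.mpr hempty)
      have hle : R₁.card ≤ γ := (Finset.card_filter_le _ _).trans hRc
      set L := F.filter (fun e => decide (e ∈ R₁)) with hL
      have hLs : L.Sublist F := List.filter_sublist
      have hLR : L.toFinset = R₁ := by
        ext e
        rw [List.mem_toFinset, hL, List.mem_filter, decide_eq_true_iff, and_iff_right_iff_imp, hFmem]
        intro he
        rw [hR₁, Finset.mem_filter] at he
        exact ⟨he.2, hRS e he.1⟩
      have hLlen : L.length = R₁.card := by
        rw [← hLR, List.toFinset_card_of_nodup (hLs.nodup hFnd)]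
      -- This index is below γ because `R₁` is nonempty.
      have h1 := h ⟨γ - R₁.card, by omega⟩ (List.mem_finRange _) L hLs (by simp; omega)
      rw [htest _ L hLs (by simp; omega)] at h1
      have h2 := h1 (R \ R₁) (fun e he => ?_) ?_
      · rwa [hLR, Finset.union_sdiff_of_subset (Finset.filter_subset _ _)] at h2
      · rw [Finset.mem_sdiff, hR₁, Finset.mem_filter, not_and] at he
        simp [hS₁, hRS e he.1, he.2 he.1]
      · rw [Finset.card_sdiff_of_subset (Finset.filter_subset _ _)]
        change R.card - R₁.card ≤ γ - R₁.card
        omega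
  · intro h q _ R hR hlen
    rw [htest q R hR hlen]
    intro R' hR' hc
    refine h _ (fun e he => ?_) ?_
    · rcases Finset.mem_union.mp he with he | he
      · exact ((hFmem e).mp (hR.subset (List.mem_toFinset.mp he))).2
      · have := hR' e he
        simp only [hS₁, Bool.and_eq_true] at this
        exact this.1
    · have h1 := R.toFinset_card_le
      have h2 := Finset.card_union_le R.toFinset R'
      have := q.isLt
      omega

end Removals

/-! ## Correctness of the search for augmenting paths -/

section AugmentingPaths

variable {V : Type}

/-- The right vertices in the list, latest first, are reached from `root` by alternating paths
recorded in `par`. -/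
def ReachedList (G : BGraph V) (M : Mates V) (root : V) (par : V → Option V) : List V → Prop
  | [] => True
  | b :: l => b ∉ l ∧ ReachedList G M root par l ∧
      ∃ a, par b = some a ∧ G a b = true ∧ (a = root ∨ ∃ b₁ ∈ l, M.toR a = some b₁)

theorem ReachedList.suffix {G : BGraph V} {M : Mates V} {root : V} {par : V → Option V}
    {l₁ l₂ : List V} (h : ReachedList G M root par (l₁ ++ l₂)) : ReachedList G M root par l₂ := by
  induction l₁ with
  | nil => exact h
  | cons b l₁ ih => exact ih h.2.1

theorem ReachedList.nodup {G : BGraph V} {M : Mates V} {root : V} {par : V → Option V}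
    {l : List V} (h : ReachedList G M root par l) : l.Nodup := by
  induction l with
  | nil => exact List.nodup_nil
  | cons b l ih => exact List.nodup_cons.mpr ⟨h.1, ih h.2.1⟩

theorem ReachedList.congr {G : BGraph V} {M : Mates V} {root : V} {par par' : V → Option V}
    {l : List V} (h : ReachedList G M root par l) (hp : ∀ b ∈ l, par' b = par b) :
    ReachedList G M root par' l := by
  induction l with
  | nil => trivial
  | cons b l ih =>
    obtain ⟨h1, h2, a, h3, h4⟩ := h
    exact ⟨h1, ih h2 fun c hc => hp c (List.mem_cons_of_mem _ hc), a,
      (hp b List.mem_cons_self).trans h3, h4⟩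

variable [DecidableEq V]

/-- While a path is being flipped, exactly one right vertex carries a possibly outdated mate.
Consistency is therefore stated with that cell erased; the exceptional vertex moves from b to the
old partner of a. -/
theorem Mates.Consistent.rematch {R L : V → Option V} {a b b₁ : V}
    (h : Mates.Consistent ⟨R, Function.update L b none⟩) (ha : R a = some b₁) :
    Mates.Consistent
      ⟨Function.update R a (some b), Function.update (Function.update L b (some a)) b₁ none⟩ := by
  have h1 := (h a b₁).mp ha
  intro a' b'
  have h2 := h a' b'
  have h3 := h a b'
  have h4 := h a' b₁
  simp only [Function.update_apply] at h1 h2 h3 h4 ⊢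
  grind

theorem Mates.Consistent.join_free {M : Mates V} {a b : V}
    (h : Mates.Consistent ⟨M.toR, Function.update M.toL b none⟩) (ha : M.toR a = none) :
    (M.join a b).Consistent := by
  intro a' b'
  have h2 := h a' b'
  have h3 := h a b'
  simp only [Mates.join, Function.update_apply] at h2 h3 ⊢
  grind

/-- The path descends strictly in the list of reached vertices, so it never meets a pair already
altered: on the tail `l` the current matching agrees with the original one. It ends at the free
root, and the length of the list bounds the number of rounds. -/
theorem augment_spec {G : BGraph V} {M : Mates V} {root : V} {par : V → Option V}
    (hroot : M.toR root = none) (k : ℕ) (b : V) (l : List V) (M' : Mates V)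
    (hl : ReachedList G M root par (b :: l)) (hk : l.length < k)
    (hM' : Mates.Consistent ⟨M'.toR, Function.update M'.toL b none⟩)
    (hG : ∀ a b, M'.toR a = some b → G a b = true)
    (hagree : ∀ a, ∀ b₁ ∈ l, M.toR a = some b₁ → M'.toR a = some b₁)
    (hroot' : M'.toR root = none) :
    (augment par k b M').val.Consistent ∧
      (∀ a' b', (augment par k b M').val.toR a' = some b' → G a' b' = true) ∧
      (augment par k b M').val.toR root ≠ none := by
  induction k generalizing b l M' with
  | zero => exact absurd hk (Nat.not_lt_zero _)
  | succ k ih =>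
    obtain ⟨hbl, hl', a, hpar, hab, ha⟩ := hl
    have hjoinG : ∀ a' b', (M'.join a b).toR a' = some b' → G a' b' = true := by
      intro a' b' h
      simp only [Mates.join, Function.update_apply] at h
      split_ifs at h with h0
      · rw [h0, ← Option.some.inj h]; exact hab
      · exact hG a' b' h
    rcases ha with rfl | ⟨b₁, hb₁, ha⟩
    · have hval : (augment par (k + 1) b M').val = M'.join a b := by
        simp [augment, hpar, hroot']
      rw [hval]
      exact ⟨hM'.join_free hroot', hjoinG, by simp [Mates.join]⟩
    · have ha' := hagree a b₁ hb₁ ha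
      have hval : (augment par (k + 1) b M').val = (augment par k b₁ (M'.join a b)).val := by
        simp [augment, hpar, ha']
      rw [hval]
      obtain ⟨l₁, l₂, rfl⟩ := List.append_of_mem hb₁
      have hl₂ : ReachedList G M root par (b₁ :: l₂) := hl'.suffix
      have hane : root ≠ a := by
        rintro rfl
        rw [hroot] at ha
        exact absurd ha (by simp)
      refine ih b₁ l₂ (M'.join a b) hl₂ ?_ (hM'.rematch ha') hjoinG (fun a' b' hb' ha'' => ?_) ?_
      · simp only [List.length_append, List.length_cons] at hk
        omega
      · have hne : a' ≠ a := by
          rintro rfl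
          rw [ha] at ha''
          exact hl₂.1 (Option.some.inj ha'' ▸ hb')
        exact (Function.update_of_ne hne _ _).trans (hagree a' b' (by simp [hb']) ha'')
      · exact (Function.update_of_ne hane _ _).trans hroot'

theorem augment_toR_ne_none (par : V → Option V) (k : ℕ) (b : V) (M : Mates V) (a : V)
    (h : M.toR a ≠ none) : (augment par k b M).val.toR a ≠ none := by
  induction k generalizing b M with
  | zero => exact h
  | succ k ih =>
    rw [augment]
    rcases par b with _ | a₁
    · exact h
    · have h1 : (M.join a₁ b).toR a ≠ none := by
        simp only [Mates.join, Function.update_apply]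
        split_ifs
        · simp
        · exact h
      simp only [bind_val, step_val]
      rcases M.toR a₁ with _ | b₁
      · exact h1
      · exact ih b₁ _ h1

/-- Invariant of the search: `E` are the left vertices explored so far, `l` the right vertices
reached, and the pairs in `P` have been looked at. -/
structure AltSearch.Inv (G : BGraph V) (M : Mates V) (root : V) (E : List V) (P : V → V → Prop)
    (s : AltSearch V) (l : List V) : Prop where
  reached : ReachedList G M root s.par l
  par_iff : ∀ b, s.par b ≠ none ↔ b ∈ l
  nodup : (E ++ s.todo).Nodup
  root_mem : root ∈ E ++ s.todo
  left : ∀ a ∈ E ++ s.todo, a = root ∨ ∃ b ∈ l, M.toR a = some b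
  matched : s.goal = none → ∀ b ∈ l, ∃ a ∈ E ++ s.todo, M.toR a = some b
  closed : s.goal = none → ∀ a b, P a b → G a b = true → b ∈ l
  goal : ∀ g, s.goal = some g → M.toL g = none ∧ ∃ l', l = g :: l'

variable {G : BGraph V} {M : Mates V} {root : V}

theorem AltSearch.Inv.visit (hM : M.Consistent) (hroot : M.toR root = none) {E : List V}
    {P : V → V → Prop} {s : AltSearch V} {l : List V} (h : s.Inv G M root E P l) {a : V}
    (ha : a ∈ E) (b : V) :
    ∃ l', (AltSearch.visit G M a s b).val.Inv G M root E
      (fun a' b' => P a' b' ∨ a' = a ∧ b' = b) l' := by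
  rw [AltSearch.visit, step_val]
  split_ifs with hc
  · simp only [Bool.and_eq_true, Option.isNone_iff_eq_none] at hc
    obtain ⟨⟨hgoal, hab⟩, hpar⟩ := hc
    have hbl : b ∉ l := fun hb => (h.par_iff b).mpr hb hpar
    have hreach : ReachedList G M root (Function.update s.par b (some a)) (b :: l) :=
      ⟨hbl, h.reached.congr fun c hc => Function.update_of_ne (by rintro rfl; exact hbl hc) _ _,
        a, Function.update_self .., hab, h.left a (List.mem_append_left _ ha)⟩
    have hpi : ∀ c, Function.update s.par b (some a) c ≠ none ↔ c ∈ b :: l := fun c => by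
      rw [Function.update_apply, List.mem_cons]
      split_ifs with hcb
      · simp [hcb]
      · simp [hcb, h.par_iff c]
    have hclosed : ∀ a' b', (P a' b' ∨ a' = a ∧ b' = b) → G a' b' = true → b' ∈ b :: l := by
      rintro a' b' (hP | ⟨rfl, rfl⟩) hG
      · exact List.mem_cons_of_mem _ (h.closed hgoal a' b' hP hG)
      · exact List.mem_cons_self
    rcases hL : M.toL b with _ | a₁
    · refine ⟨b :: l, hreach, hpi, h.nodup, h.root_mem, fun a' ha' => ?_, by simp, by simp, ?_⟩
      · exact (h.left a' ha').imp id fun ⟨c, hc, hc'⟩ => ⟨c, List.mem_cons_of_mem _ hc, hc'⟩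
      · rintro g hg
        obtain rfl := Option.some.inj hg
        exact ⟨hL, l, rfl⟩
    · have hR : M.toR a₁ = some b := (hM a₁ b).mpr hL
      -- A left vertex other than the root enters the search only through its matched partner, and
      -- `b` has just been reached for the first time.
      have hnew : a₁ ∉ E ++ s.todo := fun hmem => by
        rcases h.left a₁ hmem with rfl | ⟨c, hc, hc'⟩
        · rw [hroot] at hR; simp at hR
        · rw [hR] at hc'
          exact hbl (Option.some.inj hc' ▸ hc)
      have hperm : (E ++ a₁ :: s.todo).Perm (a₁ :: (E ++ s.todo)) := List.perm_middle
      refine ⟨b :: l, hreach, hpi, hperm.nodup_iff.mpr (List.nodup_cons.mpr ⟨hnew, h.nodup⟩),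
        hperm.mem_iff.mpr (List.mem_cons_of_mem _ h.root_mem), fun a' ha' => ?_,
        fun _ c hc => ?_, fun _ => hclosed, by simp⟩
      · rcases List.mem_cons.mp (hperm.mem_iff.mp ha') with rfl | ha'
        · exact Or.inr ⟨b, List.mem_cons_self, hR⟩
        · exact (h.left a' ha').imp id fun ⟨c, hc, hc'⟩ => ⟨c, List.mem_cons_of_mem _ hc, hc'⟩
      · rcases List.mem_cons.mp hc with rfl | hc
        · exact ⟨a₁, hperm.mem_iff.mpr List.mem_cons_self, hR⟩
        · obtain ⟨a', ha', hc'⟩ := h.matched hgoal c hc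
          exact ⟨a', hperm.mem_iff.mpr (List.mem_cons_of_mem _ ha'), hc'⟩
  · refine ⟨l, h.reached, h.par_iff, h.nodup, h.root_mem, h.left, h.matched, ?_, h.goal⟩
    rintro hgoal a' b' (hP | ⟨rfl, rfl⟩) hG
    · exact h.closed hgoal a' b' hP hG
    · rw [← h.par_iff]
      intro hpar
      simp [hgoal, hG, hpar] at hc

theorem AltSearch.Inv.foldT_visit (hM : M.Consistent) (hroot : M.toR root = none) {E : List V}
    {P : V → V → Prop} {s : AltSearch V} {l : List V} (h : s.Inv G M root E P l) {a : V}
    (ha : a ∈ E) (vs : List V) :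
    ∃ l', (foldT (AltSearch.visit G M a) s vs).val.Inv G M root E
      (fun a' b' => P a' b' ∨ a' = a ∧ b' ∈ vs) l' := by
  induction vs generalizing P s l with
  | nil => simpa using ⟨l, h⟩
  | cons b vs ih =>
    obtain ⟨l₁, h₁⟩ := h.visit hM hroot ha b
    obtain ⟨l₂, h₂⟩ := ih h₁
    refine ⟨l₂, ?_⟩
    rw [foldT_cons_val]
    refine { h₂ with closed := fun hg a' b' hP => h₂.closed hg a' b' ?_ }
    rw [List.mem_cons] at hP
    tauto

/-- Every round explores a new left vertex. When the rounds are used up, all vertices have been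
explored, and since explored and waiting vertices are distinct, none is waiting. -/
theorem AltSearch.Inv.run [Fintype V] (hM : M.Consistent) (hroot : M.toR root = none)
    {vs : List V} (hvs : ∀ a, a ∈ vs) (k : ℕ) {E : List V} {s : AltSearch V} {l : List V}
    (h : s.Inv G M root E (fun a _ => a ∈ E) l) (hk : Fintype.card V ≤ E.length + k) :
    ∃ E' l', (AltSearch.run vs G M k s).val.Inv G M root E' (fun a _ => a ∈ E') l' ∧
      ((AltSearch.run vs G M k s).val.goal = none → (AltSearch.run vs G M k s).val.todo = []) := by
  induction k generalizing E s l with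
  | zero =>
    refine ⟨E, l, h, fun _ => ?_⟩
    have h1 := h.nodup.length_le_card
    rw [List.length_append] at h1
    exact List.length_eq_zero_iff.mp (show s.todo.length = 0 by omega)
  | succ k ih =>
    rcases hgoal : s.goal with _ | g
    · rcases htodo : s.todo with _ | ⟨a, todo⟩
      · have hval : (AltSearch.run vs G M (k + 1) s).val = s := by
          simp [AltSearch.run, hgoal, htodo]
        rw [hval]
        exact ⟨E, l, h, fun _ => htodo⟩
      · have hval : (AltSearch.run vs G M (k + 1) s).val = (AltSearch.run vs G M k
            (foldT (AltSearch.visit G M a) { s with todo := todo } vs).val).val := by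
          simp [AltSearch.run, hgoal, htodo]
        rw [hval]
        have hperm : (E ++ s.todo).Perm (a :: E ++ todo) := by
          rw [htodo]; exact List.perm_middle
        have h' : AltSearch.Inv G M root (a :: E) (fun a _ => a ∈ E)
            { s with todo := todo } l :=
          { reached := h.reached
            par_iff := h.par_iff
            nodup := hperm.nodup_iff.mp h.nodup
            root_mem := hperm.mem_iff.mp h.root_mem
            left := fun a' ha' => h.left a' (hperm.mem_iff.mpr ha')
            matched := fun hg b hb =>
              have ⟨a', ha', hb'⟩ := h.matched hg b hb
              ⟨a', hperm.mem_iff.mp ha', hb'⟩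
            closed := h.closed
            goal := h.goal }
        obtain ⟨l₂, h₂⟩ := h'.foldT_visit hM hroot List.mem_cons_self vs
        refine ih (E := a :: E) (l := l₂)
          { h₂ with closed := fun hg a' b' hP => h₂.closed hg a' b' ?_ } ?_
        · rcases List.mem_cons.mp hP with hP | hP
          · exact Or.inr ⟨hP, hvs b'⟩
          · exact Or.inl hP
        · rw [List.length_cons]; omega
    · have hval : (AltSearch.run vs G M (k + 1) s).val = s := by
        simp [AltSearch.run, hgoal]
      rw [hval]
      exact ⟨E, l, h, fun h0 => by simp [hgoal] at h0⟩

/-- A failed search exhibits a Hall violator: all neighbours of the explored set E are reached, and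
every reached right vertex is matched into E without the free root, so E has fewer than |E|
neighbours. -/
theorem matchVertex_spec [Fintype V] {vs : List V} (hvs : ∀ a, a ∈ vs) (hnd : vs.Nodup)
    (hM : M.Consistent) (hMG : ∀ a b, M.toR a = some b → G a b = true) (root : V) :
    ((matchVertex vs G (some M) root).val = none → ¬ ∃ M', IsPerfectMatching G M') ∧
      ∀ M', (matchVertex vs G (some M) root).val = some M' →
        M'.Consistent ∧ (∀ a b, M'.toR a = some b → G a b = true) ∧ M'.toR root ≠ none ∧
          ∀ a, M.toR a ≠ none → M'.toR a ≠ none := by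
  have hlen : vs.length = Fintype.card V := by
    rw [← List.toFinset_card_of_nodup hnd, ← Finset.card_univ]
    congr 1
    ext a; simp [hvs]
  rcases hroot : M.toR root with _ | b
  swap
  · have hval : (matchVertex vs G (some M) root).val = some M := by simp [matchVertex, hroot]
    rw [hval]
    refine ⟨by simp, fun M' h => ?_⟩
    obtain rfl := Option.some.inj h
    exact ⟨hM, hMG, by simp [hroot], fun _ h => h⟩
  set s₀ : AltSearch V := { par := fun _ => none, todo := [root], goal := none } with hs₀
  have h₀ : s₀.Inv G M root [] (fun a _ => a ∈ ([] : List V)) [] :=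
    { reached := trivial
      par_iff := by simp [hs₀]
      nodup := by simp [hs₀]
      root_mem := by simp [hs₀]
      left := by simp [hs₀]
      matched := by simp
      closed := by simp
      goal := by simp [hs₀] }
  obtain ⟨E, l, hinv, htodo⟩ := h₀.run hM hroot hvs vs.length (by simp [hlen])
  set r := (AltSearch.run vs G M vs.length s₀).val with hr
  rcases hgoal : r.goal with _ | g
  · have hval : (matchVertex vs G (some M) root).val = none := by
      simp [matchVertex, hroot, ← hs₀, ← hr, hgoal]
    rw [hval]
    refine ⟨fun _ hex => ?_, by simp⟩
    obtain ⟨σ, hσ⟩ := exists_isPerfectMatching_iff.mp hex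
    have hE := htodo hgoal
    have hl := hinv.reached.nodup
    have hmatched := hinv.matched hgoal
    have hEnd := hinv.nodup
    have hrootE := hinv.root_mem
    rw [hE, List.append_nil] at hmatched hEnd hrootE
    have h1 : E.toFinset.card ≤ l.toFinset.card := by
      refine Finset.card_le_card_of_injOn σ (fun a ha => ?_) σ.injective.injOn
      exact List.mem_toFinset.mpr
        (hinv.closed hgoal a (σ a) (List.mem_toFinset.mp ha) (hσ a))
    have h2 : l.toFinset.card ≤ (E.toFinset.erase root).card := by
      refine Finset.card_le_card_of_injOn (fun b => (M.toL b).getD root) (fun b hb => ?_)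
        fun b hb c hc hbc => ?_
      · obtain ⟨a, ha, hab⟩ := hmatched b (List.mem_toFinset.mp hb)
        have hba := (hM a b).mp hab
        simp only [hba, Option.getD_some, Finset.coe_erase, Set.mem_sdiff, Finset.mem_coe,
          List.mem_toFinset, ha, Set.mem_singleton_iff, true_and]
        rintro rfl
        rw [hroot] at hab; simp at hab
      · obtain ⟨a, -, hab⟩ := hmatched b (List.mem_toFinset.mp hb)
        obtain ⟨a', -, hab'⟩ := hmatched c (List.mem_toFinset.mp hc)
        simp only [(hM a b).mp hab, (hM a' c).mp hab', Option.getD_some] at hbc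
        rw [hbc, hab'] at hab
        exact (Option.some.inj hab).symm
    have h3 := Finset.card_erase_lt_of_mem (List.mem_toFinset.mpr hrootE)
    omega
  · obtain ⟨hg, l', rfl⟩ := hinv.goal g hgoal
    have hval : (matchVertex vs G (some M) root).val = some (augment r.par vs.length g M).val := by
      simp [matchVertex, hroot, ← hs₀, ← hr, hgoal]
    rw [hval]
    refine ⟨by simp, fun M' h => ?_⟩
    obtain rfl := Option.some.inj h
    -- At the start of the augmentation the exceptional vertex is the free goal, where nothing needs
    -- to be erased.
    have hself : Function.update M.toL g none = M.toL := by
      rw [← hg, Function.update_eq_self]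
    have h1 := augment_spec hroot vs.length g l' M hinv.reached ?_ ?_ hMG (fun _ _ _ h => h) hroot
    · exact ⟨h1.1, h1.2.1, h1.2.2, fun a ha => augment_toR_ne_none _ _ _ _ a ha⟩
    · have := hinv.reached.nodup.length_le_card
      rw [List.length_cons] at this
      omega
    · rw [hself]; exact hM

theorem foldT_matchVertex_spec [Fintype V] {vs : List V} (hvs : ∀ a, a ∈ vs) (hnd : vs.Nodup)
    (l : List V) (hM : M.Consistent) (hMG : ∀ a b, M.toR a = some b → G a b = true) :
    ((foldT (matchVertex vs G) (some M) l).val = none → ¬ ∃ M', IsPerfectMatching G M') ∧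
      ∀ M', (foldT (matchVertex vs G) (some M) l).val = some M' →
        M'.Consistent ∧ (∀ a b, M'.toR a = some b → G a b = true) ∧
          ∀ a, (a ∈ l ∨ M.toR a ≠ none) → M'.toR a ≠ none := by
  induction l generalizing M with
  | nil =>
    refine ⟨by simp, fun M' h => ?_⟩
    obtain rfl := Option.some.inj h
    exact ⟨hM, hMG, by simp⟩
  | cons a l ih =>
    rw [foldT_cons_val]
    have h1 := matchVertex_spec hvs hnd hM hMG a
    rcases hval : (matchVertex vs G (some M) a).val with _ | M₁
    · have h2 : ∀ l : List V, (foldT (matchVertex vs G) none l).val = none := by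
        intro l
        induction l with
        | nil => rfl
        | cons b l ih => exact ih
      rw [h2]
      exact ⟨fun _ => h1.1 hval, by simp⟩
    · obtain ⟨h2, h3, h4, h5⟩ := h1.2 M₁ hval
      have h6 := ih h2 h3
      refine ⟨h6.1, fun M' hM' => ?_⟩
      obtain ⟨h7, h8, h9⟩ := h6.2 M' hM'
      refine ⟨h7, h8, fun b hb => h9 b ?_⟩
      rcases hb with hb | hb
      · rcases List.mem_cons.mp hb with rfl | hb
        · exact Or.inr h4
        · exact Or.inl hb
      · exact Or.inr (h5 b hb)

theorem Mates.Consistent.exists_isPerfectMatching [Fintype V] {M : Mates V} (hM : M.Consistent)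
    (hMG : ∀ a b, M.toR a = some b → G a b = true) (hall : ∀ a, M.toR a ≠ none) :
    ∃ σ : V ≃ V, (∀ a, M.toR a = some (σ a)) ∧ IsPerfectMatching G M.edges := by
  choose s hs using fun a => Option.ne_none_iff_exists'.mp (hall a)
  have hinj : Function.Injective s := fun a a' h => by
    have h1 := (hM _ _).mp (hs a)
    have h2 := (hM _ _).mp (hs a')
    rw [h, h2] at h1
    exact (Option.some.inj h1).symm
  refine ⟨Equiv.ofBijective s (Finite.injective_iff_bijective.mp hinj), hs,
    hM.isMatching hMG, ?_⟩
  have : M.edges = Finset.univ.map ⟨fun a => (a, s a), fun _ _ h => congrArg Prod.fst h⟩ := by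
    ext ⟨a, b⟩
    rw [mem_edges, hs, Option.some.injEq, Finset.mem_map]
    exact ⟨fun h => ⟨a, Finset.mem_univ a, Prod.ext rfl h⟩,
      fun ⟨a', _, h⟩ => by obtain ⟨rfl, rfl⟩ := Prod.ext_iff.mp h; rfl⟩
  rw [this, Finset.card_map, Finset.card_univ]

theorem checksPM_checkPM [Fintype V] {vs : List V} (hvs : ∀ a, a ∈ vs) (hnd : vs.Nodup) :
    ChecksPM (checkPM vs) := by
  intro G M hM hMG
  have h := foldT_matchVertex_spec (G := G) hvs hnd vs hM
    fun a b hab => hMG.1 (a, b) (Mates.mem_edges.mpr hab)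
  have hval : (checkPM vs G M).val = (foldT (matchVertex vs G) (some M) vs).val.isSome := rfl
  rw [hval]
  rcases hr : (foldT (matchVertex vs G) (some M) vs).val with _ | M'
  · simpa using h.1 hr
  · obtain ⟨h1, h2, h3⟩ := h.2 M' hr
    simp only [Option.isSome_some, true_iff]
    obtain ⟨_, _, h4⟩ := h1.exists_isPerfectMatching h2 fun a => h3 a (Or.inl (hvs a))
    exact ⟨_, h4⟩

end AugmentingPaths

/-! ## Correctness of the Hungarian method -/

section Hungarian

variable {V : Type}

/-- The array `toL` describes a matching of the left vertices in `D` along edges that are tight for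
the potentials `u`, `v`. -/
structure TightMatching (c : V → V → ℤ) (u v : V → ℤ) (D : V → Prop) (toL : V → Option V) :
    Prop where
  inj : ∀ a b b', toL b = some a → toL b' = some a → b = b'
  tight : ∀ a b, toL b = some a → u a + v b = c a b
  dom : ∀ a, (∃ b, toL b = some a) ↔ D a

/-- The left vertex from which a right vertex is reached, given its predecessor in the tree. -/
def treeParent (toL : V → Option V) (root : V) : Option V → Option V
  | none => some root
  | some b => toL b

/-- Each right vertex in the list is preceded in the tree by the root or a later list element. -/
def WayList (way : V → Option V) : List V → Prop
  | [] => True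
  | b :: l => b ∉ l ∧ WayList way l ∧ ∀ b₁, way b = some b₁ → b₁ ∈ l

theorem WayList.suffix {way : V → Option V} {l₁ l₂ : List V} (h : WayList way (l₁ ++ l₂)) :
    WayList way l₂ := by
  induction l₁ with
  | nil => exact h
  | cons b l₁ ih => exact ih h.2.1

theorem WayList.nodup {way : V → Option V} {l : List V} (h : WayList way l) : l.Nodup := by
  induction l with
  | nil => exact List.nodup_nil
  | cons b l ih => exact List.nodup_cons.mpr ⟨h.1, ih h.2.1⟩

theorem WayList.mem {way : V → Option V} {l : List V} (h : WayList way l) :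
    ∀ b ∈ l, ∀ b₁, way b = some b₁ → b₁ ∈ l := by
  induction l with
  | nil => simp
  | cons b l ih =>
    intro b' hb' b₁ hb₁
    rcases List.mem_cons.mp hb' with rfl | hb'
    · exact List.mem_cons_of_mem _ (h.2.2 b₁ hb₁)
    · exact List.mem_cons_of_mem _ (ih h.2.1 b' hb' b₁ hb₁)

theorem WayList.congr {way way' : V → Option V} {l : List V} (h : WayList way l)
    (hw : ∀ b ∈ l, way' b = way b) : WayList way' l := by
  induction l with
  | nil => trivial
  | cons b l ih =>
    refine ⟨h.1, ih h.2.1 fun b' hb' => hw b' (List.mem_cons_of_mem _ hb'), fun b₁ hb₁ => ?_⟩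
    exact h.2.2 b₁ (by rw [← hw b List.mem_cons_self, hb₁])

theorem pickMin_spec (s : HungarianStage V) (l : List V) (best : Option V)
    (hbest : ∀ b, best = some b → s.used b = false) :
    ((foldT (pickMin s) best l).val = none → best = none ∧ ∀ b ∈ l, s.used b = true) ∧
      ∀ b₁, (foldT (pickMin s) best l).val = some b₁ → s.used b₁ = false ∧
        (∀ b, best = some b → s.slack b₁ ≤ s.slack b) ∧
        ∀ b ∈ l, s.used b = false → s.slack b₁ ≤ s.slack b := by
  induction l generalizing best with
  | nil =>
    refine ⟨fun h => ⟨h, by simp⟩, fun b₁ h => ?_⟩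
    obtain rfl : best = some b₁ := h
    exact ⟨hbest b₁ rfl, fun b hb => by rw [Option.some.inj hb], by simp⟩
  | cons b l ih =>
    rw [foldT_cons_val, pickMin.eq_def, step_val]
    split_ifs with hused
    · have := ih best hbest
      refine ⟨fun h => ⟨(this.1 h).1, ?_⟩, fun b₁ h => ?_⟩
      · simpa [hused] using (this.1 h).2
      · have h1 := this.2 b₁ h
        exact ⟨h1.1, h1.2.1, by simpa [hused] using h1.2.2⟩
    · rw [Bool.not_eq_true] at hused
      rcases best with _ | b₀
      · have := ih (some b) (by simpa using hused)
        refine ⟨fun h => by simp at this; exact absurd h (by simpa using this.1), fun b₁ h => ?_⟩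
        have h1 := this.2 b₁ h
        refine ⟨h1.1, by simp, fun b' hb' hu => ?_⟩
        rcases List.mem_cons.mp hb' with rfl | hb'
        · exact h1.2.1 _ rfl
        · exact h1.2.2 b' hb' hu
      · dsimp only
        have key : ∃ b₂, (if s.slack b < s.slack b₀ then some b else some b₀) = some b₂ ∧
            s.used b₂ = false ∧ s.slack b₂ ≤ s.slack b ∧ s.slack b₂ ≤ s.slack b₀ := by
          split_ifs with hlt
          · exact ⟨b, rfl, hused, le_rfl, hlt.le⟩
          · exact ⟨b₀, rfl, hbest b₀ rfl, not_lt.mp hlt, le_rfl⟩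
        obtain ⟨b₂, h2, h3, h4, h5⟩ := key
        rw [h2]
        have := ih (some b₂) (by simpa using h3)
        refine ⟨fun h => absurd (this.1 h).1 (by simp), fun b₁ h => ?_⟩
        have h1 := this.2 b₁ h
        have h6 := h1.2.1 b₂ rfl
        refine ⟨h1.1, fun b' hb' => ?_, fun b' hb' hu => ?_⟩
        · rw [← Option.some.inj hb']; exact h6.trans h5
        · rcases List.mem_cons.mp hb' with rfl | hb'
          · exact h6.trans h4
          · exact h1.2.2 b' hb' hu

variable [DecidableEq V]

theorem TightMatching.fill {c : V → V → ℤ} {u v : V → ℤ} {D : V → Prop} {toL : V → Option V}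
    {a b : V} (h : TightMatching c u v D (Function.update toL b none)) (ha : ¬ D a)
    (hab : u a + v b = c a b) :
    TightMatching c u v (fun a' => D a' ∨ a' = a) (Function.update toL b (some a)) := by
  have hne : ∀ b', b' ≠ b → toL b' ≠ some a := fun b' hb' h0 =>
    ha ((h.dom a).mp ⟨b', by rw [Function.update_of_ne hb', h0]⟩)
  refine ⟨fun a' b₁ b₂ h1 h2 => ?_, fun a' b' h1 => ?_, fun a' => ?_⟩
  · have := h.inj a' b₁ b₂
    simp only [Function.update_apply] at h1 h2 this
    grind
  · have := h.tight a' b'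
    simp only [Function.update_apply] at h1 this
    grind
  · rw [← h.dom]
    constructor
    · rintro ⟨b', hb'⟩
      by_cases hbb : b' = b
      · subst hbb
        rw [Function.update_self] at hb'
        exact Or.inr (Option.some.inj hb').symm
      · rw [Function.update_of_ne hbb] at hb'
        exact Or.inl ⟨b', by rw [Function.update_of_ne hbb, hb']⟩
    · rintro (⟨b', hb'⟩ | rfl)
      · by_cases hbb : b' = b
        · subst hbb
          simp at hb'
        · rw [Function.update_of_ne hbb] at hb'
          exact ⟨b', by rw [Function.update_of_ne hbb, hb']⟩
      · exact ⟨b, Function.update_self ..⟩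

/-- The vacant right vertex b receives the mate of b₁, which becomes vacant. The set of matched left
vertices stays the same until the root fills the last vacancy. -/
theorem TightMatching.move {c : V → V → ℤ} {u v : V → ℤ} {D : V → Prop} {toL : V → Option V}
    {a b b₁ : V} (h : TightMatching c u v D (Function.update toL b none)) (hb : b₁ ≠ b)
    (ha : toL b₁ = some a) (hab : u a + v b = c a b) :
    TightMatching c u v D (Function.update (Function.update toL b (some a)) b₁ none) := by
  refine ⟨fun a' b₂ b₃ h1 h2 => ?_, fun a' b' h1 => ?_, fun a' => ?_⟩
  · have h3 := h.inj a' b₂ b₃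
    have h4 := h.inj a b₁ b₂
    have h5 := h.inj a b₁ b₃
    simp only [Function.update_apply] at h1 h2 h3 h4 h5
    grind
  · have := h.tight a' b'
    simp only [Function.update_apply] at h1 this
    grind
  · rw [← h.dom]
    constructor
    · rintro ⟨b', hb'⟩
      by_cases h1 : b' = b₁
      · subst h1
        simp at hb'
      · rw [Function.update_of_ne h1] at hb'
        by_cases h2 : b' = b
        · subst h2
          rw [Function.update_self] at hb'
          exact ⟨b₁, by rw [Function.update_of_ne hb, ha, hb']⟩
        · exact ⟨b', by rwa [Function.update_of_ne h2] at hb' ⊢⟩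
    · rintro ⟨b', hb'⟩
      by_cases h2 : b' = b
      · subst h2
        simp at hb'
      · rw [Function.update_of_ne h2] at hb'
        by_cases h1 : b' = b₁
        · subst h1
          exact ⟨b, by rw [Function.update_of_ne hb.symm, Function.update_self, ← ha, hb']⟩
        · exact ⟨b', by rw [Function.update_of_ne h1, Function.update_of_ne h2, hb']⟩

/-- The vacancy travels down the tree path along tight edges. Predecessors lie strictly later in the
list, so their mates are still the original ones when they are read. -/
theorem augmentTree_spec {c : V → V → ℤ} {u v : V → ℤ} {D : V → Prop} {toL : V → Option V}
    {way : V → Option V} {root : V} (hroot : ¬ D root) (k : ℕ) (b : V) (l : List V)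
    (toL' : V → Option V) (hl : WayList way (b :: l)) (hk : l.length < k)
    (hagree : ∀ b' ∈ l, toL' b' = toL b')
    (htight : ∀ b' ∈ b :: l, ∃ a, treeParent toL root (way b') = some a ∧ u a + v b' = c a b')
    (h : TightMatching c u v D (Function.update toL' b none)) :
    TightMatching c u v (fun a => D a ∨ a = root) (augmentTree way root k b toL').val := by
  induction k generalizing b l toL' with
  | zero => exact absurd hk (Nat.not_lt_zero _)
  | succ k ih =>
    obtain ⟨a, ha, hab⟩ := htight b List.mem_cons_self
    rw [augmentTree]
    rcases hway : way b with _ | b₁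
    · rw [hway] at ha
      obtain rfl := Option.some.inj ha
      exact h.fill hroot hab
    · rw [hway] at ha
      have hb₁ : b₁ ∈ l := hl.2.2 b₁ hway
      have hne : b₁ ≠ b := by rintro rfl; exact hl.1 hb₁
      have ha' : toL' b₁ = some a := (hagree b₁ hb₁).trans ha
      obtain ⟨l₁, l₂, rfl⟩ := List.append_of_mem hb₁
      simp only [bind_val, step_val]
      rw [ha']
      refine ih b₁ l₂ _ hl.2.1.suffix ?_ (fun b' hb' => ?_) (fun b' hb' => htight b' ?_)
        (h.move hne ha' hab)
      · simp only [List.length_append, List.length_cons] at hk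
        omega
      · have hb'l : b' ∈ l₁ ++ b₁ :: l₂ := by simp [hb']
        rw [Function.update_of_ne (by rintro rfl; exact hl.1 hb'l)]
        exact hagree b' hb'l
      · exact List.mem_cons_of_mem _ (List.mem_append_right _ hb')

-- Distinct right vertices have distinct mates, so no potential is changed twice and the loop acts
-- as one simultaneous update. The root has no mate and is treated separately.
open Classical in
theorem shift_spec {toL : V → Option V} (hinj : ∀ a b b', toL b = some a → toL b' = some a → b = b')
    (δ : ℤ) (l : List V) (hl : l.Nodup) (s : HungarianStage V) :
    (foldT (shift toL δ) s l).val =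
      { u := fun a => s.u a + if ∃ b ∈ l, s.used b = true ∧ toL b = some a then δ else 0
        v := fun b => s.v b - if b ∈ l ∧ s.used b = true then δ else 0
        slack := fun b => s.slack b - if b ∈ l ∧ s.used b = false then δ else 0
        way := s.way
        used := s.used
        last := s.last } := by
  induction l generalizing s with
  | nil => simp
  | cons b l ih =>
    rw [List.nodup_cons] at hl
    rw [foldT_cons_val, ih hl.2]
    have hb : ∀ b', b' ∈ l → b' ≠ b := fun b' hb' h => hl.1 (h ▸ hb')
    rw [shift, step_val]
    by_cases hu : s.used b = true
    · rw [if_pos hu]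
      rcases hL : toL b with _ | a
      · simp only [HungarianStage.mk.injEq, and_true]
        refine ⟨?_, ?_, ?_⟩
        · funext a
          simp [hL]
        · funext b'
          by_cases h : b' = b
          · subst h; simp [hl.1, hu]
          · simp [h]
        · funext b'
          by_cases h : b' = b
          · subst h; simp [hl.1, hu]
          · simp [h]
      · simp only [HungarianStage.mk.injEq, and_true]
        refine ⟨?_, ?_, ?_⟩
        · funext a'
          by_cases h : a' = a
          · subst h
            have h1 : ¬ ∃ b' ∈ l, s.used b' = true ∧ toL b' = some a' := by
              rintro ⟨b', hb', -, h2⟩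
              exact hb b' hb' (hinj _ _ _ h2 hL)
            rw [if_neg h1, Function.update_self, if_pos ⟨b, List.mem_cons_self, hu, hL⟩, add_zero]
          · have h1 : a ≠ a' := fun h0 => h h0.symm
            simp [h, hL, h1]
        · funext b'
          by_cases h : b' = b
          · subst h; simp [hl.1, hu]
          · simp [h]
        · funext b'
          by_cases h : b' = b
          · subst h; simp [hl.1, hu]
          · simp [h]
    · rw [if_neg hu]
      simp only [HungarianStage.mk.injEq, and_true]
      refine ⟨?_, ?_, ?_⟩
      · funext a
        simp [hu]
      · funext b'
        by_cases h : b' = b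
        · subst h; simp [hl.1, hu]
        · simp [h]
      · funext b'
        by_cases h : b' = b
        · subst h; simp [hl.1, hu]
        · simp [h]

open Classical in
theorem relax_spec (c : V → V → ℤ) (a b₁ : V) (l : List V) (hl : l.Nodup) (s : HungarianStage V) :
    (foldT (relax c a b₁) s l).val =
      { s with
        slack := fun b => if b ∈ l ∧ s.used b = false ∧ c a b - s.u a - s.v b < s.slack b then
          c a b - s.u a - s.v b else s.slack b
        way := fun b => if b ∈ l ∧ s.used b = false ∧ c a b - s.u a - s.v b < s.slack b then
          some b₁ else s.way b } := by
  induction l generalizing s with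
  | nil => simp
  | cons b l ih =>
    rw [List.nodup_cons] at hl
    rw [foldT_cons_val, ih hl.2, relax, step_val]
    by_cases hu : s.used b = true
    · rw [if_pos hu]
      simp only [HungarianStage.mk.injEq, and_true, true_and]
      constructor <;> funext b' <;> by_cases h : b' = b
      · subst h; simp [hl.1, hu]
      · simp [h]
      · subst h; simp [hl.1, hu]
      · simp [h]
    · rw [if_neg hu]
      rw [Bool.not_eq_true] at hu
      split_ifs with hlt
      · simp only [HungarianStage.mk.injEq, and_true, true_and]
        constructor <;> funext b' <;> by_cases h : b' = b
        · subst h; simp [hl.1, hu, hlt]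
        · simp [h]
        · subst h; simp [hl.1, hu, hlt]
        · simp [h]
      · simp only [HungarianStage.mk.injEq, and_true, true_and]
        constructor <;> funext b' <;> by_cases h : b' = b
        · subst h
          simp only [hl.1, hu, hlt, and_false, if_false]
        · simp [h]
        · subst h
          simp only [hl.1, hu, hlt, and_false, if_false]
        · simp [h]

/-- Invariant of a stage of the Hungarian method: `l` are the right vertices of the tree, latest
first, and the slacks take the left vertices into account that are the root or matched to a vertex
in `l₀`. -/
structure TreeInv (c : V → V → ℤ) (toL : V → Option V) (root : V) (D : V → Prop)
    (s : HungarianStage V) (l l₀ : List V) : Prop where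
  matching : TightMatching c s.u s.v D toL
  feasible : ∀ a b, s.u a + s.v b ≤ c a b
  used_iff : ∀ b, s.used b = true ↔ b ∈ l
  way : WayList s.way l
  parent : ∀ b ∈ l, ∃ a, treeParent toL root (s.way b) = some a ∧ s.u a + s.v b = c a b
  way_mem : ∀ b, b ∉ l → ∀ b₁, s.way b = some b₁ → b₁ ∈ l₀
  slack_eq : ∀ b, b ∉ l → ∃ a, treeParent toL root (s.way b) = some a ∧
    s.slack b = c a b - s.u a - s.v b
  slack_le : ∀ b, b ∉ l → ∀ a, (a = root ∨ ∃ b₁ ∈ l₀, toL b₁ = some a) →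
    s.slack b ≤ c a b - s.u a - s.v b

variable {c : V → V → ℤ} {toL : V → Option V} {root : V} {D : V → Prop}

-- The least slack δ is added to the left potentials of the tree and subtracted from the right ones.
-- Tree edges and matched edges stay tight, edges leaving the tree lose δ but remain feasible by
-- minimality, and the edge by which `b₁` is reached becomes tight. The mate of `b₁` is not yet
-- counted in the slacks, whence the two different lists.
open Classical in
theorem TreeInv.shift {s s' : HungarianStage V} {l : List V} (h : TreeInv c toL root D s l l)
    (hroot : ¬ D root) {b₁ : V} (hb₁ : b₁ ∉ l) (hmin : ∀ b, b ∉ l → s.slack b₁ ≤ s.slack b)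
    (hu : ∀ a, s'.u a =
      s.u a + if a = root ∨ ∃ b ∈ l, toL b = some a then s.slack b₁ else 0)
    (hv : ∀ b, s'.v b = s.v b - if b ∈ l then s.slack b₁ else 0)
    (hs : ∀ b, b ∉ l → s'.slack b = s.slack b - s.slack b₁) (hway : s'.way = s.way)
    (hused : ∀ b, s'.used b = true ↔ b ∈ b₁ :: l) :
    TreeInv c toL root D s' (b₁ :: l) l := by
  set δ := s.slack b₁ with hδ
  have hδ0 : 0 ≤ δ := by
    obtain ⟨a, -, ha⟩ := h.slack_eq b₁ hb₁
    have := h.feasible a b₁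
    omega
  -- the vertex from which a vertex is reached lies in the tree
  have hpar : ∀ b a, (∀ b₂, s.way b = some b₂ → b₂ ∈ l) →
      treeParent toL root (s.way b) = some a → a = root ∨ ∃ b ∈ l, toL b = some a := by
    intro b a h1 h2
    rcases hw : s.way b with _ | b₂
    · rw [hw] at h2
      exact Or.inl (Option.some.inj h2).symm
    · rw [hw] at h2
      exact Or.inr ⟨b₂, h1 b₂ hw, h2⟩
  refine ⟨⟨h.matching.inj, fun a b hab => ?_, h.matching.dom⟩, fun a b => ?_, hused,
    ⟨hb₁, h.way.congr (by simp [hway]), fun b₂ => ?_⟩, fun b hb => ?_, fun b hb b₂ => ?_,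
    fun b hb => ?_, fun b hb a ha => ?_⟩
  · have h1 := h.matching.tight a b hab
    rw [hu, hv]
    -- Matched partners lie in the tree together, so their potentials change by opposite amounts or
    -- not at all.
    have h2 : (a = root ∨ ∃ b ∈ l, toL b = some a) ↔ b ∈ l := by
      constructor
      · rintro (rfl | ⟨b', hb', hab'⟩)
        · exact absurd ((h.matching.dom a).mp ⟨b, hab⟩) hroot
        · rwa [← h.matching.inj a b' b hab' hab]
      · exact fun hb => Or.inr ⟨b, hb, hab⟩
    simp only [h2]
    split_ifs <;> omega
  · have h1 := h.feasible a b
    rw [hu, hv]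
    by_cases hb : b ∈ l
    · rw [if_pos hb]
      split_ifs <;> omega
    · rw [if_neg hb]
      split_ifs with ha
      · have h2 := h.slack_le b hb a ha
        have h3 := hmin b hb
        omega
      · omega
  · rw [hway]
    exact h.way_mem b₁ hb₁ b₂
  · rw [hway]
    rcases List.mem_cons.mp hb with rfl | hb
    · obtain ⟨a, ha, ha'⟩ := h.slack_eq b hb₁
      refine ⟨a, ha, ?_⟩
      rw [hu, hv, if_pos (hpar b a (h.way_mem b hb₁) ha), if_neg hb₁]
      omega
    · obtain ⟨a, ha, ha'⟩ := h.parent b hb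
      refine ⟨a, ha, ?_⟩
      rw [hu, hv, if_pos (hpar b a (h.way.mem b hb) ha), if_pos hb]
      omega
  · rw [hway]
    exact h.way_mem b (fun h0 => hb (List.mem_cons_of_mem _ h0)) b₂
  · have hb' : b ∉ l := fun h0 => hb (List.mem_cons_of_mem _ h0)
    obtain ⟨a, ha, ha'⟩ := h.slack_eq b hb'
    rw [hway]
    refine ⟨a, ha, ?_⟩
    rw [hs b hb', hu, hv, if_pos (hpar b a (h.way_mem b hb') ha), if_neg hb']
    omega
  · have hb' : b ∉ l := fun h0 => hb (List.mem_cons_of_mem _ h0)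
    have := h.slack_le b hb' a ha
    rw [hs b hb', hu, hv, if_pos ha, if_neg hb']
    omega

theorem TreeInv.relax {vs : List V} (hvs : ∀ a, a ∈ vs) (hnd : vs.Nodup) {s : HungarianStage V}
    {l : List V} {b₁ a : V} (h : TreeInv c toL root D s (b₁ :: l) l) (ha : toL b₁ = some a) :
    TreeInv c toL root D (foldT (relax c a b₁) s vs).val (b₁ :: l) (b₁ :: l) := by
  classical
  rw [relax_spec c a b₁ vs hnd]
  have hunused : ∀ b, b ∉ b₁ :: l → s.used b = false := fun b hb => by
    rw [← Bool.not_eq_true, h.used_iff]; exact hb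
  refine ⟨h.matching, h.feasible, h.used_iff, h.way.congr fun b hb => ?_, fun b hb => ?_,
    fun b hb b₂ => ?_, fun b hb => ?_, fun b hb a' ha' => ?_⟩
  · have : s.used b = true := (h.used_iff b).mpr hb
    simp [this]
  · have h1 : s.used b = true := (h.used_iff b).mpr hb
    simpa [h1] using h.parent b hb
  · dsimp only
    split_ifs with hlt
    · intro h1
      rw [← Option.some.inj h1]
      exact List.mem_cons_self
    · exact fun h1 => List.mem_cons_of_mem _ (h.way_mem b hb b₂ h1)
  · dsimp only
    split_ifs with hlt
    · exact ⟨a, ha, rfl⟩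
    · exact h.slack_eq b hb
  · have h1 : s.slack b ≤ c a' b - s.u a' - s.v b ∨ a' = a := by
      rcases ha' with rfl | ⟨b₂, hb₂, hb₂'⟩
      · exact Or.inl (h.slack_le b hb _ (Or.inl rfl))
      · rcases List.mem_cons.mp hb₂ with rfl | hb₂
        · rw [ha] at hb₂'
          exact Or.inr (Option.some.inj hb₂').symm
        · exact Or.inl (h.slack_le b hb _ (Or.inr ⟨b₂, hb₂, hb₂'⟩))
    simp only [hvs, hunused b hb, true_and]
    rcases h1 with h1 | rfl <;> split_ifs <;> omega

/-- If all right vertices were in the tree and matched, their mates would exhaust the left side,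
including the unmatched root. -/
theorem TreeInv.exists_notMem [Fintype V] {s : HungarianStage V} {l l₀ : List V}
    (h : TreeInv c toL root D s l l₀) (hroot : ¬ D root) (hmatched : ∀ b ∈ l, toL b ≠ none) :
    (∃ b, b ∉ l) ∧ l.length < Fintype.card V := by
  have hex : ∃ b, b ∉ l := by
    by_contra hall
    push Not at hall
    choose f hf using fun b => Option.ne_none_iff_exists'.mp (hmatched b (hall b))
    have hinj : Function.Injective f := fun b b' hbb =>
      h.matching.inj (f b) b b' (hf b) (by rw [hbb]; exact hf b')
    obtain ⟨b, hb⟩ := (Finite.injective_iff_surjective.mp hinj) root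
    exact hroot ((h.matching.dom root).mp ⟨b, by rw [hf, hb]⟩)
  obtain ⟨b, hb⟩ := hex
  have := (List.nodup_cons.mpr ⟨hb, h.way.nodup⟩).length_le_card
  exact ⟨⟨b, hb⟩, by rwa [List.length_cons] at this⟩

theorem growTree_spec [Fintype V] {vs : List V} (hvs : ∀ a, a ∈ vs) (hnd : vs.Nodup)
    (hroot : ¬ D root) (k : ℕ) {s : HungarianStage V} {l : List V}
    (h : TreeInv c toL root D s l l) (hmatched : ∀ b ∈ l, toL b ≠ none)
    (hk : Fintype.card V ≤ l.length + k) :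
    ∃ b l', (growTree vs c toL root k s).val.last = some b ∧ toL b = none ∧
      TreeInv c toL root D (growTree vs c toL root k s).val (b :: l') l' := by
  classical
  induction k generalizing s l with
  | zero => exact absurd (h.exists_notMem hroot hmatched).2 (by omega)
  | succ k ih =>
    obtain ⟨b₀, hb₀⟩ := (h.exists_notMem hroot hmatched).1
    have hunused : ∀ b, s.used b = false ↔ b ∉ l := fun b => by
      rw [← Bool.not_eq_true, h.used_iff]
    obtain ⟨b₁, hb₁⟩ : ∃ b₁, (foldT (pickMin s) none vs).val = some b₁ := by
      rw [← Option.ne_none_iff_exists']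
      intro h0
      have := ((pickMin_spec s vs none (by simp)).1 h0).2 b₀ (hvs b₀)
      exact hb₀ ((h.used_iff b₀).mp this)
    obtain ⟨hb₁u, -, hmin⟩ := (pickMin_spec s vs none (by simp)).2 b₁ hb₁
    have hb₁l := (hunused b₁).mp hb₁u
    -- The field `last` does not enter the invariant. It is left arbitrary to serve both the final
    -- round, which sets it, and the others.
    have hinv : ∀ o, TreeInv c toL root D
        { (foldT (shift toL (s.slack b₁)) s vs).val with
          u := Function.update (foldT (shift toL (s.slack b₁)) s vs).val.u root
            ((foldT (shift toL (s.slack b₁)) s vs).val.u root + s.slack b₁)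
          used := Function.update (foldT (shift toL (s.slack b₁)) s vs).val.used b₁ true
          last := o } (b₁ :: l) l := by
      intro o
      rw [shift_spec h.matching.inj _ vs hnd]
      refine h.shift hroot hb₁l (fun b hb => hmin b (hvs b) ((hunused b).mpr hb)) (fun a => ?_)
        (fun b => ?_) (fun b hb => ?_) rfl fun b => ?_
      · simp only [hvs, true_and, h.used_iff, Function.update_apply]
        by_cases ha : a = root
        · subst ha
          have : ¬ ∃ b ∈ l, toL b = some a := fun ⟨b, _, hb⟩ =>
            hroot ((h.matching.dom a).mp ⟨b, hb⟩)
          simp [this]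
        · simp [ha]
      · simp only [hvs, true_and, h.used_iff]
      · simp only [hvs, true_and, hunused, hb, not_false_eq_true, if_true]
      · simp only [Function.update_apply, List.mem_cons, ← h.used_iff]
        split_ifs with hbb <;> simp [hbb]
    rcases hL : toL b₁ with _ | a
    · refine ⟨b₁, l, ?_, hL, ?_⟩
      · simp [growTree, hb₁, hL]
      · have := hinv (some b₁)
        simpa [growTree, hb₁, hL] using this
    · have h2 := (hinv (foldT (shift toL (s.slack b₁)) s vs).val.last).relax hvs hnd hL
      have hm : ∀ b ∈ b₁ :: l, toL b ≠ none := fun b hb => by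
        rcases List.mem_cons.mp hb with rfl | hb
        · simp [hL]
        · exact hmatched b hb
      have := ih h2 hm (by rw [List.length_cons]; omega)
      simpa [growTree, hb₁, hL] using this

theorem hungarianStage_spec [Fintype V] {vs : List V} (hvs : ∀ a, a ∈ vs) (hnd : vs.Nodup)
    {h : HungarianState V} (hm : TightMatching c h.u h.v D h.toL)
    (hf : ∀ a b, h.u a + h.v b ≤ c a b) (hroot : ¬ D root) :
    TightMatching c (hungarianStage vs c h root).val.u (hungarianStage vs c h root).val.v
        (fun a => D a ∨ a = root) (hungarianStage vs c h root).val.toL ∧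
      ∀ a b, (hungarianStage vs c h root).val.u a + (hungarianStage vs c h root).val.v b ≤
        c a b := by
  have hlen : Fintype.card V ≤ vs.length := by
    rw [← Finset.card_univ]
    refine (Finset.card_le_card fun a _ => List.mem_toFinset.mpr (hvs a)).trans vs.toFinset_card_le
  set s₀ : HungarianStage V :=
    { u := h.u
      v := h.v
      slack := fun b => c root b - h.u root - h.v b
      way := fun _ => none
      used := fun _ => false
      last := none } with hs₀
  have h₀ : TreeInv c h.toL root D s₀ [] [] :=
    { matching := hm
      feasible := hf
      used_iff := by simp [hs₀]
      way := trivial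
      parent := by simp
      way_mem := by simp [hs₀]
      slack_eq := fun b _ => ⟨root, rfl, rfl⟩
      slack_le := fun b _ a ha => by
        rcases ha with rfl | ⟨_, h0, _⟩
        · exact le_rfl
        · simp at h0 }
  obtain ⟨b, l, hlast, hb, hinv⟩ := growTree_spec hvs hnd hroot vs.length h₀ (by simp) (by simpa)
  set s := (growTree vs c h.toL root vs.length s₀).val with hs
  have hval : (hungarianStage vs c h root).val =
      { u := s.u, v := s.v, toL := (augmentTree s.way root vs.length b h.toL).val } := by
    simp [hungarianStage, ← hs₀, ← hs, hlast]
  rw [hval]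
  refine ⟨augmentTree_spec hroot vs.length b l h.toL hinv.way ?_ (fun _ _ => rfl) hinv.parent ?_,
    hinv.feasible⟩
  · have := hinv.way.nodup.length_le_card
    rw [List.length_cons] at this
    omega
  · rw [← hb, Function.update_eq_self]
    exact hinv.matching

theorem foldT_hungarianStage_spec [Fintype V] {vs : List V} (hvs : ∀ a, a ∈ vs) (hnd : vs.Nodup)
    (l : List V) (hl : l.Nodup) {h : HungarianState V} (hm : TightMatching c h.u h.v D h.toL)
    (hf : ∀ a b, h.u a + h.v b ≤ c a b) (hD : ∀ a ∈ l, ¬ D a) :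
    TightMatching c (foldT (hungarianStage vs c) h l).val.u (foldT (hungarianStage vs c) h l).val.v
        (fun a => D a ∨ a ∈ l) (foldT (hungarianStage vs c) h l).val.toL ∧
      ∀ a b, (foldT (hungarianStage vs c) h l).val.u a +
        (foldT (hungarianStage vs c) h l).val.v b ≤ c a b := by
  induction l generalizing h D with
  | nil => simpa using ⟨hm, hf⟩
  | cons a l ih =>
    rw [List.nodup_cons] at hl
    obtain ⟨h1, h2⟩ := hungarianStage_spec hvs hnd hm hf (hD a List.mem_cons_self)
    obtain ⟨h3, h4⟩ := ih hl.2 h1 h2 (fun b hb h0 => by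
      rcases h0 with h0 | rfl
      · exact hD b (List.mem_cons_of_mem _ hb) h0
      · exact hl.1 hb)
    rw [foldT_cons_val]
    refine ⟨?_, h4⟩
    simpa only [List.mem_cons, or_assoc] using h3

/-- Recording fails only at a pair outside the graph; `done` collects the right vertices already
entered. -/
theorem recordPair_spec (G : BGraph V) {toL : V → Option V} (htot : ∀ b, toL b ≠ none)
    (hinj : ∀ a b b', toL b = some a → toL b' = some a → b = b') (l : List V) (hl : l.Nodup)
    (done : List V) (hdone : ∀ b ∈ l, b ∉ done) (M : Mates V)
    (hR : ∀ a b, M.toR a = some b ↔ b ∈ done ∧ toL b = some a)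
    (hL : ∀ a b, M.toL b = some a ↔ b ∈ done ∧ toL b = some a) :
    ((foldT (recordPair G toL) (some M) l).val = none →
        ∃ a b, toL b = some a ∧ G a b = false) ∧
      ∀ M', (foldT (recordPair G toL) (some M) l).val = some M' →
        (∀ a b, M'.toR a = some b ↔ (b ∈ done ∨ b ∈ l) ∧ toL b = some a) ∧
        (∀ a b, M'.toL b = some a ↔ (b ∈ done ∨ b ∈ l) ∧ toL b = some a) ∧
        ∀ a, ∀ b ∈ l, toL b = some a → G a b = true := by
  induction l generalizing done M with
  | nil =>
    refine ⟨by simp, fun M' h => ?_⟩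
    obtain rfl : M = M' := Option.some.inj h
    simpa using ⟨hR, hL⟩
  | cons b l ih =>
    rw [List.nodup_cons] at hl
    obtain ⟨a, ha⟩ := Option.ne_none_iff_exists'.mp (htot b)
    rw [foldT_cons_val]
    by_cases hG : G a b = true
    · have hval : (recordPair G toL (some M) b).val = some (M.join a b) := by
        simp [recordPair, ha, hG]
      rw [hval]
      have h1 := ih hl.2 (b :: done) (fun b' hb' h0 => by
        rcases List.mem_cons.mp h0 with rfl | h0
        · exact hl.1 hb'
        · exact hdone b' (List.mem_cons_of_mem _ hb') h0) (M.join a b)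
        (fun a' b' => by
          have h2 := hR a' b'
          have h3 := hinj a b b'
          simp only [Mates.join, Function.update_apply, List.mem_cons]
          grind)
        (fun a' b' => by
          have h2 := hL a' b'
          have h3 := hinj a b b'
          simp only [Mates.join, Function.update_apply, List.mem_cons]
          grind)
      refine ⟨h1.1, fun M' hM' => ?_⟩
      obtain ⟨h2, h3, h4⟩ := h1.2 M' hM'
      refine ⟨fun a' b' => ?_, fun a' b' => ?_, fun a' b' hb' hab' => ?_⟩
      · rw [h2]; simp only [List.mem_cons]; tauto
      · rw [h3]; simp only [List.mem_cons]; tauto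
      · rcases List.mem_cons.mp hb' with rfl | hb'
        · rw [ha] at hab'
          rwa [← Option.some.inj hab']
        · exact h4 a' b' hb' hab'
    · rw [Bool.not_eq_true] at hG
      have hval : (recordPair G toL (some M) b).val = none := by
        simp [recordPair, ha, hG]
      have h2 : ∀ l : List V, (foldT (recordPair G toL) none l).val = none := by
        intro l
        induction l with
        | nil => rfl
        | cons b l ih => rw [foldT_cons_val]; exact ih
      rw [hval, h2]
      exact ⟨fun _ => ⟨a, b, ha, hG⟩, by simp⟩

variable [Fintype V]

/-- Weak duality: feasible potentials bound the cost of every permutation from below by their total,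
and a tight perfect matching attains this bound. -/
theorem findsMinCostPM_minCostPM {vs : List V} (hvs : ∀ a, a ∈ vs) (hnd : vs.Nodup) :
    FindsMinCostPM (minCostPM vs) := by
  intro G S
  have hlen : vs.length = Fintype.card V := by
    rw [← List.toFinset_card_of_nodup hnd, ← Finset.card_univ]
    congr 1
    ext a; simp [hvs]
  set c := pairCost G S ((vs.length : ℤ) + 1) with hc
  have hc0 : ∀ a b, 0 ≤ c a b := fun a b => by
    rw [hc, pairCost]
    split_ifs <;> omega
  obtain ⟨hm, hf⟩ := foldT_hungarianStage_spec (c := c) (D := fun _ => False) hvs hnd vs hnd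
    (h := { u := fun _ => 0, v := fun _ => 0, toL := fun _ => none })
    ⟨by simp, by simp, by simp⟩ (by simpa using hc0) (by simp)
  set h := (foldT (hungarianStage vs c)
    { u := fun _ => 0, v := fun _ => 0, toL := fun _ => none } vs).val with hh
  have hval : (minCostPM vs G S).val =
      (foldT (recordPair G h.toL) (some ⟨fun _ => none, fun _ => none⟩) vs).val := rfl
  have hex : ∀ a, ∃ b, h.toL b = some a := fun a => (hm.dom a).mpr (Or.inr (hvs a))
  choose t ht using hex
  have htinj : Function.Injective t := fun a a' haa => by
    have := ht a
    rw [haa, ht a'] at this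
    exact (Option.some.inj this).symm
  let τ : V ≃ V := Equiv.ofBijective t (Finite.injective_iff_bijective.mp htinj)
  have hτ : ∀ a, h.toL (τ a) = some a := ht
  have htot : ∀ b, h.toL b ≠ none := fun b => by
    rw [← τ.apply_symm_apply b, hτ]
    simp
  -- the potentials bound the costs of all matchings
  have hopt : ∀ σ : V ≃ V, ∑ a, c a (τ a) ≤ ∑ a, c a (σ a) := by
    intro σ
    have h1 : ∑ a, c a (τ a) = ∑ a, h.u a + ∑ a, h.v a := by
      rw [← Equiv.sum_comp τ h.v, ← Finset.sum_add_distrib]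
      exact Finset.sum_congr rfl fun a _ => (hm.tight a (τ a) (hτ a)).symm
    rw [h1, ← Equiv.sum_comp σ h.v, ← Finset.sum_add_distrib]
    exact Finset.sum_le_sum fun a _ => hf a (σ a)
  have hcost : ∀ {M : Finset (V × V)}, IsPerfectMatching G M → ∀ σ : V ≃ V,
      (∀ a, (a, σ a) ∈ M) → ∑ a, c a (σ a) = (edgeCost S M : ℤ) := by
    intro M hM σ hσ
    rw [hM.edgeCost_eq hσ, Nat.cast_sum]
    refine Finset.sum_congr rfl fun a _ => ?_
    have := hM.1.1 _ (hσ a)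
    rw [hc, pairCost, if_pos this]
    split_ifs <;> simp
  have hrec := recordPair_spec G htot hm.inj vs hnd [] (by simp) ⟨fun _ => none, fun _ => none⟩
    (by simp) (by simp)
  rw [← hval] at hrec
  refine ⟨fun h0 => ?_, fun M hMval => ?_⟩
  · rintro ⟨M, hM⟩
    obtain ⟨a, b, hab, hG⟩ := hrec.1 h0
    obtain ⟨σ, hσ, -⟩ := hM.exists_equiv
    have hb : τ a = b := hm.inj a _ _ (hτ a) hab
    -- One pair outside the graph already costs more than a perfect matching of the graph can, since
    -- its `vs.length` edges cost at most 1 each.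
    have h1 : ((vs.length : ℤ) + 1) ≤ ∑ a, c a (τ a) := by
      have h2 : c a (τ a) = (vs.length : ℤ) + 1 := by
        rw [hc, pairCost, hb, hG]
        simp
      rw [← h2]
      exact Finset.single_le_sum (f := fun a => c a (τ a)) (fun a _ => hc0 _ _) (Finset.mem_univ a)
    have h3 := hopt σ
    rw [hcost hM σ hσ, hM.edgeCost_eq hσ] at h3
    have h4 : (∑ a, if S a (σ a) then 1 else 0) ≤ vs.length := by
      rw [hlen, ← Finset.card_univ, Finset.card_eq_sum_ones]
      exact Finset.sum_le_sum fun a _ => by split_ifs <;> simp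
    have h5 : ((∑ a, if S a (σ a) then 1 else 0 : ℕ) : ℤ) ≤ vs.length := by exact_mod_cast h4
    omega
  · obtain ⟨hR, hL, hG⟩ := hrec.2 M hMval
    have hcons : M.Consistent := fun a b => by rw [hR, hL]
    have hMG : ∀ a b, M.toR a = some b → G a b = true := fun a b hab =>
      hG a b (hvs b) ((hR a b).mp hab).2
    have hMτ : ∀ a, M.toR a = some (τ a) := fun a => (hR a _).mpr ⟨Or.inr (hvs _), hτ a⟩
    obtain ⟨_, -, hpm⟩ := hcons.exists_isPerfectMatching hMG fun a => by simp [hMτ]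
    refine ⟨hcons, hpm, fun M' hM' => ?_⟩
    obtain ⟨σ, hσ, -⟩ := hM'.exists_equiv
    have h1 := hopt σ
    rw [hcost hM' σ hσ, hcost hpm τ fun a => Mates.mem_edges.mpr (hMτ a)] at h1
    exact_mod_cast h1

end Hungarian

/-! ## Running times of the subroutines -/

section Times

variable {V : Type} [DecidableEq V]

theorem run_time_le (vs : List V) (G : BGraph V) (M : Mates V) (k : ℕ) (s : AltSearch V) :
    (AltSearch.run vs G M k s).time ≤ k * (2 * vs.length + 1) + 1 := by
  induction k generalizing s with
  | zero => simp [AltSearch.run]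
  | succ k ih =>
    rw [AltSearch.run.eq_def]
    dsimp only
    split
    · next a l _ _ =>
      rw [bind_time]
      have h1 := foldT_time_le (body := AltSearch.visit G M a) (t := 1) vs (fun _ _ _ => le_rfl)
        { s with todo := l }
      have h2 := ih (foldT (AltSearch.visit G M a) { s with todo := l } vs).val
      rw [add_mul, one_mul]
      omega
    · rw [step_time]
      omega

theorem augment_time_le (par : V → Option V) (k : ℕ) (b : V) (M : Mates V) :
    (augment par k b M).time ≤ k + 1 := by
  induction k generalizing b M with
  | zero => simp [augment]
  | succ k ih =>
    rw [augment]
    rcases par b with _ | a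
    · simp
    · simp only [bind_time, step_time, step_val]
      rcases M.toR a with _ | b₁
      · simp
      · have := ih b₁ (M.join a b)
        dsimp only
        omega

theorem matchVertex_time_le (vs : List V) (G : BGraph V) (M : Mates V) (a : V) :
    (matchVertex vs G (some M) a).time ≤
      1 + if M.toR a = none then 2 * vs.length ^ 2 + 3 * vs.length + 2 else 0 := by
  rw [matchVertex]
  rcases hR : M.toR a with _ | b
  · simp only [bind_time, charge_time, charge_val, if_true]
    have h1 := run_time_le vs G M vs.length { par := fun _ => none, todo := [a], goal := none }
    have h2 : vs.length * (2 * vs.length + 1) = 2 * vs.length ^ 2 + vs.length := by ring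
    rcases (AltSearch.run vs G M vs.length
      { par := fun _ => none, todo := [a], goal := none }).val.goal with _ | b
    · simp only [step_time]; omega
    · simp only [bind_time, step_time]
      have h3 := augment_time_le (AltSearch.run vs G M vs.length
        { par := fun _ => none, todo := [a], goal := none }).val.par vs.length b M
      omega
  · simp

theorem matchVertex_toR_ne_none (vs : List V) (G : BGraph V) (M M' : Mates V) (a : V)
    (h : (matchVertex vs G (some M) a).val = some M') (b : V) (hb : M.toR b ≠ none) :
    M'.toR b ≠ none := by
  rw [matchVertex] at h
  rcases hR : M.toR a with _ | b₁
  · simp only [hR, bind_val, charge_val] at h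
    rcases hg : (AltSearch.run vs G M vs.length
      { par := fun _ => none, todo := [a], goal := none }).val.goal with _ | g
    · simp [hg] at h
    · simp only [hg, bind_val, step_val, Option.some.injEq] at h
      rw [← h]
      exact augment_toR_ne_none _ _ _ _ _ hb
  · simp only [hR, step_val, Option.some.injEq] at h
    rwa [← h]

/-- Only initially free left vertices cause a search, because augmentation never frees a left
vertex. The bound thus counts free vertices, which is decisive when the starting matching is almost
perfect. -/
theorem foldT_matchVertex_time_le (vs : List V) (G : BGraph V) (l : List V) (M : Mates V) :
    (foldT (matchVertex vs G) (some M) l).time ≤ 2 * l.length + 1 +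
      (l.countP fun a => (M.toR a).isNone) * (2 * vs.length ^ 2 + 3 * vs.length + 2) := by
  induction l generalizing M with
  | nil => simp
  | cons a l ih =>
    rw [foldT_cons_time, List.length_cons, List.countP_cons]
    have h1 := matchVertex_time_le vs G M a
    have h3 : ((if (M.toR a).isNone = true then 1 else 0) : ℕ) *
        (2 * vs.length ^ 2 + 3 * vs.length + 2) =
          if M.toR a = none then 2 * vs.length ^ 2 + 3 * vs.length + 2 else 0 := by
      rcases M.toR a <;> simp
    rw [add_mul, h3]
    rcases hval : (matchVertex vs G (some M) a).val with _ | M'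
    · have h2 : (foldT (matchVertex vs G) none l).time ≤ l.length * 2 + 1 := by
        clear ih
        induction l with
        | nil => simp
        | cons b l ih =>
          have h3 : (matchVertex vs G none b).time = 1 := rfl
          have h4 : (matchVertex vs G none b).val = none := rfl
          rw [foldT_cons_time, h3, h4, List.length_cons]
          omega
      omega
    · have h2 := ih M'
      have h4 : l.countP (fun a => (M'.toR a).isNone) ≤ l.countP (fun a => (M.toR a).isNone) :=
        List.countP_mono_left fun b _ hb => by
          by_contra h0
          exact matchVertex_toR_ne_none vs G M M' a hval b (by simpa using h0) (by simpa using hb)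
      have h5 := Nat.mul_le_mul_right (2 * vs.length ^ 2 + 3 * vs.length + 2) h4
      omega

theorem checkPM_time_le (vs : List V) (G : BGraph V) (M : Mates V) :
    (checkPM vs G M).time ≤ 2 * vs.length + 2 +
      (vs.countP fun a => (M.toR a).isNone) * (2 * vs.length ^ 2 + 3 * vs.length + 2) := by
  have h := foldT_matchVertex_time_le vs G vs M
  have : (checkPM vs G M).time = (foldT (matchVertex vs G) (some M) vs).time + 1 := rfl
  omega

theorem growTree_time_le (vs : List V) (c : V → V → ℤ) (toL : V → Option V) (root : V) (k : ℕ)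
    (s : HungarianStage V) :
    (growTree vs c toL root k s).time ≤ k * (6 * vs.length + 5) + 1 := by
  induction k generalizing s with
  | zero => simp [growTree]
  | succ k ih =>
    rw [growTree, bind_time, add_mul, one_mul]
    have h1 := foldT_time_le (body := pickMin s) (t := 1) vs (fun _ _ _ => le_rfl) none
    rcases (foldT (pickMin s) none vs).val with _ | b₁
    · simp only [step_time]
      omega
    · simp only [bind_time, step_time, step_val]
      have h2 := foldT_time_le (body := shift toL (s.slack b₁)) (t := 1) vs (fun _ _ _ => le_rfl) s
      rcases toL b₁ with _ | a
      · simp only [step_time]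
        omega
      · dsimp only
        rw [bind_time]
        have h3 := foldT_time_le (body := relax c a b₁) (t := 1) vs (fun _ _ _ => le_rfl)
        have h4 : ∀ s', (foldT (relax c a b₁) s' vs).time +
            (growTree vs c toL root k (foldT (relax c a b₁) s' vs).val).time ≤
              (vs.length * (1 + 1) + 1) + (k * (6 * vs.length + 5) + 1) :=
          fun s' => Nat.add_le_add (h3 s') (ih _)
        refine (Nat.add_le_add_left (Nat.add_le_add_left (Nat.add_le_add_left
          (Nat.add_le_add_left (h4 _) _) _) _) _).trans ?_
        omega

theorem augmentTree_time_le (way : V → Option V) (root : V) (k : ℕ) (b : V) (toL : V → Option V) :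
    (augmentTree way root k b toL).time ≤ k + 1 := by
  induction k generalizing b toL with
  | zero => simp [augmentTree]
  | succ k ih =>
    rw [augmentTree]
    rcases way b with _ | b₁
    · simp
    · simp only [bind_time, step_time, step_val]
      have := ih b₁ (Function.update toL b (toL b₁))
      omega

theorem hungarianStage_time_le (vs : List V) (c : V → V → ℤ) (h : HungarianState V) (root : V) :
    (hungarianStage vs c h root).time ≤ 6 * vs.length ^ 2 + 9 * vs.length + 3 := by
  rw [hungarianStage]
  simp only [bind_time, charge_time, charge_val]
  have h1 := growTree_time_le vs c h.toL root vs.length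
    { u := h.u
      v := h.v
      slack := fun b => c root b - h.u root - h.v b
      way := fun _ => none
      used := fun _ => false
      last := none }
  have h2 : vs.length * (6 * vs.length + 5) = 6 * vs.length ^ 2 + 5 * vs.length := by ring
  set s := growTree vs c h.toL root vs.length
    { u := h.u
      v := h.v
      slack := fun b => c root b - h.u root - h.v b
      way := fun _ => none
      used := fun _ => false
      last := none }
  rcases s.val.last with _ | b
  · simp only [step_time]
    omega
  · simp only [bind_time, step_time]
    have h3 := augmentTree_time_le s.val.way root vs.length b h.toL
    omega

theorem minCostPM_time_le (vs : List V) (G S : BGraph V) :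
    (minCostPM vs G S).time ≤ 6 * vs.length ^ 3 + 10 * vs.length ^ 2 + 12 * vs.length + 2 := by
  rw [minCostPM]
  simp only [bind_time, charge_time, charge_val]
  have h1 := foldT_time_le (body := hungarianStage vs (pairCost G S ((vs.length : ℤ) + 1)))
    (t := 6 * vs.length ^ 2 + 9 * vs.length + 3) vs (fun h a _ => hungarianStage_time_le _ _ h a)
    { u := fun _ => 0, v := fun _ => 0, toL := fun _ => none }
  set r := foldT (hungarianStage vs (pairCost G S ((vs.length : ℤ) + 1)))
    { u := fun _ => 0, v := fun _ => 0, toL := fun _ => none } vs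
  have h2 := foldT_time_le (body := recordPair G r.val.toL) (t := 1) vs (fun _ _ _ => le_rfl)
    (some ⟨fun _ => none, fun _ => none⟩)
  nlinarith [h1, h2]

/-- The tests are counted by Pascal's rule. The summand added on the left pays for the copies at
each branching, so that the bounds of the two branches simply add up; the factor 2 covers the empty
list. -/
theorem forRemovals_time_add_le (vs : List V) (test : BGraph V → Mates V → Timed Bool) (τ k : ℕ)
    (F : List (V × V)) (G : BGraph V) (M : Mates V)
    (h : ∀ R : List (V × V), R.Sublist F → R.length = k →
      (test (removeEdges G R.toFinset) (M.cutList R)).time ≤ τ) :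
    (forRemovals vs test k F G M).time + (vs.length ^ 2 + 2 * vs.length + 2) ≤
      F.length.choose k * τ +
        2 * (F.length + 1) ^ k * (vs.length ^ 2 + 2 * vs.length + 2) := by
  set L := vs.length ^ 2 + 2 * vs.length + 2 with hL
  have hzero : ∀ (F : List (V × V)) (G : BGraph V) (M : Mates V),
      (test (removeEdges G ∅) M).time ≤ τ → (forRemovals vs test 0 F G M).time ≤ τ := by
    intro F G M h0
    rw [removeEdges_empty] at h0
    cases F <;> exact h0
  induction F generalizing k G M with
  | nil =>
    rcases k with _ | k
    · have := hzero [] G M (h [] (List.Sublist.refl _) rfl)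
      simp
      omega
    · simp [forRemovals]
      omega
  | cons e F ih =>
    rcases k with _ | k
    · have := hzero (e :: F) G M (h [] (List.nil_sublist _) rfl)
      simp
      omega
    · have h1 := ih k (removeEdges G {e}) (M.cut e.1 e.2) fun R hR hlen => by
        have := h (e :: R) (hR.cons_cons e) (by simp [hlen])
        rwa [List.toFinset_cons, Finset.insert_eq, ← removeEdges_removeEdges] at this
      have h2 := ih (k + 1) G M fun R hR hlen => h R (hR.cons e) hlen
      have h3 : 2 * (F.length + 1) ^ k * L + 2 * (F.length + 1) ^ (k + 1) * L ≤
          2 * (F.length + 1 + 1) ^ (k + 1) * L := by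
        rw [← add_mul]
        refine Nat.mul_le_mul_right _ ?_
        have : (F.length + 1) ^ k ≤ (F.length + 1 + 1) ^ k := Nat.pow_le_pow_left (by omega) k
        have h4 : 2 * (F.length + 1) ^ k + 2 * (F.length + 1) ^ (k + 1) =
            2 * ((F.length + 1) ^ k * (F.length + 1 + 1)) := by ring
        rw [h4, pow_succ (F.length + 1 + 1)]
        exact Nat.mul_le_mul_left _ (Nat.mul_le_mul_right _ this)
      have h4 : L ≤ 2 * (F.length + 1) ^ (k + 1) * L :=
        Nat.le_mul_of_pos_left _ (by positivity)
      rw [forRemovals_cons, List.length_cons, Nat.choose_succ_succ', add_mul]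
      dsimp only
      split_ifs <;> omega

end Times

/-! ## The verification algorithm -/

namespace ClosedLoop

variable {n m p : ℕ}

theorem mem_vertices (a : Vertex n m p) : a ∈ vertices n m p := by
  rcases a with i | i | i <;> simp [vertices]

theorem nodup_vertices : (vertices n m p).Nodup := by
  unfold vertices
  refine List.Nodup.append ((List.nodup_finRange n).map Sum.inl_injective)
    (List.Nodup.append ((List.nodup_finRange m).map (Sum.inr_injective.comp Sum.inl_injective))
      ((List.nodup_finRange p).map (Sum.inr_injective.comp Sum.inr_injective)) ?_) ?_
  · intro a ha hb
    simp only [List.mem_map] at ha hb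
    obtain ⟨i, -, rfl⟩ := ha
    obtain ⟨j, -, h⟩ := hb
    simp at h
  · intro a ha hb
    simp only [List.mem_append, List.mem_map] at ha hb
    obtain ⟨i, -, rfl⟩ := ha
    rcases hb with ⟨j, -, h⟩ | ⟨j, -, h⟩ <;> simp at h

theorem length_vertices : (vertices n m p).length = n + m + p := by
  simp [vertices, add_assoc]

/-- Removals of feedback edges correspond to link failures. -/
theorem resilient_iff {sys : ClosedLoop n m p} (hirr : sys.Irreducible)
    (hfb : ∀ M, IsPerfectMatching sys.bipartite M → ∃ e ∈ M, sys.feedbackEdges e.1 e.2 = true)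
    (γ : ℕ) :
    sys.Resilient γ ↔ ∀ R : Finset (Vertex n m p × Vertex n m p),
      (∀ e ∈ R, sys.feedbackEdges e.1 e.2 = true) → R.card ≤ γ →
        ∃ M, IsPerfectMatching (removeEdges sys.bipartite R) M := by
  rw [Resilient.iff_forall_exists_isPerfectMatching hirr hfb]
  let f : Fin m × Fin p ↪ Vertex n m p × Vertex n m p :=
    ⟨fun e => (.inr (.inl e.1), .inr (.inr e.2)), fun e e' h => by
      simpa [Prod.ext_iff] using h⟩
  constructor
  · intro h R hR hc
    have hex : ∀ e ∈ R, ∃ d, f d = e := by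
      rintro ⟨a, b⟩ he
      have := hR _ he
      rcases a with a | a | a <;> rcases b with b | b | b <;> simp [feedbackEdges] at this
      exact ⟨(a, b), rfl⟩
    have hcard : (R.preimage f f.injective.injOn).card ≤ γ := by
      refine le_trans ?_ hc
      rw [← Finset.card_map f]
      exact Finset.card_le_card fun e he => by
        obtain ⟨d, hd, rfl⟩ := Finset.mem_map.mp he
        exact Finset.mem_preimage.mp hd
    obtain ⟨M, hM⟩ := h _ hcard
    refine ⟨M, hM.mono fun e he => ?_⟩
    have h1 := hM.1.1 e he
    rw [removeEdges_iff]
    obtain ⟨a, b⟩ := e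
    constructor
    · rcases a with a | a | a <;> rcases b with b | b | b <;>
        simp [bipartite, failLinks] at h1 ⊢ <;> tauto
    · intro heR
      obtain ⟨⟨i, j⟩, hij⟩ := hex _ heR
      obtain ⟨rfl, rfl⟩ := Prod.ext_iff.mp hij
      have h2 : (i, j) ∈ R.preimage f f.injective.injOn := Finset.mem_preimage.mpr heR
      have h3 : (if (i, j) ∈ R.preimage f f.injective.injOn then false else sys.K i j) = true := h1
      rw [if_pos h2] at h3
      exact Bool.false_ne_true h3
  · intro h I hI
    obtain ⟨M, hM⟩ := h ((I.filter fun e => sys.K e.1 e.2 = true).map f) (fun e he => by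
        obtain ⟨d, hd, rfl⟩ := Finset.mem_map.mp he
        exact (Finset.mem_filter.mp hd).2)
      (by rw [Finset.card_map]; exact (Finset.card_filter_le _ _).trans hI)
    refine ⟨M, hM.mono fun e he => ?_⟩
    obtain ⟨h1, h2⟩ := removeEdges_iff.mp (hM.1.1 e he)
    obtain ⟨a, b⟩ := e
    rcases a with a | a | a <;> rcases b with b | b | b <;> simp only [bipartite] at h1 ⊢
    any_goals exact h1
    change (if (a, b) ∈ I then false else sys.K a b) = true
    rw [if_neg]
    · exact h1
    · exact fun hab => h2 (Finset.mem_map.mpr ⟨(a, b), Finset.mem_filter.mpr ⟨hab, h1⟩, rfl⟩)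

/-- Each feedback edge of a perfect matching requires an edge from an output to a state. -/
theorem length_feedback_le {sys : ClosedLoop n m p} {M : Finset (Vertex n m p × Vertex n m p)}
    (hM : IsPerfectMatching sys.bipartite M) {F : List (Vertex n m p × Vertex n m p)}
    (hF : F.Nodup) (hFM : ∀ e ∈ F, e ∈ M ∧ sys.feedbackEdges e.1 e.2 = true) : F.length ≤ n := by
  obtain ⟨σ, hσM, hσ⟩ := hM.exists_equiv
  have hex : ∀ e ∈ F, ∃ k : Fin n, σ e.2 = .inl k := by
    rintro ⟨a, b⟩ he
    obtain ⟨h1, h2⟩ := hFM _ he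
    rcases a with a | a | a <;> rcases b with b | b | b <;> simp [feedbackEdges] at h2
    have h3 := hM.1.1 _ (hσM (.inr (.inr b)))
    have h4 := hσ _ h1
    dsimp only at h3 h4 ⊢
    rcases hs : σ (.inr (.inr b)) with k | k | k <;> rw [hs] at h3
    · exact ⟨k, rfl⟩
    · simp [bipartite] at h3
    · have : b = k := of_decide_eq_true h3
      subst this
      have := σ.injective (h4.symm.trans hs.symm)
      simp at this
  rw [← List.toFinset_card_of_nodup hF]
  have h1 : F.toFinset.card ≤ (Finset.univ.map (⟨Sum.inl, Sum.inl_injective⟩ :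
      Fin n ↪ Vertex n m p)).card := by
    refine Finset.card_le_card_of_injOn (fun e => σ e.2) (fun e he => ?_) fun e he e' he' h => ?_
    · obtain ⟨k, hk⟩ := hex e (List.mem_toFinset.mp he)
      simp only [hk]
      exact Finset.mem_coe.mpr (Finset.mem_map.mpr ⟨k, Finset.mem_univ k, rfl⟩)
    · have h2 : e.2 = e'.2 := σ.injective h
      have h3 := hσ e (hFM e (List.mem_toFinset.mp he)).1
      have h4 := hσ e' (hFM e' (List.mem_toFinset.mp he')).1
      rw [h2, h4] at h3
      exact Prod.ext (σ.injective h3).symm h2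
  simpa using h1

end ClosedLoop

/-! ## Sums in the running time estimate -/

/-- From C(f, k) k! ≤ n^k and 2^k ≤ 2 k!. The gain of 2^k over the trivial bound keeps the recursive
costs summable with the stated dependence on γ. -/
theorem choose_mul_two_pow_le {f n : ℕ} (h : f ≤ n) (k : ℕ) :
    f.choose k * 2 ^ k ≤ 2 * n ^ k := by
  have h1 : f.choose k * k.factorial ≤ n ^ k := by
    rw [mul_comm, ← Nat.descFactorial_eq_factorial_mul_choose]
    exact (Nat.descFactorial_le_pow f k).trans (Nat.pow_le_pow_left h k)
  have h2 : 2 ^ k ≤ 2 * k.factorial := by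
    induction k with
    | zero => simp
    | succ k ih =>
      rcases k with _ | k
      · simp
      · rw [pow_succ, Nat.factorial_succ]
        have h3 : f.choose (k + 1) * (k + 1).factorial ≤ n ^ (k + 1) := by
          rw [mul_comm, ← Nat.descFactorial_eq_factorial_mul_choose]
          exact (Nat.descFactorial_le_pow f _).trans (Nat.pow_le_pow_left h _)
        have := ih h3
        nlinarith [Nat.factorial_pos (k + 1)]
  calc f.choose k * 2 ^ k ≤ f.choose k * (2 * k.factorial) := Nat.mul_le_mul_left _ h2
    _ = 2 * (f.choose k * k.factorial) := by ring
    _ ≤ 2 * n ^ k := Nat.mul_le_mul_left _ h1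

theorem sum_two_pow_sub_le (γ : ℕ) : ∑ q ∈ Finset.range γ, (2 : ℝ) ^ (γ - q) ≤ 2 * 2 ^ γ := by
  have : ∑ q ∈ Finset.range γ, (2 : ℝ) ^ (γ - q) + 2 = 2 * 2 ^ γ := by
    induction γ with
    | zero => simp
    | succ γ ih =>
      rw [Finset.sum_range_succ']
      simp only [Nat.succ_sub_succ, Nat.sub_zero]
      rw [pow_succ]
      linarith
  linarith

theorem three_mul_sum_four_pow_le (γ : ℕ) : 3 * ∑ q ∈ Finset.range γ, (4 : ℝ) ^ q ≤ 4 ^ γ := by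
  have : 3 * ∑ q ∈ Finset.range γ, (4 : ℝ) ^ q + 1 = 4 ^ γ := by
    induction γ with
    | zero => simp
    | succ γ ih =>
      rw [Finset.sum_range_succ, pow_succ]
      linarith
  linarith

/-! ### Vertices freed by cutting edges -/

section CutList

variable {V : Type} [DecidableEq V]

theorem Mates.cutList_toR_eq_none {M : Mates V} {R : List (V × V)} {a : V}
    (h : (M.cutList R).toR a = none) : M.toR a = none ∨ a ∈ R.map Prod.fst := by
  induction R generalizing M with
  | nil => exact Or.inl h
  | cons e R ih =>
    rcases ih (M := M.cut e.1 e.2) h with h | h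
    · by_cases ha : a = e.1
      · exact Or.inr (by simp [ha])
      · have h' : Function.update M.toR e.1 none a = none := h
        exact Or.inl (by rwa [Function.update_of_ne ha] at h')
    · exact Or.inr (List.mem_cons_of_mem _ h)

theorem Mates.countP_cutList_le {M : Mates V} (hM : ∀ a, M.toR a ≠ none) {vs : List V}
    (hnd : vs.Nodup) (R : List (V × V)) :
    vs.countP (fun a => ((M.cutList R).toR a).isNone) ≤ R.length := by
  rw [List.countP_eq_length_filter, ← List.length_map (f := Prod.fst) (as := R)]
  refine (List.Nodup.subperm (hnd.filter _) fun a ha => ?_).length_le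
  have := (List.mem_filter.mp ha).2
  exact (cutList_toR_eq_none (by simpa using this)).resolve_left (hM a)

end CutList

/-! ### Running time of the verification -/

namespace ClosedLoop

variable {n m p : ℕ}

/-- Strong induction on γ. In units of κ³ 2^(γ-1) n^(γ+2), the matching and the copy of S cost at
most 35, the checks 11, the recursive calls 200 and the copies during removals 40, together less
than 300. -/
theorem verifyRemovals_time_le {sys : ClosedLoop n m p} {κ : ℕ} (hn : 1 ≤ n)
    (hκ : n + m + p ≤ κ * n) (γ : ℕ) (hγ : 1 ≤ γ) (G S : BGraph (Vertex n m p))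
    (hG : ∀ a b, G a b = true → sys.bipartite a b = true)
    (hS : ∀ a b, S a b = true → sys.feedbackEdges a b = true) :
    (verifyRemovals (vertices n m p) (minCostPM (vertices n m p)) (checkPM (vertices n m p)) γ
      G S).time ≤ 300 * κ ^ 3 * (2 ^ (γ - 1) * n ^ (γ + 2)) := by
  set vs := vertices n m p with hvs
  obtain ⟨N, hN⟩ : ∃ N, vs.length = N := ⟨_, rfl⟩
  have hN1 : 1 ≤ N := by rw [← hN, hvs, length_vertices]; omega
  have hNκ : N ≤ κ * n := by rw [← hN, hvs, length_vertices]; exact hκ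
  have hκ1 : 1 ≤ κ := Nat.one_le_iff_ne_zero.mpr (by rintro rfl; omega)
  have hN2 : N ^ 2 ≤ κ ^ 3 * n ^ 2 := by
    calc N ^ 2 ≤ (κ * n) ^ 2 := Nat.pow_le_pow_left hNκ 2
      _ = κ ^ 2 * n ^ 2 := mul_pow _ _ _
      _ ≤ κ ^ 3 * n ^ 2 := Nat.mul_le_mul_right _ (Nat.pow_le_pow_right hκ1 (by norm_num))
  have hN3 : N ^ 3 ≤ κ ^ 3 * n ^ 3 := by
    rw [← mul_pow]; exact Nat.pow_le_pow_left hNκ 3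
  have hNN2 : N ≤ N ^ 2 := Nat.le_self_pow (by norm_num) N
  have hN23 : N ^ 2 ≤ N ^ 3 := Nat.pow_le_pow_right hN1 (by norm_num)
  induction γ using Nat.strong_induction_on generalizing G S with
  | _ γ ih =>
  obtain ⟨P, hP⟩ : ∃ P, n ^ (γ + 2) = P := ⟨_, rfl⟩
  have hn3P : n ^ 3 ≤ P := by rw [← hP]; exact Nat.pow_le_pow_right hn (by omega)
  have hn2P : n ^ 2 ≤ P := by rw [← hP]; exact Nat.pow_le_pow_right hn (by omega)
  have h2γ : 1 ≤ 2 ^ (γ - 1) := Nat.one_le_two_pow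
  rw [hP]
  -- the cost of the matching and of the copies
  have hbase : 30 * N ^ 3 + 5 * N ^ 2 ≤ 35 * κ ^ 3 * (2 ^ (γ - 1) * P) := by
    calc 30 * N ^ 3 + 5 * N ^ 2 ≤ 30 * (κ ^ 3 * P) + 5 * (κ ^ 3 * P) :=
          Nat.add_le_add
            (Nat.mul_le_mul_left _ (hN3.trans (Nat.mul_le_mul_left _ hn3P)))
            (Nat.mul_le_mul_left _ (hN2.trans (Nat.mul_le_mul_left _ hn2P)))
      _ = 35 * κ ^ 3 * (1 * P) := by ring
      _ ≤ 35 * κ ^ 3 * (2 ^ (γ - 1) * P) :=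
          Nat.mul_le_mul_left _ (Nat.mul_le_mul_right _ h2γ)
  have hmc := minCostPM_time_le vs G S
  rw [hN] at hmc
  rw [verifyRemovals, bind_time]
  rcases hval : (minCostPM vs G S).val with _ | M
  · have h300 : 35 * κ ^ 3 * (2 ^ (γ - 1) * P) ≤ 300 * κ ^ 3 * (2 ^ (γ - 1) * P) :=
      Nat.mul_le_mul_right _ (Nat.mul_le_mul_right _ (by norm_num))
    simp only [step_time]
    omega
  obtain ⟨hcons, hM, -⟩ := (findsMinCostPM_minCostPM mem_vertices nodup_vertices G S).2 M hval
  have hMtot : ∀ a, M.toR a ≠ none := fun a => by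
    obtain ⟨σ, hσ, -⟩ := hM.exists_equiv
    rw [Mates.mem_edges.mp (hσ a)]
    simp
  simp only [bind_time, charge_time, charge_val]
  set F := (foldT (edgesIn S M) [] vs).val with hF
  set S₁ : BGraph (Vertex n m p) := fun a b => S a b && !decide (M.toR a = some b) with hS₁
  -- Bounding the list by n rather than by the number of vertices keeps κ out of the powers that
  -- grow with γ.
  have hfn : F.length ≤ n := by
    refine length_feedback_le (hM.mono fun e he => hG _ _ (hM.1.1 e he))
      (nodup_edgesIn S M [] vs List.nodup_nil nodup_vertices (by simp)) fun e he => ?_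
    rw [hF, mem_edgesIn_iff] at he
    rcases he with he | ⟨-, h1, h2⟩
    · simp at he
    · exact ⟨Mates.mem_edges.mpr h1, hS _ _ h2⟩
  have hGR : ∀ R a b, removeEdges G R a b = true → sys.bipartite a b = true := fun R a b h =>
    hG a b (removeEdges_iff.mp h).1
  have hSS₁ : ∀ a b, S₁ a b = true → sys.feedbackEdges a b = true := fun a b h => by
    simp only [hS₁, Bool.and_eq_true] at h
    exact hS a b h.1
  have hfold := foldT_time_le (body := edgesIn S M) (t := 1) vs (fun _ _ _ => le_rfl) []
  rw [hN] at hfold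
  -- the cost of the removals in case `q`
  set W : Fin γ → ℕ := fun q => (forRemovals vs
    (if q.val = 0 then checkPM vs else fun G₁ _ => verifyRemovals vs (minCostPM vs) (checkPM vs)
      q.val G₁ S₁) (γ - q.val) F G M).time with hW
  have hL : N ^ 2 + 2 * N + 2 ≤ 5 * (κ ^ 3 * n ^ 2) := by omega
  have hcopies : ∀ k, k ≤ γ → 2 * (F.length + 1) ^ k * (N ^ 2 + 2 * N + 2) ≤
      10 * κ ^ 3 * P * 2 ^ k := by
    intro k hk
    have h1 : (F.length + 1) ^ k ≤ 2 ^ k * n ^ k := by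
      rw [← mul_pow]; exact Nat.pow_le_pow_left (by omega) k
    have h2 : n ^ k * n ^ 2 ≤ P := by
      rw [← hP, ← pow_add]; exact Nat.pow_le_pow_right hn (by omega)
    calc 2 * (F.length + 1) ^ k * (N ^ 2 + 2 * N + 2)
        ≤ 2 * (2 ^ k * n ^ k) * (5 * (κ ^ 3 * n ^ 2)) :=
          Nat.mul_le_mul (Nat.mul_le_mul_left _ h1) hL
      _ = 10 * κ ^ 3 * 2 ^ k * (n ^ k * n ^ 2) := by ring
      _ ≤ 10 * κ ^ 3 * 2 ^ k * P := Nat.mul_le_mul_left _ h2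
      _ = 10 * κ ^ 3 * P * 2 ^ k := by ring
  -- The three terms are the recursive calls, the checks for q = 0, and the copies; the 2 is the
  -- loop overhead per case. Real numbers allow the division by 2^γ.
  have hWq : ∀ q : Fin γ, ((W q + 2 : ℕ) : ℝ) ≤
      300 * (κ : ℝ) ^ 3 * P / 2 ^ γ * 4 ^ q.val +
        (if q.val = 0 then 11 * (κ : ℝ) ^ 3 * (2 ^ (γ - 1) * P) else 0) +
        10 * (κ : ℝ) ^ 3 * P * 2 ^ (γ - q.val) := by
    intro q
    have hq := q.isLt
    have hc := hcopies (γ - q.val) (Nat.sub_le _ _)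
    by_cases hq0 : q.val = 0
    · have h1 := forRemovals_time_add_le vs (checkPM vs) (11 * γ * (κ ^ 3 * n ^ 2)) γ F G M
        fun R _ hlen => by
          refine (checkPM_time_le vs _ _).trans ?_
          have h2 := Mates.countP_cutList_le hMtot nodup_vertices R
          rw [hlen, ← hvs] at h2
          rw [hN]
          -- Cutting γ edges of a perfect matching leaves at most γ free left vertices, hence at
          -- most γ searches.
          calc _ ≤ 2 * N + 2 + γ * (2 * N ^ 2 + 3 * N + 2) :=
                Nat.add_le_add_left (Nat.mul_le_mul_right _ h2) _
            _ ≤ 4 * (γ * N ^ 2) + γ * (7 * N ^ 2) := by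
                refine Nat.add_le_add ?_ (Nat.mul_le_mul_left _ (by omega))
                have : N ^ 2 ≤ γ * N ^ 2 := Nat.le_mul_of_pos_left _ hγ
                omega
            _ = 11 * γ * N ^ 2 := by ring
            _ ≤ 11 * γ * (κ ^ 3 * n ^ 2) := Nat.mul_le_mul_left _ hN2
      have hWeq : W q = (forRemovals vs (checkPM vs) γ F G M).time := by
        simp only [hW, hq0, if_true, Nat.sub_zero]
      rw [hN, ← hWeq] at h1
      rw [hq0, Nat.sub_zero] at hc
      have h2 : F.length.choose γ * (11 * γ * (κ ^ 3 * n ^ 2)) ≤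
          11 * κ ^ 3 * (2 ^ (γ - 1) * P) := by
        have h3 : F.length.choose γ ≤ n ^ γ :=
          (Nat.choose_le_pow _ _).trans (Nat.pow_le_pow_left hfn γ)
        have h4 : γ ≤ 2 ^ (γ - 1) := by
          have := Nat.lt_two_pow_self (n := γ - 1)
          omega
        calc _ ≤ n ^ γ * (11 * 2 ^ (γ - 1) * (κ ^ 3 * n ^ 2)) :=
              Nat.mul_le_mul h3 (Nat.mul_le_mul_right _ (Nat.mul_le_mul_left _ h4))
          _ = 11 * κ ^ 3 * (2 ^ (γ - 1) * n ^ (γ + 2)) := by ring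
          _ = _ := by rw [hP]
      have h5 : W q + 2 ≤ 11 * κ ^ 3 * (2 ^ (γ - 1) * P) + 10 * κ ^ 3 * P * 2 ^ γ := by omega
      have h6 : ((W q + 2 : ℕ) : ℝ) ≤ 11 * κ ^ 3 * (2 ^ (γ - 1) * P) + 10 * κ ^ 3 * P * 2 ^ γ := by
        exact_mod_cast h5
      have h7 : (0 : ℝ) ≤ 300 * κ ^ 3 * P / 2 ^ γ * 4 ^ q.val := by positivity
      rw [if_pos hq0, hq0, Nat.sub_zero]
      rw [hq0] at h7
      linarith
    · have h1 := forRemovals_time_add_le vs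
        (fun G₁ _ => verifyRemovals vs (minCostPM vs) (checkPM vs) q.val G₁ S₁)
        (300 * κ ^ 3 * (2 ^ (q.val - 1) * n ^ (q.val + 2))) (γ - q.val) F G M
        fun R _ _ => ih q.val hq (Nat.one_le_iff_ne_zero.mpr hq0) _ S₁ (hGR _) hSS₁
      have hWeq : W q = (forRemovals vs
          (fun G₁ _ => verifyRemovals vs (minCostPM vs) (checkPM vs) q.val G₁ S₁)
          (γ - q.val) F G M).time := by
        simp only [hW, hq0, if_false]
      rw [hN, ← hWeq] at h1
      set Y := F.length.choose (γ - q.val) *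
        (300 * κ ^ 3 * (2 ^ (q.val - 1) * n ^ (q.val + 2))) with hY
      -- The factor 2^(γ-q) is absorbed by the binomial coefficient. The remaining 2^q meets the
      -- 2^(q-1) of the inductive bound and the 2 of the binomial estimate, which gives 4^q.
      have h2 : 2 ^ γ * Y ≤ 300 * κ ^ 3 * P * 4 ^ q.val := by
        have h3 := choose_mul_two_pow_le hfn (γ - q.val)
        have h4 : 2 ^ γ = 2 ^ (γ - q.val) * 2 ^ q.val := by rw [← pow_add]; congr 1; omega
        have h5 : 2 * 2 ^ (q.val - 1) = 2 ^ q.val := by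
          rw [← pow_succ']; congr 1; omega
        have h6 : n ^ (γ - q.val) * n ^ (q.val + 2) = P := by
          rw [← hP, ← pow_add]; congr 1; omega
        calc 2 ^ γ * Y = (F.length.choose (γ - q.val) * 2 ^ (γ - q.val)) * (2 ^ q.val *
              (300 * κ ^ 3 * (2 ^ (q.val - 1) * n ^ (q.val + 2)))) := by rw [h4, hY]; ring
          _ ≤ (2 * n ^ (γ - q.val)) * (2 ^ q.val *
              (300 * κ ^ 3 * (2 ^ (q.val - 1) * n ^ (q.val + 2)))) := Nat.mul_le_mul_right _ h3
          _ = 300 * κ ^ 3 * (n ^ (γ - q.val) * n ^ (q.val + 2)) *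
              (2 ^ q.val * (2 * 2 ^ (q.val - 1))) := by ring
          _ = 300 * κ ^ 3 * P * 4 ^ q.val := by
              rw [h5, h6, ← mul_pow]; norm_num
      have h7 : W q + 2 ≤ Y + 10 * κ ^ 3 * P * 2 ^ (γ - q.val) := by omega
      have h8 : ((W q + 2 : ℕ) : ℝ) ≤ Y + 10 * κ ^ 3 * P * 2 ^ (γ - q.val) := by
        exact_mod_cast h7
      have h9 : (Y : ℝ) ≤ 300 * κ ^ 3 * P / 2 ^ γ * 4 ^ q.val := by
        rw [div_mul_eq_mul_div, le_div_iff₀ (by positivity)]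
        rw [mul_comm]
        exact_mod_cast h2
      rw [if_neg hq0]
      linarith
  -- summation
  have hsum : ((∑ q : Fin γ, (W q + 2) : ℕ) : ℝ) ≤ 251 * κ ^ 3 * (2 ^ (γ - 1) * P) := by
    rw [Nat.cast_sum]
    refine (Finset.sum_le_sum fun q _ => hWq q).trans ?_
    rw [Fin.sum_univ_eq_sum_range (fun q => 300 * (κ : ℝ) ^ 3 * P / 2 ^ γ * 4 ^ q +
      (if q = 0 then 11 * (κ : ℝ) ^ 3 * (2 ^ (γ - 1) * P) else 0) +
        10 * (κ : ℝ) ^ 3 * P * 2 ^ (γ - q)) γ, Finset.sum_add_distrib, Finset.sum_add_distrib,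
      ← Finset.mul_sum, ← Finset.mul_sum, Finset.sum_ite_eq' (Finset.range γ) 0,
      if_pos (Finset.mem_range.mpr hγ)]
    -- The sum of 4^q is at most 4^γ / 3, so the recursive calls use only two thirds of the constant
    -- 300; this closes the induction.
    have h1 : 300 * (κ : ℝ) ^ 3 * P / 2 ^ γ * ∑ q ∈ Finset.range γ, (4 : ℝ) ^ q ≤
        300 * (κ : ℝ) ^ 3 * P / 2 ^ γ * (4 ^ γ / 3) :=
      mul_le_mul_of_nonneg_left (by linarith [three_mul_sum_four_pow_le γ]) (by positivity)
    have h2 : 10 * (κ : ℝ) ^ 3 * P * ∑ q ∈ Finset.range γ, (2 : ℝ) ^ (γ - q) ≤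
        10 * (κ : ℝ) ^ 3 * P * (2 * 2 ^ γ) :=
      mul_le_mul_of_nonneg_left (sum_two_pow_sub_le γ) (by positivity)
    have h3 : (2 : ℝ) ^ γ = 2 * 2 ^ (γ - 1) := by rw [← pow_succ']; congr 1; omega
    have h4 : 300 * (κ : ℝ) ^ 3 * P / 2 ^ γ * (4 ^ γ / 3) = 100 * κ ^ 3 * P * 2 ^ γ := by
      rw [show (4 : ℝ) ^ γ = 2 ^ γ * 2 ^ γ by rw [← mul_pow]; norm_num]
      field_simp
      ring
    have h5 : 100 * (κ : ℝ) ^ 3 * P * 2 ^ γ = 200 * κ ^ 3 * (2 ^ (γ - 1) * P) := by rw [h3]; ring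
    have h6 : 10 * (κ : ℝ) ^ 3 * P * (2 * 2 ^ γ) = 40 * κ ^ 3 * (2 ^ (γ - 1) * P) := by
      rw [h3]; ring
    linarith
  have hsum' : ∑ q : Fin γ, (W q + 2) ≤ 251 * κ ^ 3 * (2 ^ (γ - 1) * P) := by exact_mod_cast hsum
  have hall := allT_time_le (fun q : Fin γ => forRemovals vs
    (if q.val = 0 then checkPM vs else fun G₁ _ => verifyRemovals vs (minCostPM vs) (checkPM vs)
      q.val G₁ S₁) (γ - q.val) F G M) (List.finRange γ)
  rw [← Fin.sum_univ_def] at hall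
  rw [hN]
  have h286 : 35 * κ ^ 3 * (2 ^ (γ - 1) * P) + 251 * κ ^ 3 * (2 ^ (γ - 1) * P) ≤
      300 * κ ^ 3 * (2 ^ (γ - 1) * P) := by
    rw [← add_mul, ← add_mul]
    exact Nat.mul_le_mul_right _ (Nat.mul_le_mul_right _ (by norm_num))
  have hall' := hall.trans (Nat.add_le_add_right hsum' 1)
  omega

/-- A system all of whose perfect matchings contain a feedback edge has a state. -/
theorem one_le_of_feedback {sys : ClosedLoop n m p}
    (hfb : ∀ M, IsPerfectMatching sys.bipartite M → ∃ e ∈ M, sys.feedbackEdges e.1 e.2 = true) :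
    1 ≤ n := by
  by_contra h0
  obtain rfl : n = 0 := by omega
  obtain ⟨e, he, hfe⟩ := hfb _ (.of_equiv (Equiv.refl _) fun a => by
    rcases a with i | i | i
    · exact i.elim0
    · simp [bipartite]
    · simp [bipartite])
  obtain ⟨a, -, rfl⟩ := Finset.mem_map.mp he
  rcases a with i | i | i <;> simp [feedbackEdges] at hfe

theorem verifyRemovals_val_iff_resilient {sys : ClosedLoop n m p} {γ : ℕ}
    {mc : BGraph (Vertex n m p) → BGraph (Vertex n m p) → Timed (Option (Mates (Vertex n m p)))}
    {chk : BGraph (Vertex n m p) → Mates (Vertex n m p) → Timed Bool} (hirr : sys.Irreducible)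
    (hfb : ∀ M, IsPerfectMatching sys.bipartite M → ∃ e ∈ M, sys.feedbackEdges e.1 e.2 = true)
    (hγ : 1 ≤ γ) (hmc : FindsMinCostPM mc) (hchk : ChecksPM chk) :
    (verifyRemovals (vertices n m p) mc chk γ sys.bipartite sys.feedbackEdges).val = true ↔
      sys.Resilient γ := by
  rw [verifyRemovals_val_iff mem_vertices nodup_vertices hmc hchk γ hγ, resilient_iff hirr hfb]

theorem verify_time_le {sys : ClosedLoop n m p} {κ γ : ℕ} (hn : 1 ≤ n)
    (hκ : n + m + p ≤ κ * n) (hγ : 1 ≤ γ) :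
    (sys.verify γ).time ≤ 302 * κ ^ 3 * (2 ^ (γ - 1) * n ^ (γ + 2)) := by
  have h1 := verifyRemovals_time_le (sys := sys) hn hκ γ hγ sys.bipartite sys.feedbackEdges
    (fun _ _ h => h) (fun _ _ h => h)
  have hκ1 : 1 ≤ κ := Nat.one_le_iff_ne_zero.mpr (by rintro rfl; omega)
  have h2 : (n + m + p) ^ 2 ≤ κ ^ 3 * (2 ^ (γ - 1) * n ^ (γ + 2)) := by
    calc (n + m + p) ^ 2 ≤ (κ * n) ^ 2 := Nat.pow_le_pow_left hκ 2
      _ = κ ^ 2 * (1 * n ^ 2) := by ring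
      _ ≤ κ ^ 3 * (2 ^ (γ - 1) * n ^ (γ + 2)) :=
        Nat.mul_le_mul (Nat.pow_le_pow_right hκ1 (by norm_num))
          (Nat.mul_le_mul Nat.one_le_two_pow (Nat.pow_le_pow_right hn (by omega)))
  have h3 : 302 * κ ^ 3 * (2 ^ (γ - 1) * n ^ (γ + 2)) =
      300 * κ ^ 3 * (2 ^ (γ - 1) * n ^ (γ + 2)) + 2 * (κ ^ 3 * (2 ^ (γ - 1) * n ^ (γ + 2))) := by
    ring
  rw [verify]
  simp only [bind_time, charge_time, charge_val, length_vertices]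
  omega

end ClosedLoop

theorem theorem8 :
    -- correctness, whatever minimum cost perfect matchings are chosen
    (∀ (n m p : ℕ) (sys : ClosedLoop n m p) (γ : ℕ)
        (mc : BGraph (ClosedLoop.Vertex n m p) → BGraph (ClosedLoop.Vertex n m p) →
          Timed (Option (Mates (ClosedLoop.Vertex n m p))))
        (chk : BGraph (ClosedLoop.Vertex n m p) → Mates (ClosedLoop.Vertex n m p) → Timed Bool),
        sys.Irreducible →
        (∀ M, IsPerfectMatching sys.bipartite M → ∃ e ∈ M, sys.feedbackEdges e.1 e.2 = true) →
        1 ≤ γ → FindsMinCostPM mc → ChecksPM chk →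
        ((verifyRemovals (ClosedLoop.vertices n m p) mc chk γ sys.bipartite
            sys.feedbackEdges).val = true ↔ sys.Resilient γ)) ∧
    -- the two subroutines are correct
    (∀ n m p : ℕ, FindsMinCostPM (minCostPM (ClosedLoop.vertices n m p)) ∧
        ChecksPM (checkPM (ClosedLoop.vertices n m p))) ∧
    -- correctness and running time of the algorithm with these subroutines
    (∀ c : ℝ, ∃ T : ℝ, ∀ (n m p : ℕ) (sys : ClosedLoop n m p) (γ : ℕ),
        (m : ℝ) ≤ c * n → (p : ℝ) ≤ c * n →
        sys.Irreducible →
        (∀ M, IsPerfectMatching sys.bipartite M → ∃ e ∈ M, sys.feedbackEdges e.1 e.2 = true) →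
        1 ≤ γ →
        ((sys.verify γ).val = true ↔ sys.Resilient γ) ∧
          ((sys.verify γ).time : ℝ) ≤ T * (2 ^ (γ - 1) * (n : ℝ) ^ ((γ : ℝ) + 5 / 2))) := by
  refine ⟨fun n m p sys γ mc chk hirr hfb hγ hmc hchk =>
      ClosedLoop.verifyRemovals_val_iff_resilient hirr hfb hγ hmc hchk,
    fun n m p => ⟨findsMinCostPM_minCostPM ClosedLoop.mem_vertices ClosedLoop.nodup_vertices,
      checksPM_checkPM ClosedLoop.mem_vertices ClosedLoop.nodup_vertices⟩, fun c => ?_⟩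
  -- Here κ = 1 + 2⌈c⌉₊ bounds (n + m + p) / n. The constant is 300 for the procedure and 2 for
  -- setting up the graph and the set of its feedback edges.
  refine ⟨302 * (1 + 2 * ⌈c⌉₊ : ℕ) ^ 3, fun n m p sys γ hm hp hirr hfb hγ => ⟨?_, ?_⟩⟩
  · exact ClosedLoop.verifyRemovals_val_iff_resilient hirr hfb hγ
      (findsMinCostPM_minCostPM ClosedLoop.mem_vertices ClosedLoop.nodup_vertices)
      (checksPM_checkPM ClosedLoop.mem_vertices ClosedLoop.nodup_vertices)
  · have hn := ClosedLoop.one_le_of_feedback hfb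
    have hle : ∀ k : ℕ, (k : ℝ) ≤ c * n → k ≤ ⌈c⌉₊ * n := fun k hk => by
      have : (k : ℝ) ≤ ⌈c⌉₊ * n :=
        hk.trans (mul_le_mul_of_nonneg_right (Nat.le_ceil c) (Nat.cast_nonneg n))
      exact_mod_cast this
    have hκ : n + m + p ≤ (1 + 2 * ⌈c⌉₊) * n := by
      have h1 := hle m hm
      have h2 := hle p hp
      linarith
    have h1 : ((sys.verify γ).time : ℝ) ≤
        302 * (1 + 2 * ⌈c⌉₊ : ℕ) ^ 3 * (2 ^ (γ - 1) * (n : ℝ) ^ (γ + 2)) := by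
      exact_mod_cast ClosedLoop.verify_time_le (sys := sys) hn hκ hγ
    refine h1.trans (mul_le_mul_of_nonneg_left (mul_le_mul_of_nonneg_left ?_ (by positivity))
      (by positivity))
    -- Since n ≥ 1, the exponent γ + 2 may be raised to γ + 5/2.
    rw [← Real.rpow_natCast]
    refine Real.rpow_le_rpow_of_exponent_le (by exact_mod_cast hn) ?_
    push_cast
    linarith
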